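/- **Theorem.** *(Four-round distributed $(1-\frac1e-\varepsilon)$-approximation for $k$-dominating set.)* In $k$-dominating set one is given a graph $G$ on $n$ vertices and $0\le k\le n$. A set $S$ of vertices dominates the set $S\cup\Gamma_G(S)$, where $\Gamma_G(S)$ is the set of all neighbours of vertices of $S$. A set $S$ of exactly $k$ vertices is an $\alpha$-approximate solution if $|S\cup\Gamma_G(S)|\ge\alpha\,|T\cup\Gamma_G(T)|$ for every set $T$ of $k$ vertices. *Model.* There are $n$ machines, numbered $0,\dots,n-1$; the vertices are also numbered $0,\dots,n-1$. Each machine is a random access machine whose registers hold natural numbers, with arithmetic, indirect addressing, branching, loops and private independent fair coins. At the beginning, machine $i$ knows $n$, $k$, its own number $i$, and its share of the input: the edges of $G$ are split arbitrarily among the machines, each edge being stored once, on one machine, and each machine holding at most $n$ edges. In each round every machine receives the messages sent to it in the previous round, runs the program of this round on its memory, and sends messages to other machines; memories are kept between rounds. The output is the set of the contents of the messages sent by machine $0$ in the last round. The space used by a machine at a moment is the number of bits of its nonzero registers (addresses and contents), of the items received and not yet read, and of the messages sent in the current round. A four-round algorithm is a list of four programs, one for each round, the same for all machines and all inputs. *Claim.*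 There is an absolute constant $c$ such that for every $\varepsilon\in(0,1]$ there are a constant $C$ and a four-round algorithm such that, for every $n\ge1$, every $0\le k\le n$, every graph $G$ on the vertices $0,\dots,n-1$ and every splitting of its edges as above: 1. for all outcomes of the coins, all programs halt and no machine ever uses more than $C\,n\,(\lfloor\log_2 n\rfloor+1)^c=\tilde O(n)$ bits of space; 2. with probability at least $1-\frac2n$ over the coins, the output is a $\left(1-\frac1e-\varepsilon\right)$-approximate solution to $k$-dominating set on $G$. -/

import Mathlib

/-! ### Local computation: random access machines with space measured in bits -/

/-- Arithmetic operations of a random access machine (on `ℕ`; subtraction is truncated). -/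
inductive RamOp where
  | add | sub | mul | div

/-- Value of an arithmetic operation. -/
def RamOp.eval : RamOp → ℕ → ℕ → ℕ
  | .add, a, b => a + b
  | .sub, a, b => a - b
  | .mul, a, b => a * b
  | .div, a, b => a / b

/-- Elementary instructions. Register names are natural numbers. -/
inductive RamInstr where
  /-- `x := c` -/
  | const (x c : ℕ)
  /-- `x := y op z` -/
  | arith (op : RamOp) (x y z : ℕ)
  /-- `x :=` the register whose address is stored in `y` -/
  | load (x y : ℕ)
  /-- the register whose address is stored in `x` receives the contents of `y` -/
  | store (x y : ℕ)
  /-- `x :=` a fresh fair coin in `{0, 1}` -/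
  | flip (x : ℕ)
  /-- remove the first item `(a, b)` of the inbox and set `x := 1`, `y := a`, `z := b`;
  if the inbox is empty, set `x := 0` -/
  | recv (x y z : ℕ)
  /-- send the contents of `y` to the machine whose number is stored in `x` -/
  | send (x y : ℕ)

/-- Programs, built from elementary instructions by the usual control structures. -/
inductive RamProg where
  | skip
  | instr (i : RamInstr)
  | seq (p q : RamProg)
  /-- run `p` if register `x` is nonzero, otherwise `q` -/
  | ite (x : ℕ) (p q : RamProg)
  /-- repeat `p` as long as register `x` is nonzero -/
  | loop (x : ℕ) (p : RamProg)

/-- The state of one machine: its memory, the items received and not yet read (pairs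
`(sender, contents)` or, at the beginning, the input edges), the messages sent in the current
round (pairs `(destination, contents)`), and the coins not yet used. -/
structure MachineState where
  mem : ℕ →₀ ℕ
  inbox : List (ℕ × ℕ)
  outbox : List (ℕ × ℕ)
  coins : ℕ → Bool

/-- Number of bits charged for a list of items. -/
def itemBits (l : List (ℕ × ℕ)) : ℕ :=
  (l.map fun m => 1 + Nat.size m.1 + Nat.size m.2).sum

/-- Number of bits used by a machine: for each nonzero register the bits of its address and of
its contents, and all items received and not yet read, and all items sent in this round. -/
noncomputable def MachineState.space (s : MachineState) : ℕ :=
  (s.mem.sum fun a v => Nat.size a + Nat.size v) + itemBits s.inbox + itemBits s.outbox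

/-- Overwrite a register. -/
noncomputable def MachineState.set (s : MachineState) (x v : ℕ) : MachineState :=
  { s with mem := s.mem.update x v }

/-- Effect of an elementary instruction. -/
noncomputable def RamInstr.step : RamInstr → MachineState → MachineState
  | .const x c, s => s.set x c
  | .arith op x y z, s => s.set x (op.eval (s.mem y) (s.mem z))
  | .load x y, s => s.set x (s.mem (s.mem y))
  | .store x y, s => s.set (s.mem x) (s.mem y)
  | .flip x, s => { s.set x (s.coins 0).toNat with coins := fun i => s.coins (i + 1) }
  | .recv x y z, s =>
    match s.inbox with
    | [] => s.set x 0
    | m :: l => { ((s.set x 1).set y m.1).set z m.2 with inbox := l }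
  | .send x y, s => { s with outbox := s.outbox ++ [(s.mem x, s.mem y)] }

/-- `RamExec B p s t`: started in state `s`, the program `p` halts in state `t`, and no state on
the way, including `s` and `t`, uses more than `B` bits. -/
inductive RamExec (B : ℕ) : RamProg → MachineState → MachineState → Prop where
  | skip {s} : s.space ≤ B → RamExec B .skip s s
  | instr {i s} : s.space ≤ B → (i.step s).space ≤ B → RamExec B (.instr i) s (i.step s)
  | seq {p q s t u} : RamExec B p s t → RamExec B q t u → RamExec B (.seq p q) s u
  | iteTrue {x p q s t} : s.mem x ≠ 0 → RamExec B p s t → RamExec B (.ite x p q) s t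
  | iteFalse {x p q s t} : s.mem x = 0 → RamExec B q s t → RamExec B (.ite x p q) s t
  | loopStop {x p s} : s.space ≤ B → s.mem x = 0 → RamExec B (.loop x p) s s
  | loopStep {x p s t u} : s.mem x ≠ 0 → RamExec B p s t → RamExec B (.loop x p) t u →
      RamExec B (.loop x p) s u

/-! ### Distributed computation in rounds -/

/-- Communication at the end of a round: memories are kept, and the inbox of machine `j` consists
of all messages addressed to `j`, tagged by their senders, by increasing number of the sender and
in the order of sending. -/
def deliverMessages {n : ℕ} (s : Fin n → MachineState) (j : Fin n) : MachineState where
  mem := (s j).mem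
  inbox := (List.finRange n).flatMap fun i =>
    ((s i).outbox.filter fun m => m.1 = j.val).map fun m => (i.val, m.2)
  outbox := []
  coins := (s j).coins

/-- `DistributedRun B P s t`: `n` machines, started in the states `s`, work for `P.length` rounds
and end in the states `t`. In each round all machines run the program of that round; between
two rounds the messages are delivered. All programs halt and no machine ever uses more than
`B` bits. -/
inductive DistributedRun {n : ℕ} (B : ℕ) :
    List RamProg → (Fin n → MachineState) → (Fin n → MachineState) → Prop where
  | last {p s t} : (∀ i, RamExec B p (s i) (t i)) → DistributedRun B [p] s t
  | next {p P s t u} : (∀ i, RamExec B p (s i) (t i)) →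
      DistributedRun B P (deliverMessages t) u → DistributedRun B (p :: P) s u

/-- The list `inp i` of edges held by machine `i` at the beginning is a splitting of the edges of
`G` among the `n` machines: each edge is stored once, on one machine, in one of its two
orientations, and no machine holds more than `n` edges. -/
def IsEdgeSplit {n : ℕ} (G : SimpleGraph (Fin n)) (inp : Fin n → List (Fin n × Fin n)) : Prop :=
  (∀ i, (inp i).length ≤ n) ∧
  (∀ e ∈ G.edgeSet, ∑ i, ((inp i).map fun p => s(p.1, p.2)).count e = 1) ∧
  (∀ e ∉ G.edgeSet, ∑ i, ((inp i).map fun p => s(p.1, p.2)).count e = 0)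

/-- Initial states: machine `i` knows the number `n` of vertices (and of machines), the
parameter `k` and its own number `i` (in registers `0`, `1`, `2`); its inbox contains its share of
the edges, and it owns the private coins `ω (i, 0), ω (i, 1), …`. -/
noncomputable def initialStates {n : ℕ} (k : ℕ) (inp : Fin n → List (Fin n × Fin n))
    (ω : Fin n × ℕ → Bool) (i : Fin n) : MachineState where
  mem := Finsupp.single 0 n + Finsupp.single 1 k + Finsupp.single 2 i.val
  inbox := (inp i).map fun p => (p.1.val, p.2.val)
  outbox := []
  coins := fun j => ω (i, j)

/-- The law of the coins of all `n` machines: independent fair coins. -/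
noncomputable def coinMeasure (n : ℕ) : MeasureTheory.Measure (Fin n × ℕ → Bool) :=
  MeasureTheory.Measure.infinitePi fun _ => (PMF.uniformOfFintype Bool).toMeasure

/-- In the final states `t`, the set reported by machine `0`, i.e. the set of the contents of the
messages that it sends in the last round, is `S`. -/
def ReportsSet {n : ℕ} [NeZero n] (t : Fin n → MachineState) (S : Finset (Fin n)) : Prop :=
  ((t 0).outbox.map Prod.snd).toFinset = S.map Fin.valEmbedding

/-! ### The `k`-dominating set problem -/

/-- The set `S ∪ Γ(S)` of the vertices dominated by `S`. -/
def dominatedSet {V : Type*} (G : SimpleGraph V) (S : Finset V) : Set V :=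
  {v | v ∈ S ∨ ∃ u ∈ S, G.Adj u v}

/-- `S` is an `α`-approximate solution to `k`-dominating set on `G`: it consists of `k` vertices
and dominates at least `α` times as many vertices as any set of `k` vertices. -/
def IsApproxKDominating {V : Type*} (G : SimpleGraph V) (k : ℕ) (α : ℝ) (S : Finset V) : Prop :=
  S.card = k ∧
  ∀ T : Finset V, T.card = k → α * (dominatedSet G T).ncard ≤ (dominatedSet G S).ncard

/-!
The statement bounds space and the number of rounds, but not time. So it is enough to bring to
machine `0`, in three rounds, a sketch of the graph with `O(n log n)` items from which the value of
every set of `k` vertices can be estimated up to a constant factor slightly below `1`; machine `0`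
then tries all sets. The total loss is `15 / 16 * 11 / 16 = 165 / 256 > 1 - 1 / e`
(`one_sub_inv_exp_le`), so a single algorithm serves all `ε`.

*The sketch.* A set `S` dominates `v` if it meets the closed neighbourhood of `v`. Every closed
neighbourhood is truncated to its `D = 512 n / k + 1` smallest members. This costs at most a
sixteenth of the optimum (`exists_covered_truncated`): a sixteenth of an optimal solution is
exchanged for vertices that hit most of the truncated neighbourhoods, each of which is so large
that `k / 16` random vertices hit it with probability at least `15 / 16`. On the other hand
neighbourhoods of size `O(n / k)` force the optimum `M` to be proportional to `k / n` times the sum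
`T` of the truncated degrees (`exists_covered_ge`). Hence if vertices `v` are sampled with
probability `p` such that `p T` is of order `n log n`, then `p M` is at least a large multiple of
`k log n`. By Chernoff bounds and a union bound over at most `n ^ k` sets, with high probability
every set that beats an optimal one within the sample covers at least `11 M / 16` vertices
(`representative_whp`).

*The rounds.* Edges are sent to their end points, so that every vertex knows its neighbours.
Machine `v` flips `n` coins, takes as its level the number of ones at the end, and broadcasts its
level and its truncated degree. All machines then know `T`, the least level `j` for which
`T / 2 ^ j` is small enough, and the exact size of the sample formed by the vertices of level at
least `j`, which is a sample with `p = 2 ^ (-j)` (`representative_level_whp`). If this size exceeds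
four times the bound for its expectation, nothing is sent; this makes the space bound hold for all
outcomes of the coins. Otherwise the sampled machines send their truncated neighbourhoods to machine
`0`, which searches all bit masks (`exists_run`, `exists_reported`).

*The machine.* The programs use a constant number of registers with long contents; a list of items
is stored as one number, its items being the digits (`listCode`). Programs are composed of
expressions, for which `Evals` records both the value and the space bound, so that it suffices to
bound all intermediate values by `2 ^ (O(n log² n))` and the numbers of items received and sent by
`O(n log n)`. Thus the exponent of the logarithm is `2`.
-/

/-! ### Memory bounds and straight-line steps -/

/-- One more than the largest register named in a program without indirect addressing; loads and
stores through pointers are not used below, and their value here is arbitrary. -/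
def RamInstr.regBound : RamInstr → ℕ
  | .const x _ => x + 1
  | .arith _ x y z => max (x + 1) (max (y + 1) (z + 1))
  | .load _ _ => 0
  | .store _ _ => 0
  | .flip x => x + 1
  | .recv x y z => max (x + 1) (max (y + 1) (z + 1))
  | .send x y => max (x + 1) (y + 1)

/-- One more than the largest register named in a program. -/
def RamProg.regBound : RamProg → ℕ
  | .skip => 0
  | .instr i => i.regBound
  | .seq p q => max p.regBound q.regBound
  | .ite x p q => max (x + 1) (max p.regBound q.regBound)
  | .loop x p => max (x + 1) p.regBound

/-- A budget: `R` registers of at most `b` bits each, and `J` bits for the messages. -/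
structure Budget where
  R : ℕ
  b : ℕ
  J : ℕ

/-- The space, in bits, that a budget allows for. -/
def Budget.total (L : Budget) : ℕ := L.R * (L.R + L.b) + L.J

/-- The state keeps within the budget. -/
structure Fits (L : Budget) (s : MachineState) : Prop where
  lt : ∀ x, s.mem x < 2 ^ L.b
  zero : ∀ x, L.R ≤ x → s.mem x = 0
  items : itemBits s.inbox + itemBits s.outbox ≤ L.J

theorem Fits.space_le {L : Budget} {s : MachineState} (h : Fits L s) : s.space ≤ L.total := by
  have h1 : (s.mem.sum fun a v => Nat.size a + Nat.size v) ≤ L.R * (L.R + L.b) := by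
    have hs : s.mem.support ⊆ Finset.range L.R := by
      intro x hx
      by_contra hx'
      exact (Finsupp.mem_support_iff.1 hx) (h.zero x (by simpa using hx'))
    calc (s.mem.sum fun a v => Nat.size a + Nat.size v)
        ≤ ∑ x ∈ s.mem.support, (L.R + L.b) := by
          refine Finset.sum_le_sum fun x hx => Nat.add_le_add ?_ (Nat.size_le.2 (h.lt x))
          have := Finset.mem_range.1 (hs hx)
          exact Nat.size_le.2 (this.trans Nat.lt_two_pow_self)
      _ ≤ _ := by
          rw [Finset.sum_const, smul_eq_mul]
          exact Nat.mul_le_mul_right _ (by simpa using Finset.card_le_card hs)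
  have := h.items
  unfold MachineState.space Budget.total
  omega

theorem MachineState.set_mem (s : MachineState) (x v y : ℕ) :
    (s.set x v).mem y = if y = x then v else s.mem y := by
  simp [MachineState.set, Finsupp.update, Function.update_apply]

theorem Fits.set {L : Budget} {s : MachineState} (h : Fits L s) {x v : ℕ} (hx : x < L.R)
    (hv : v < 2 ^ L.b) : Fits L (s.set x v) := by
  refine ⟨fun y => ?_, fun y hy => ?_, h.items⟩
  · rw [MachineState.set_mem]; split_ifs
    · exact hv
    · exact h.lt y
  · rw [MachineState.set_mem, if_neg (by omega)]; exact h.zero y hy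

/-- The states differ at most in their memories: the coins also are the same. -/
structure SameMessages (s t : MachineState) : Prop where
  inbox : t.inbox = s.inbox
  outbox : t.outbox = s.outbox
  coins : t.coins = s.coins

theorem SameMessages.refl (s : MachineState) : SameMessages s s := ⟨rfl, rfl, rfl⟩

theorem SameMessages.trans {s t u : MachineState} (h : SameMessages s t)
    (h' : SameMessages t u) : SameMessages s u :=
  ⟨h'.inbox.trans h.inbox, h'.outbox.trans h.outbox, h'.coins.trans h.coins⟩

theorem SameMessages.set (s : MachineState) (x v : ℕ) : SameMessages s (s.set x v) :=
  ⟨rfl, rfl, rfl⟩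

theorem exec_const {L : Budget} {s : MachineState} (h : Fits L s) {x c : ℕ} (hx : x < L.R)
    (hc : c < 2 ^ L.b) :
    RamExec L.total (.instr (.const x c)) s (s.set x c) :=
  RamExec.instr (i := .const x c) h.space_le (h.set hx hc).space_le

theorem exec_arith {L : Budget} {s : MachineState} (h : Fits L s) {x y z : ℕ} (op : RamOp)
    (hx : x < L.R) (hc : op.eval (s.mem y) (s.mem z) < 2 ^ L.b) :
    RamExec L.total (.instr (.arith op x y z)) s (s.set x (op.eval (s.mem y) (s.mem z))) :=
  RamExec.instr (i := .arith op x y z) h.space_le (h.set hx hc).space_le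

/-! ### Expressions -/

/-- An expression is given by the code that evaluates it: `e m` leaves the value in register `m`
and uses the registers from `m` on as its workspace. -/
abbrev RamExpr := ℕ → RamProg

/-- `Evals L e m σ v`: in every state that fits the budget `L` and whose registers below `m` agree
with `σ`, the expression `e` has the value `v`; its evaluation, at any level `m' ≥ m`, stays within
the budget and changes no register below `m'`. -/
def Evals (L : Budget) (e : RamExpr) (m : ℕ) (σ : ℕ → ℕ) (v : ℕ) : Prop :=
  v < 2 ^ L.b ∧ ∀ m', m ≤ m' → (e m').regBound ≤ L.R → ∀ s, Fits L s → (∀ x < m, s.mem x = σ x) →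
    ∃ t, RamExec L.total (e m') s t ∧ Fits L t ∧ t.mem m' = v ∧ (∀ x < m', t.mem x = s.mem x) ∧
      SameMessages s t

theorem Evals.lt {L : Budget} {e : RamExpr} {m : ℕ} {σ : ℕ → ℕ} {v : ℕ} (h : Evals L e m σ v) :
    v < 2 ^ L.b := h.1

theorem Evals.of_eq {L : Budget} {e : RamExpr} {m : ℕ} {σ : ℕ → ℕ} {v w : ℕ}
    (h : Evals L e m σ v) (hv : v = w) : Evals L e m σ w := hv ▸ h

theorem Evals.mono {L : Budget} {e : RamExpr} {m m' : ℕ} {σ σ' : ℕ → ℕ} {v : ℕ}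
    (h : Evals L e m σ v) (hm : m ≤ m') (hσ : ∀ x < m, σ' x = σ x) : Evals L e m' σ' v :=
  ⟨h.1, fun m'' hm'' hR s hs hx => h.2 m'' (hm.trans hm'') hR s hs
    fun x hxm => (hx x (by omega)).trans (hσ x hxm)⟩

/-- The contents of a register. -/
def varE (x : ℕ) : RamExpr := fun m =>
  .seq (.instr (.const m 0)) (.instr (.arith .add m x m))

/-- A numeral. -/
def litE (c : ℕ) : RamExpr := fun m => .instr (.const m c)

/-- An arithmetic operation. -/
def opE (op : RamOp) (e₁ e₂ : RamExpr) : RamExpr := fun m =>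
  .seq (e₁ m) (.seq (e₂ (m + 1)) (.instr (.arith op m m (m + 1))))

/-- Iteration: starting with the value of `init`, apply `body` for the indices below the value of
`cnt`, in decreasing order. The arguments of `body` are the current value and the index. -/
def foldE (cnt init : RamExpr) (body : RamExpr → RamExpr → RamExpr) : RamExpr := fun m =>
  .seq (init m) (.seq (cnt (m + 1)) (.loop (m + 1)
    (.seq (.seq (.instr (.const (m + 2) 1)) (.instr (.arith .sub (m + 1) (m + 1) (m + 2))))
      (.seq (body (varE m) (varE (m + 1)) (m + 2))
        (.seq (.instr (.const m 0)) (.instr (.arith .add m (m + 2) m)))))))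

section
variable {L : Budget} {m : ℕ} {σ : ℕ → ℕ}

/-- Copying a register through a fresh one. -/
theorem exec_copy {s : MachineState} (h : Fits L s) {x m : ℕ} (hx : x ≠ m) (hm : m < L.R) :
    RamExec L.total (.seq (.instr (.const m 0)) (.instr (.arith .add m x m))) s
      ((s.set m 0).set m (s.mem x)) := by
  have h0 := h.set hm (v := 0) (by positivity)
  refine .seq (exec_const h hm (by positivity)) ?_
  have := exec_arith (x := m) (y := x) (z := m) h0 .add hm
    (by simpa [RamOp.eval, MachineState.set_mem, hx] using h.lt x)
  simpa [RamOp.eval, MachineState.set_mem, hx] using this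

theorem Evals.var {x : ℕ} (hx : x < m) (hσ : σ x < 2 ^ L.b) : Evals L (varE x) m σ (σ x) := by
  refine ⟨hσ, fun m' hm hR s hs hag => ?_⟩
  simp only [varE, RamProg.regBound, RamInstr.regBound] at hR
  refine ⟨_, exec_copy hs (by omega) (by omega),
    (hs.set (by omega) (by positivity)).set (by omega) (hs.lt x), ?_, ?_, ⟨rfl, rfl, rfl⟩⟩
  · simp [MachineState.set_mem, hag x hx]
  · intro y hy
    simp [MachineState.set_mem, hy.ne]

theorem Evals.lit {c : ℕ} (hc : c < 2 ^ L.b) : Evals L (litE c) m σ c := by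
  refine ⟨hc, fun m' hm hR s hs hag => ?_⟩
  simp only [litE, RamProg.regBound, RamInstr.regBound] at hR
  refine ⟨_, exec_const hs (by omega) hc, hs.set (by omega) hc, ?_, ?_, SameMessages.set _ _ _⟩
  · simp [MachineState.set_mem]
  · intro y hy
    simp [MachineState.set_mem, hy.ne]

theorem Evals.op (op : RamOp) {e₁ e₂ : RamExpr} {v₁ v₂ : ℕ} (h₁ : Evals L e₁ m σ v₁)
    (h₂ : Evals L e₂ m σ v₂) (hv : op.eval v₁ v₂ < 2 ^ L.b) :
    Evals L (opE op e₁ e₂) m σ (op.eval v₁ v₂) := by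
  refine ⟨hv, fun m' hm hR s hs hag => ?_⟩
  simp only [opE, RamProg.regBound, RamInstr.regBound] at hR
  obtain ⟨t, ht, hft, hv1, hlt, hio⟩ := h₁.2 m' hm (by omega) s hs hag
  obtain ⟨u, hu, hfu, hv2, hlu, hio'⟩ := h₂.2 (m' + 1) (by omega) (by omega) t hft
    fun x hx => (hlt x (by omega)).trans (hag x hx)
  have hv1' : u.mem m' = v₁ := (hlu m' (by omega)).trans hv1
  refine ⟨_, .seq ht (.seq hu (exec_arith (x := m') hfu op (by omega) (by rwa [hv1', hv2]))),
    hfu.set (by omega) (by rwa [hv1', hv2]), ?_, ?_,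
    (hio.trans hio').trans (SameMessages.set _ _ _)⟩
  · simp [MachineState.set_mem, hv1', hv2]
  · intro y hy
    simp [MachineState.set_mem, hy.ne, hlu y (by omega), hlt y hy]

/-- The rule for loops: `g i` is the value accumulated after the indices from `i` on. The body is
analysed for arbitrary expressions in the place of the accumulated value and of the index, at an
arbitrary level, so that loops can be nested. -/
theorem Evals.fold {cnt init : RamExpr} {body : RamExpr → RamExpr → RamExpr} {N : ℕ} {g : ℕ → ℕ}
    (hc : Evals L cnt m σ N) (hi : Evals L init m σ (g N))
    (hb : ∀ i < N, ∀ (m' : ℕ) (σ' : ℕ → ℕ) (ea ei : RamExpr), m ≤ m' → (∀ x < m, σ' x = σ x) →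
      Evals L ea m' σ' (g (i + 1)) → Evals L ei m' σ' i → Evals L (body ea ei) m' σ' (g i)) :
    Evals L (foldE cnt init body) m σ (g 0) := by
  have hg : ∀ i ≤ N, g i < 2 ^ L.b := by
    intro i hiN
    induction hiN using Nat.decreasingInduction with
    | of_succ i hi ih =>
      have h1 := hc.lt
      refine (hb i hi (m + 2) (fun x => if x = m then g (i + 1) else if x = m + 1 then i else σ x)
        (varE m) (varE (m + 1)) (by omega) ?_ ?_ ?_).lt
      · intro x hx
        simp [hx.ne, show x ≠ m + 1 by omega]
      · simpa using Evals.var (L := L) (m := m + 2) (x := m)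
          (σ := fun x => if x = m then g (i + 1) else if x = m + 1 then i else σ x)
          (by omega) (by simpa using ih)
      · simpa using Evals.var (L := L) (m := m + 2) (x := m + 1)
          (σ := fun x => if x = m then g (i + 1) else if x = m + 1 then i else σ x)
          (by omega) (by simp; omega)
    | self => exact hi.lt
  refine ⟨hg 0 (Nat.zero_le _), fun m' hm hR s hs hag => ?_⟩
  -- register `m'` holds the accumulated value, register `m' + 1` the number of remaining indices
  simp only [foldE, RamProg.regBound, RamInstr.regBound] at hR
  obtain ⟨t, ht, hft, hv1, hlt, hio⟩ := hi.2 m' hm (by omega) s hs hag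
  obtain ⟨u, hu, hfu, hv2, hlu, hio'⟩ := hc.2 (m' + 1) (by omega) (by omega) t hft
    fun x hx => (hlt x (by omega)).trans (hag x hx)
  have key : ∀ i ≤ N, ∀ u, Fits L u → u.mem m' = g i → u.mem (m' + 1) = i →
      (∀ x < m', u.mem x = s.mem x) → ∃ w, RamExec L.total (.loop (m' + 1)
    (.seq (.seq (.instr (.const (m' + 2) 1)) (.instr (.arith .sub (m' + 1) (m' + 1) (m' + 2))))
      (.seq (body (varE m') (varE (m' + 1)) (m' + 2))
        (.seq (.instr (.const m' 0)) (.instr (.arith .add m' (m' + 2) m')))))) u w ∧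
        Fits L w ∧ w.mem m' = g 0 ∧ (∀ x < m', w.mem x = s.mem x) ∧ SameMessages u w := by
    intro i
    induction i with
    | zero =>
      intro _ u hu h1 h2 h3
      exact ⟨u, .loopStop hu.space_le h2, hu, h1, h3, SameMessages.refl _⟩
    | succ i ih =>
      intro hiN u hu h1 h2 h3
      have h1V : 1 < 2 ^ L.b := by
        have := hc.lt; omega
      have hf1 : Fits L (u.set (m' + 2) 1) := hu.set (by omega) h1V
      have e1 := exec_const hu (x := m' + 2) (by omega) h1V
      have hval : RamOp.sub.eval ((u.set (m' + 2) 1).mem (m' + 1))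
          ((u.set (m' + 2) 1).mem (m' + 2)) = i := by
        simp [RamOp.eval, MachineState.set_mem, h2]
      have hiV : i < 2 ^ L.b := by have := hc.lt; omega
      have e2 := exec_arith (x := m' + 1) (y := m' + 1) (z := m' + 2) hf1 .sub (by omega)
        (by rw [hval]; exact hiV)
      rw [hval] at e2
      have hf2 := hf1.set (x := m' + 1) (by omega) hiV
      set u2 := (u.set (m' + 2) 1).set (m' + 1) i with hu2
      have u2m : u2.mem m' = g (i + 1) := by simp [hu2, MachineState.set_mem, h1]
      have u2i : u2.mem (m' + 1) = i := by simp [hu2, MachineState.set_mem]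
      have u2x : ∀ x < m', u2.mem x = s.mem x := by
        intro x hx
        simp [hu2, MachineState.set_mem, show x ≠ m' + 1 by omega, show x ≠ m' + 2 by omega,
          h3 x hx]
      have hB := hb i (by omega) (m' + 2) u2.mem (varE m') (varE (m' + 1)) (by omega)
        (fun x hx => (u2x x (by omega)).trans (hag x hx))
        (by have := Evals.var (L := L) (m := m' + 2) (σ := u2.mem) (x := m') (by omega) (hf2.lt _)
            rwa [u2m] at this)
        (by have := Evals.var (L := L) (m := m' + 2) (σ := u2.mem) (x := m' + 1) (by omega)
              (hf2.lt _)
            rwa [u2i] at this)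
      obtain ⟨w, hw, hfw, hwv, hwx, hwio⟩ := hB.2 (m' + 2) le_rfl (by omega) u2 hf2
        fun x hx => rfl
      have e3 := exec_copy hfw (x := m' + 2) (m := m') (by omega) (by omega)
      have hf3 := (hfw.set (x := m') (v := 0) (by omega) (by positivity)).set (x := m')
        (v := w.mem (m' + 2)) (by omega) (hfw.lt _)
      set w2 := (w.set m' 0).set m' (w.mem (m' + 2)) with hw2
      obtain ⟨y, hy, hfy, hyv, hyx, hyio⟩ := ih (by omega) w2 hf3
        (by simp [hw2, MachineState.set_mem, hwv])
        (by simp [hw2, MachineState.set_mem, hwx, u2i])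
        (by
          intro x hx
          simp [hw2, MachineState.set_mem, hx.ne, hwx x (by omega), u2x x hx])
      refine ⟨y, .loopStep (by omega) (.seq (.seq e1 e2) (.seq hw e3)) hy, hfy, hyv, hyx, ?_⟩
      exact SameMessages.trans (t := w2) ⟨hwio.inbox, hwio.outbox, hwio.coins⟩ hyio
  obtain ⟨w, hw, hfw, hwv, hwx, hwio⟩ := key N le_rfl u hfu
    ((hlu m' (by omega)).trans hv1) hv2 fun x hx => (hlu x (by omega)).trans (hlt x hx)
  exact ⟨w, .seq ht (.seq hu hw), hfw, hwv, hwx, (hio.trans hio').trans hwio⟩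

/-! ### Derived expressions -/

theorem Evals.add {e₁ e₂ : RamExpr} {v₁ v₂ : ℕ} (h₁ : Evals L e₁ m σ v₁)
    (h₂ : Evals L e₂ m σ v₂) (hv : v₁ + v₂ < 2 ^ L.b) :
    Evals L (opE .add e₁ e₂) m σ (v₁ + v₂) := h₁.op .add h₂ hv

theorem Evals.sub {e₁ e₂ : RamExpr} {v₁ v₂ : ℕ} (h₁ : Evals L e₁ m σ v₁)
    (h₂ : Evals L e₂ m σ v₂) : Evals L (opE .sub e₁ e₂) m σ (v₁ - v₂) :=
  h₁.op .sub h₂ ((Nat.sub_le _ _).trans_lt h₁.lt)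

theorem Evals.mul {e₁ e₂ : RamExpr} {v₁ v₂ : ℕ} (h₁ : Evals L e₁ m σ v₁)
    (h₂ : Evals L e₂ m σ v₂) (hv : v₁ * v₂ < 2 ^ L.b) :
    Evals L (opE .mul e₁ e₂) m σ (v₁ * v₂) := h₁.op .mul h₂ hv

theorem Evals.div {e₁ e₂ : RamExpr} {v₁ v₂ : ℕ} (h₁ : Evals L e₁ m σ v₁)
    (h₂ : Evals L e₂ m σ v₂) : Evals L (opE .div e₁ e₂) m σ (v₁ / v₂) :=
  h₁.op .div h₂ ((Nat.div_le_self _ _).trans_lt h₁.lt)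

/-- The remainder `e₁ % e₂`. -/
def modE (e₁ e₂ : RamExpr) : RamExpr := opE .sub e₁ (opE .mul (opE .div e₁ e₂) e₂)

theorem Evals.mod {e₁ e₂ : RamExpr} {v₁ v₂ : ℕ} (h₁ : Evals L e₁ m σ v₁)
    (h₂ : Evals L e₂ m σ v₂) : Evals L (modE e₁ e₂) m σ (v₁ % v₂) := by
  have := h₁.sub ((h₁.div h₂).mul h₂ ((Nat.div_mul_le_self _ _).trans_lt h₁.lt))
  have h : v₁ - v₁ / v₂ * v₂ = v₁ % v₂ := by
    have := Nat.mod_add_div v₁ v₂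
    rw [Nat.mul_comm v₂] at this
    omega
  rwa [h] at this

/-- The power `e₁ ^ e₂`. -/
def powE (e₁ e₂ : RamExpr) : RamExpr := foldE e₂ (litE 1) fun a _ => opE .mul a e₁

theorem Evals.pow {e₁ e₂ : RamExpr} {v₁ v₂ : ℕ} (h₁ : Evals L e₁ m σ v₁)
    (h₂ : Evals L e₂ m σ v₂) (h0 : 0 < v₁) (hv : v₁ ^ v₂ < 2 ^ L.b) :
    Evals L (powE e₁ e₂) m σ (v₁ ^ v₂) := by
  have h1 : 1 < 2 ^ L.b := (Nat.one_le_pow _ _ h0).trans_lt hv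
  refine Evals.fold (g := fun i => v₁ ^ (v₂ - i)) h₂ (by simpa using Evals.lit h1) ?_
  intro i hi m' σ' ea ei hm hσ ha _
  have : v₂ - i = (v₂ - (i + 1)) + 1 := by omega
  simp only [this, pow_succ]
  refine ha.mul (h₁.mono hm hσ) (lt_of_le_of_lt ?_ hv)
  rw [← pow_succ]
  exact Nat.pow_le_pow_right h0 (by omega)

/-- The sum of `f i` over all `i` below the value of `cnt`. -/
def sumE (cnt : RamExpr) (f : RamExpr → RamExpr) : RamExpr :=
  foldE cnt (litE 0) fun a i => opE .add a (f i)

theorem Evals.sum {cnt : RamExpr} {f : RamExpr → RamExpr} {N : ℕ} {F : ℕ → ℕ}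
    (hc : Evals L cnt m σ N)
    (hb : ∀ i < N, ∀ (m' : ℕ) (σ' : ℕ → ℕ) (ei : RamExpr), m ≤ m' → (∀ x < m, σ' x = σ x) →
      Evals L ei m' σ' i → Evals L (f ei) m' σ' (F i))
    (hs : ∑ i ∈ Finset.range N, F i < 2 ^ L.b) :
    Evals L (sumE cnt f) m σ (∑ i ∈ Finset.range N, F i) := by
  rw [Finset.range_eq_Ico] at hs ⊢
  refine Evals.fold (g := fun i => ∑ x ∈ Finset.Ico i N, F x) hc
    (by simpa using Evals.lit (by positivity)) ?_
  intro i hi m' σ' ea ei hm hσ ha he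
  simp only [Finset.sum_eq_sum_Ico_succ_bot hi F]
  rw [Nat.add_comm]
  refine ha.add (hb i hi m' σ' ei hm hσ he) (lt_of_le_of_lt ?_ hs)
  rw [Nat.add_comm, ← Finset.sum_eq_sum_Ico_succ_bot hi F]
  exact Finset.sum_le_sum_of_subset (Finset.Ico_subset_Ico_left (Nat.zero_le _))

open Classical in
/-- The truth value of a proposition as a number. -/
noncomputable def ind (P : Prop) : ℕ := if P then 1 else 0

theorem ind_le_one (P : Prop) : ind P ≤ 1 := by unfold ind; split_ifs <;> simp

theorem ind_true {P : Prop} (h : P) : ind P = 1 := if_pos h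

theorem ind_false {P : Prop} (h : ¬P) : ind P = 0 := if_neg h

theorem ind_eq_zero {P : Prop} : ind P = 0 ↔ ¬P := by unfold ind; split_ifs <;> simp_all

theorem sum_ind_le (N : ℕ) (P : ℕ → Prop) : ∑ i ∈ Finset.range N, ind (P i) ≤ N := by
  simpa using Finset.sum_le_card_nsmul (Finset.range N) (fun i => ind (P i)) 1
    fun i _ => ind_le_one _

/-- Whether the value is nonzero. -/
def posE (e : RamExpr) : RamExpr := opE .sub (litE 1) (opE .sub (litE 1) e)

theorem Evals.pos (h1 : 1 < 2 ^ L.b) {e : RamExpr} {v : ℕ} (h : Evals L e m σ v) :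
    Evals L (posE e) m σ (ind (v ≠ 0)) := by
  have := (Evals.lit (m := m) (σ := σ) h1).sub ((Evals.lit h1).sub h)
  refine this.of_eq ?_
  unfold ind; split_ifs <;> omega

/-- Whether `e₁ < e₂`. -/
def ltE (e₁ e₂ : RamExpr) : RamExpr := posE (opE .sub e₂ e₁)

theorem Evals.ltTest (h1 : 1 < 2 ^ L.b) {e₁ e₂ : RamExpr} {v₁ v₂ : ℕ} (h₁ : Evals L e₁ m σ v₁)
    (h₂ : Evals L e₂ m σ v₂) : Evals L (ltE e₁ e₂) m σ (ind (v₁ < v₂)) := by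
  have := (h₂.sub h₁).pos h1
  refine this.of_eq (congrArg ind ?_)
  simp; omega

/-- Negation of a truth value. -/
def notE (e : RamExpr) : RamExpr := opE .sub (litE 1) e

theorem Evals.not (h1 : 1 < 2 ^ L.b) {e : RamExpr} {P : Prop} (h : Evals L e m σ (ind P)) :
    Evals L (notE e) m σ (ind (¬P)) := by
  have := (Evals.lit (m := m) (σ := σ) h1).sub h
  refine this.of_eq ?_
  unfold ind; split_ifs <;> simp_all

/-- Whether `e₁ ≤ e₂`. -/
def leE (e₁ e₂ : RamExpr) : RamExpr := notE (ltE e₂ e₁)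

theorem Evals.leTest (h1 : 1 < 2 ^ L.b) {e₁ e₂ : RamExpr} {v₁ v₂ : ℕ} (h₁ : Evals L e₁ m σ v₁)
    (h₂ : Evals L e₂ m σ v₂) : Evals L (leE e₁ e₂) m σ (ind (v₁ ≤ v₂)) := by
  have := (h₂.ltTest h1 h₁).not h1
  refine this.of_eq (congrArg ind ?_)
  simp

/-- Conjunction of truth values. -/
def andE (e₁ e₂ : RamExpr) : RamExpr := opE .mul e₁ e₂

theorem Evals.and {e₁ e₂ : RamExpr} {P Q : Prop} (h₁ : Evals L e₁ m σ (ind P))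
    (h₂ : Evals L e₂ m σ (ind Q)) : Evals L (andE e₁ e₂) m σ (ind (P ∧ Q)) := by
  have h : ind (P ∧ Q) = ind P * ind Q := by
    unfold ind; split_ifs <;> simp_all
  rw [h]
  refine h₁.mul h₂ (lt_of_le_of_lt ?_ h₁.lt)
  simpa using Nat.mul_le_mul_left (ind P) (ind_le_one Q)

/-- Disjunction of truth values. -/
def orE (e₁ e₂ : RamExpr) : RamExpr := notE (andE (notE e₁) (notE e₂))

theorem Evals.or (h1 : 1 < 2 ^ L.b) {e₁ e₂ : RamExpr} {P Q : Prop} (h₁ : Evals L e₁ m σ (ind P))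
    (h₂ : Evals L e₂ m σ (ind Q)) : Evals L (orE e₁ e₂) m σ (ind (P ∨ Q)) := by
  have := ((h₁.not h1).and (h₂.not h1)).not h1
  refine this.of_eq (congrArg ind ?_)
  simp only [eq_iff_iff]; tauto

/-- Whether `e₁ = e₂`. -/
def eqE (e₁ e₂ : RamExpr) : RamExpr := andE (leE e₁ e₂) (leE e₂ e₁)

theorem Evals.eqTest (h1 : 1 < 2 ^ L.b) {e₁ e₂ : RamExpr} {v₁ v₂ : ℕ} (h₁ : Evals L e₁ m σ v₁)
    (h₂ : Evals L e₂ m σ v₂) : Evals L (eqE e₁ e₂) m σ (ind (v₁ = v₂)) := by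
  have := (h₁.leTest h1 h₂).and (h₂.leTest h1 h₁)
  refine this.of_eq (congrArg ind ?_)
  simp only [eq_iff_iff]; omega

/-- Whether `f i` is true for some `i` below the value of `cnt`. -/
def anyE (cnt : RamExpr) (f : RamExpr → RamExpr) : RamExpr := posE (sumE cnt f)

theorem Evals.any (h1 : 1 < 2 ^ L.b) {cnt : RamExpr} {f : RamExpr → RamExpr} {N : ℕ}
    {P : ℕ → Prop} (hc : Evals L cnt m σ N)
    (hb : ∀ i < N, ∀ (m' : ℕ) (σ' : ℕ → ℕ) (ei : RamExpr), m ≤ m' → (∀ x < m, σ' x = σ x) →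
      Evals L ei m' σ' i → Evals L (f ei) m' σ' (ind (P i))) :
    Evals L (anyE cnt f) m σ (ind (∃ i < N, P i)) := by
  have := (Evals.sum hc hb ((sum_ind_le _ _).trans_lt hc.lt)).pos h1
  refine this.of_eq (congrArg ind ?_)
  simp [ind_eq_zero]

/-- Whether bit number `u` of `S` is set. -/
def bitE (S u : RamExpr) : RamExpr :=
  eqE (modE (opE .div S (powE (litE 2) u)) (litE 2)) (litE 1)

theorem Evals.bit (h2 : 2 < 2 ^ L.b) {eS eu : RamExpr} {S u : ℕ} (hS : Evals L eS m σ S)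
    (hu : Evals L eu m σ u) (hpow : 2 ^ u < 2 ^ L.b) :
    Evals L (bitE eS eu) m σ (ind (S.testBit u = true)) := by
  have h1 : 1 < 2 ^ L.b := by omega
  have := ((hS.div ((Evals.lit h2).pow hu (by norm_num) hpow)).mod (Evals.lit h2)).eqTest h1
    (Evals.lit h1)
  refine this.of_eq (congrArg ind ?_)
  simp [Nat.testBit_eq_decide_div_mod_eq]

end

/-! ### Lists of items stored in a register -/

/-- A list of pairs as a single number in base `n * Q + 1`. The pair `(y, z)` with `y < n` and
`z < Q` is the nonzero digit `y * Q + z + 1`, and the last pair is the lowest digit. -/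
def listCode (n Q : ℕ) (l : List (ℕ × ℕ)) : ℕ :=
  l.foldl (fun a p => a * (n * Q + 1) + (p.1 * Q + p.2 + 1)) 0

theorem listCode_append (n Q : ℕ) (l : List (ℕ × ℕ)) (p : ℕ × ℕ) :
    listCode n Q (l ++ [p]) = listCode n Q l * (n * Q + 1) + (p.1 * Q + p.2 + 1) := by
  simp [listCode]

/-- All items are pairs `(y, z)` with `y < n` and `z < Q`. -/
def ItemsLt (n Q : ℕ) (l : List (ℕ × ℕ)) : Prop := ∀ p ∈ l, p.1 < n ∧ p.2 < Q

theorem itemCode_lt {n Q y z : ℕ} (hy : y < n) (hz : z < Q) : y * Q + z + 1 < n * Q + 1 := by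
  have : (y + 1) * Q ≤ n * Q := Nat.mul_le_mul_right _ hy
  rw [Nat.add_mul, Nat.one_mul] at this
  omega

theorem itemCode_inj {Q y z y' z' : ℕ} (hz : z < Q) (hz' : z' < Q)
    (h : y * Q + z = y' * Q + z') : y = y' ∧ z = z' := by
  have hQ : 0 < Q := by omega
  have h1 : (y * Q + z) / Q = y := by
    rw [Nat.add_comm, Nat.add_mul_div_right _ _ hQ, Nat.div_eq_of_lt hz, Nat.zero_add]
  have h2 : (y' * Q + z') / Q = y' := by
    rw [Nat.add_comm, Nat.add_mul_div_right _ _ hQ, Nat.div_eq_of_lt hz', Nat.zero_add]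
  have : y = y' := by rw [← h1, ← h2, h]
  subst this
  omega

theorem listCode_lt {n Q : ℕ} {l : List (ℕ × ℕ)} (hl : ItemsLt n Q l) :
    listCode n Q l < (n * Q + 1) ^ l.length := by
  induction l using List.reverseRecOn with
  | nil => simp [listCode]
  | append_singleton l p ih =>
    have ih := ih fun q hq => hl q (by simp [hq])
    have hp := hl p (by simp)
    have := itemCode_lt hp.1 hp.2
    rw [listCode_append]
    simp only [List.length_append, List.length_singleton, pow_succ]
    have h2 := Nat.mul_le_mul_right (n * Q + 1) (Nat.succ_le_of_lt ih)
    rw [Nat.succ_mul] at h2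
    omega

/-- The items of a list are the nonzero digits of its code. -/
theorem exists_digit_iff {n Q : ℕ} {l : List (ℕ × ℕ)} (hl : ItemsLt n Q l) {M y z : ℕ}
    (hM : l.length ≤ M) (hz : z < Q) :
    (∃ i < M, listCode n Q l / (n * Q + 1) ^ i % (n * Q + 1) = y * Q + z + 1) ↔ (y, z) ∈ l := by
  induction l using List.reverseRecOn generalizing M with
  | nil => simp [listCode]
  | append_singleton l p ih =>
    have hp := hl p (by simp)
    have hlt := itemCode_lt hp.1 hp.2
    simp only [List.length_append, List.length_singleton] at hM
    obtain ⟨M, rfl⟩ : ∃ M', M = M' + 1 := ⟨M - 1, by omega⟩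
    have hdiv : listCode n Q (l ++ [p]) / (n * Q + 1) = listCode n Q l := by
      rw [listCode_append, Nat.add_comm, Nat.add_mul_div_right _ _ (by omega),
        Nat.div_eq_of_lt hlt, Nat.zero_add]
    have hmod : listCode n Q (l ++ [p]) % (n * Q + 1) = p.1 * Q + p.2 + 1 := by
      rw [listCode_append, Nat.add_comm, Nat.add_mul_mod_self_right, Nat.mod_eq_of_lt hlt]
    have ih := ih (fun q hq => hl q (by simp [hq])) (M := M) (by omega)
    rw [List.mem_append, ← ih, List.mem_singleton]
    constructor
    · rintro ⟨i, hi, h⟩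
      cases i with
      | zero =>
        right
        rw [pow_zero, Nat.div_one, hmod] at h
        obtain ⟨h1, h2⟩ := itemCode_inj hp.2 hz (Nat.succ_injective h)
        ext <;> simp [h1, h2]
      | succ i =>
        left
        refine ⟨i, by omega, ?_⟩
        rwa [pow_succ', ← Nat.div_div_eq_div_mul, hdiv] at h
    · rintro (⟨i, hi, h⟩ | h)
      · refine ⟨i + 1, by omega, ?_⟩
        rwa [pow_succ', ← Nat.div_div_eq_div_mul, hdiv]
      · refine ⟨0, by omega, ?_⟩
        rw [pow_zero, Nat.div_one, hmod, ← h]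

/-! ### Building blocks of programs

Registers below `16` are variables, the others are the workspace of expressions. -/

/-- `x := e` -/
def assignP (x : ℕ) (e : RamExpr) : RamProg :=
  .seq (e 16) (.seq (.instr (.const x 0)) (.instr (.arith .add x 16 x)))

/-- Read the whole inbox; register `x` accumulates the value of `push`, which may refer to `x` and
to the current item in registers `4` and `5`. -/
def recvP (x : ℕ) (push : RamExpr) : RamProg :=
  .seq (assignP x (litE 0)) (.seq (.instr (.recv 3 4 5))
    (.loop 3 (.seq (assignP x push) (.instr (.recv 3 4 5)))))

/-- For all `i` below the value of `cnt`, in decreasing order and kept in register `6`: if `cond`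
is true, send `val` to the machine `dst`. -/
def sendP (cnt cond dst val : RamExpr) : RamProg :=
  .seq (assignP 6 cnt) (.loop 6 (.seq (assignP 6 (opE .sub (varE 6) (litE 1)))
    (.seq (assignP 7 cond) (.ite 7
      (.seq (assignP 7 dst) (.seq (assignP 8 val) (.instr (.send 7 8)))) .skip))))

/-- Flip `cnt` coins; register `12` counts the ones at the end of the sequence. -/
def flipP (cnt : RamExpr) : RamProg :=
  .seq (assignP 12 (litE 0)) (.seq (assignP 6 cnt) (.loop 6
    (.seq (assignP 6 (opE .sub (varE 6) (litE 1)))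
      (.seq (.instr (.flip 13))
        (assignP 12 (opE .mul (opE .add (varE 12) (litE 1)) (varE 13)))))))

/-- The number of ones at the end of the first `t` coins. -/
def trailingOnes (ω : ℕ → Bool) : ℕ → ℕ
  | 0 => 0
  | t + 1 => (trailingOnes ω t + 1) * (ω t).toNat

theorem trailingOnes_le (ω : ℕ → Bool) (t : ℕ) : trailingOnes ω t ≤ t := by
  induction t with
  | zero => simp [trailingOnes]
  | succ t ih =>
    have := Nat.mul_le_mul_left (trailingOnes ω t + 1) (Bool.toNat_le (ω t))
    simp only [trailingOnes]
    omega

theorem le_trailingOnes_iff (ω : ℕ → Bool) {j t : ℕ} (hj : j ≤ t) :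
    j ≤ trailingOnes ω t ↔ ∀ i, t - j ≤ i → i < t → ω i = true := by
  induction t generalizing j with
  | zero => simp at hj; subst hj; simp
  | succ t ih =>
    cases j with
    | zero => simp; intros; omega
    | succ j =>
      have ih := ih (j := j) (by omega)
      simp only [trailingOnes]
      cases h : ω t with
      | false =>
        simp only [Bool.toNat_false, Nat.mul_zero]
        constructor
        · intro h'; omega
        · intro h'
          have := h' t (by omega) (by omega)
          simp [h] at this
      | true =>
        simp only [Bool.toNat_true, Nat.mul_one, Nat.add_le_add_iff_right, ih,
          Nat.add_sub_add_right]
        constructor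
        · intro h' i h1 h2
          rcases Nat.lt_succ_iff_lt_or_eq.1 h2 with h3 | rfl
          · exact h' i h1 h3
          · exact h
        · intro h' i h1 h2
          exact h' i h1 (by omega)

section
variable {L : Budget}

/-- The effect of an assignment: register `x` becomes `v`, the other variables and the messages
are kept. -/
structure AssignResult (L : Budget) (x v : ℕ) (s t : MachineState) : Prop where
  fits : Fits L t
  mem_eq : t.mem x = v
  mem_ne : ∀ y < 16, y ≠ x → t.mem y = s.mem y
  io : SameMessages s t

theorem exec_assign {x v : ℕ} {e : RamExpr} {s : MachineState} (hx : x < 16)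
    (hR : (assignP x e).regBound ≤ L.R) (hs : Fits L s) (he : Evals L e 16 s.mem v) :
    ∃ t, RamExec L.total (assignP x e) s t ∧ AssignResult L x v s t := by
  simp only [assignP, RamProg.regBound, RamInstr.regBound] at hR
  obtain ⟨t, ht, hft, hv, hlt, hio⟩ := he.2 16 le_rfl (by omega) s hs fun x _ => rfl
  refine ⟨_, .seq ht (exec_copy hft (by omega) (by omega)),
    (hft.set (by omega) (by positivity)).set (by omega) (hft.lt _), ?_, ?_,
    hio.trans ⟨rfl, rfl, rfl⟩⟩
  · simp [MachineState.set_mem, hv]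
  · intro y hy hyx
    simp [MachineState.set_mem, hyx, hlt y hy]

theorem itemBits_cons (p : ℕ × ℕ) (l : List (ℕ × ℕ)) :
    itemBits (p :: l) = 1 + Nat.size p.1 + Nat.size p.2 + itemBits l := by
  simp [itemBits]

theorem itemBits_append (l l' : List (ℕ × ℕ)) :
    itemBits (l ++ l') = itemBits l + itemBits l' := by
  simp [itemBits]

theorem exec_recv_cons {s : MachineState} (hs : Fits L s) (hR : 6 ≤ L.R) {p : ℕ × ℕ}
    {l : List (ℕ × ℕ)} (hin : s.inbox = p :: l) (hp1 : p.1 < 2 ^ L.b) (hp2 : p.2 < 2 ^ L.b)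
    (h1 : 1 < 2 ^ L.b) :
    ∃ t, RamExec L.total (.instr (.recv 3 4 5)) s t ∧ Fits L t ∧ t.mem 3 = 1 ∧ t.mem 4 = p.1 ∧
      t.mem 5 = p.2 ∧ (∀ y < 16, y ≠ 3 → y ≠ 4 → y ≠ 5 → t.mem y = s.mem y) ∧ t.inbox = l ∧
      t.outbox = s.outbox ∧ t.coins = s.coins := by
  have hstep : (RamInstr.recv 3 4 5).step s =
      { ((s.set 3 1).set 4 p.1).set 5 p.2 with inbox := l } := by
    simp [RamInstr.step, hin]
  have hf := ((hs.set (x := 3) (by omega) h1).set (x := 4) (by omega) hp1).set (x := 5)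
    (by omega) hp2
  have hf' : Fits L ((RamInstr.recv 3 4 5).step s) := by
    rw [hstep]
    refine ⟨hf.lt, hf.zero, ?_⟩
    have := hs.items
    rw [hin, itemBits_cons] at this
    simp only [MachineState.set] at *
    omega
  refine ⟨_, .instr hs.space_le hf'.space_le, hf', ?_, ?_, ?_, ?_, ?_, ?_, ?_⟩ <;> rw [hstep]
  · simp [MachineState.set_mem]
  · simp [MachineState.set_mem]
  · simp [MachineState.set_mem]
  · intro y _ h3 h4 h5
    simp [MachineState.set_mem, h3, h4, h5]
  · rfl
  · rfl

theorem exec_recv_nil {s : MachineState} (hs : Fits L s) (hR : 6 ≤ L.R) (hin : s.inbox = []) :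
    ∃ t, RamExec L.total (.instr (.recv 3 4 5)) s t ∧ AssignResult L 3 0 s t := by
  have hstep : (RamInstr.recv 3 4 5).step s = s.set 3 0 := by
    simp [RamInstr.step, hin]
  have hf : Fits L ((RamInstr.recv 3 4 5).step s) := by
    rw [hstep]; exact hs.set (by omega) (by positivity)
  refine ⟨_, .instr hs.space_le hf.space_le, hf, ?_, ?_, ?_⟩ <;> rw [hstep]
  · simp [MachineState.set_mem]
  · intro y _ h3
    simp [MachineState.set_mem, h3]
  · exact ⟨rfl, rfl, rfl⟩

/-- Reading the whole inbox. `σ` holds the variables that stay fixed; `g l` is the value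
accumulated after the items of `l`. -/
theorem exec_recvP {x : ℕ} {push : RamExpr} {s : MachineState} {g : List (ℕ × ℕ) → ℕ}
    (hx : 5 < x) (hx' : x < 16) (hR : (recvP x push).regBound ≤ L.R) (hs : Fits L s)
    (h1 : 1 < 2 ^ L.b) (hlt : ∀ p ∈ s.inbox, p.1 < 2 ^ L.b ∧ p.2 < 2 ^ L.b) (hg0 : g [] = 0)
    (hpush : ∀ l p r, s.inbox = l ++ p :: r → ∀ σ : ℕ → ℕ,
      (∀ y < 16, y ≠ 3 → y ≠ 4 → y ≠ 5 → y ≠ x → σ y = s.mem y) → (∀ y, σ y < 2 ^ L.b) →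
      σ x = g l → σ 4 = p.1 → σ 5 = p.2 → Evals L push 16 σ (g (l ++ [p]))) :
    ∃ t, RamExec L.total (recvP x push) s t ∧ Fits L t ∧ t.mem x = g s.inbox ∧
      (∀ y < 16, y ≠ 3 → y ≠ 4 → y ≠ 5 → y ≠ x → t.mem y = s.mem y) ∧ t.inbox = [] ∧
      t.outbox = s.outbox ∧ t.coins = s.coins := by
  simp only [recvP, RamProg.regBound, RamInstr.regBound] at hR
  obtain ⟨t, ht, at1⟩ := exec_assign (x := x) (v := 0) (e := litE 0) hx' (by omega) hs
    (Evals.lit (by positivity))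
  -- the state before each `recv`: the items of `l` have been processed, those of `r` remain
  have key : ∀ r l, s.inbox = l ++ r → ∀ t, Fits L t → t.mem x = g l →
      (∀ y < 16, y ≠ 3 → y ≠ 4 → y ≠ 5 → y ≠ x → t.mem y = s.mem y) → t.inbox = r →
      t.outbox = s.outbox → t.coins = s.coins → ∃ u, RamExec L.total (.seq (.instr (.recv 3 4 5))
        (.loop 3 (.seq (assignP x push) (.instr (.recv 3 4 5))))) t u ∧
      Fits L u ∧ u.mem x = g s.inbox ∧
      (∀ y < 16, y ≠ 3 → y ≠ 4 → y ≠ 5 → y ≠ x → u.mem y = s.mem y) ∧ u.inbox = [] ∧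
      u.outbox = s.outbox ∧ u.coins = s.coins := by
    intro r
    induction r with
    | nil =>
      intro l hl t hft htx hty hin hout hco
      obtain ⟨u, hu, au⟩ := exec_recv_nil hft (by omega) hin
      refine ⟨u, .seq hu (.loopStop au.fits.space_le au.mem_eq), au.fits, ?_, ?_,
        au.io.inbox.trans hin, au.io.outbox.trans hout, au.io.coins.trans hco⟩
      · rw [au.mem_ne x hx' (by omega), htx, hl, List.append_nil]
      · intro y hy h3 h4 h5 h6
        rw [au.mem_ne y hy h3, hty y hy h3 h4 h5 h6]
    | cons p r ih =>
      intro l hl t hft htx hty hin hout hco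
      have hp := hlt p (by rw [hl]; simp)
      obtain ⟨u, hu, hfu, hu3, hu4, hu5, huy, huin, huout, huco⟩ :=
        exec_recv_cons hft (by omega) hin hp.1 hp.2 h1
      have hE := hpush l p r hl u.mem
        (fun y hy h3 h4 h5 h6 => (huy y hy h3 h4 h5).trans (hty y hy h3 h4 h5 h6)) hfu.lt
        ((huy x hx' (by omega) (by omega) (by omega)).trans htx) hu4 hu5
      obtain ⟨w, hw, aw⟩ := exec_assign hx' (by omega) hfu hE
      obtain ⟨z, hz, hfz⟩ := ih (l ++ [p]) (by simpa using hl) w aw.fits aw.mem_eq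
        (fun y hy h3 h4 h5 h6 => by
          rw [aw.mem_ne y hy h6, huy y hy h3 h4 h5, hty y hy h3 h4 h5 h6])
        (aw.io.inbox.trans huin) (aw.io.outbox.trans (huout.trans hout))
        (aw.io.coins.trans (huco.trans hco))
      refine ⟨z, ?_, hfz⟩
      cases hz with
      | seq ha hb => exact .seq hu (.loopStep (by omega) (.seq hw ha) hb)
  obtain ⟨u, hu, hfu⟩ := key s.inbox [] rfl t at1.fits (by rw [at1.mem_eq, hg0])
    (fun y hy _ _ _ h6 => at1.mem_ne y hy h6) at1.io.inbox at1.io.outbox at1.io.coins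
  exact ⟨u, .seq ht hu, hfu⟩

theorem exec_decrement {x i : ℕ} {s : MachineState} (hx : x < 16)
    (hR : (assignP x (opE .sub (varE x) (litE 1))).regBound ≤ L.R) (hs : Fits L s)
    (h1 : 1 < 2 ^ L.b) (hi : s.mem x = i + 1) :
    ∃ t, RamExec L.total (assignP x (opE .sub (varE x) (litE 1))) s t ∧ AssignResult L x i s t :=
  exec_assign hx hR hs (((Evals.var hx (hs.lt x)).sub (Evals.lit h1)).of_eq (by omega))

open Classical in
/-- The messages of a sending loop: for `i = N - 1, …, 0`, if `P i` holds, `val i` is sent to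
`dst i`. -/
noncomputable def sentItems (N : ℕ) (P : ℕ → Prop) (dst val : ℕ → ℕ) : List (ℕ × ℕ) :=
  ((List.range N).reverse.filter fun i => decide (P i)).map fun i => (dst i, val i)

theorem sentItems_succ (N : ℕ) (P : ℕ → Prop) (dst val : ℕ → ℕ) :
    sentItems (N + 1) P dst val =
      sentItems 1 (fun _ => P N) (fun _ => dst N) (fun _ => val N) ++ sentItems N P dst val := by
  classical
  simp only [sentItems, List.range_succ, List.reverse_append]
  by_cases h : P N <;> simp [h]

theorem mem_sentItems {N : ℕ} {P : ℕ → Prop} {dst val : ℕ → ℕ} {p : ℕ × ℕ} :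
    p ∈ sentItems N P dst val ↔ ∃ i < N, P i ∧ (dst i, val i) = p := by
  simp [sentItems, and_assoc]

/-- A sending loop, started with an empty inbox and outbox. -/
theorem exec_sendP {cnt cond dst val : RamExpr} {s : MachineState} {N : ℕ} {P : ℕ → Prop}
    {d v : ℕ → ℕ} (hR : (sendP cnt cond dst val).regBound ≤ L.R) (hs : Fits L s)
    (h1 : 1 < 2 ^ L.b) (hin : s.inbox = []) (hout : s.outbox = [])
    (hJ : itemBits (sentItems N P d v) ≤ L.J) (hcnt : Evals L cnt 16 s.mem N)
    (hbody : ∀ i < N, ∀ σ : ℕ → ℕ, (∀ y < 16, y ≠ 6 → y ≠ 7 → y ≠ 8 → σ y = s.mem y) →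
      (∀ y, σ y < 2 ^ L.b) → σ 6 = i →
      Evals L cond 16 σ (ind (P i)) ∧ (P i → Evals L dst 16 σ (d i) ∧ Evals L val 16 σ (v i))) :
    ∃ t, RamExec L.total (sendP cnt cond dst val) s t ∧ Fits L t ∧
      (∀ y < 16, y ≠ 6 → y ≠ 7 → y ≠ 8 → t.mem y = s.mem y) ∧
      t.outbox = sentItems N P d v ∧ t.coins = s.coins := by
  simp only [sendP, RamProg.regBound, RamInstr.regBound] at hR
  obtain ⟨t, ht, at1⟩ := exec_assign (x := 6) (by omega) (by omega) hs hcnt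
  have key : ∀ i ≤ N, ∀ t, Fits L t → t.mem 6 = i →
      (∀ y < 16, y ≠ 6 → y ≠ 7 → y ≠ 8 → t.mem y = s.mem y) → t.inbox = [] →
      t.outbox ++ sentItems i P d v = sentItems N P d v → t.coins = s.coins →
      ∃ u, RamExec L.total (.loop 6 (.seq (assignP 6 (opE .sub (varE 6) (litE 1)))
        (.seq (assignP 7 cond) (.ite 7
          (.seq (assignP 7 dst) (.seq (assignP 8 val) (.instr (.send 7 8)))) .skip)))) t u ∧
      Fits L u ∧ (∀ y < 16, y ≠ 6 → y ≠ 7 → y ≠ 8 → u.mem y = s.mem y) ∧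
      u.outbox = sentItems N P d v ∧ u.coins = s.coins := by
    intro i
    induction i with
    | zero =>
      intro _ t hft h6 hy _ hou hco
      exact ⟨t, .loopStop hft.space_le h6, hft, hy, by simpa [sentItems] using hou, hco⟩
    | succ i ih =>
      intro hiN t hft h6 hy hti hou hco
      obtain ⟨t1, ht1, a1⟩ := exec_decrement (by omega) (by omega) hft h1 h6
      obtain ⟨hc, hdv⟩ := hbody i (by omega) t1.mem
        (fun y hy' h6 h7 h8 => (a1.mem_ne y hy' h6).trans (hy y hy' h6 h7 h8)) a1.fits.lt a1.mem_eq
      obtain ⟨t2, ht2, a2⟩ := exec_assign (x := 7) (by omega) (by omega) a1.fits hc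
      rw [sentItems_succ, ← List.append_assoc] at hou
      have hy2 : ∀ y < 16, y ≠ 6 → y ≠ 7 → y ≠ 8 → t2.mem y = s.mem y :=
        fun y hy' h6 h7 h8 => by rw [a2.mem_ne y hy' h7, a1.mem_ne y hy' h6, hy y hy' h6 h7 h8]
      have h62 : t2.mem 6 = i := (a2.mem_ne 6 (by omega) (by omega)).trans a1.mem_eq
      by_cases hP : P i
      · obtain ⟨hd, hv⟩ := (hbody i (by omega) t2.mem hy2 a2.fits.lt h62).2 hP
        obtain ⟨t3, ht3, a3⟩ := exec_assign (x := 7) (by omega) (by omega) a2.fits hd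
        have hy3 : ∀ y < 16, y ≠ 6 → y ≠ 7 → y ≠ 8 → t3.mem y = s.mem y :=
          fun y hy' h6 h7 h8 => by rw [a3.mem_ne y hy' h7, hy2 y hy' h6 h7 h8]
        have h63 : t3.mem 6 = i := (a3.mem_ne 6 (by omega) (by omega)).trans h62
        obtain ⟨_, hv⟩ := (hbody i (by omega) t3.mem hy3 a3.fits.lt h63).2 hP
        obtain ⟨t4, ht4, a4⟩ := exec_assign (x := 8) (by omega) (by omega) a3.fits hv
        have hio := ((a1.io.trans a2.io).trans a3.io).trans a4.io
        have h7 : t4.mem 7 = d i := (a4.mem_ne 7 (by omega) (by omega)).trans a3.mem_eq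
        set t5 := (RamInstr.send 7 8).step t4 with ht5
        have hout5 : t5.outbox = t.outbox ++ [(d i, v i)] := by
          simp [ht5, RamInstr.step, h7, a4.mem_eq, hio.outbox]
        have hsent : sentItems 1 (fun _ => P i) (fun _ => d i) (fun _ => v i) = [(d i, v i)] := by
          simp [sentItems, hP]
        rw [hsent] at hou
        have hf5 : Fits L t5 := by
          refine ⟨a4.fits.lt, a4.fits.zero, ?_⟩
          have hin5 : t5.inbox = [] := hio.inbox.trans hti
          rw [hin5, hout5]
          refine le_trans ?_ hJ
          rw [← hou, itemBits_append _ (sentItems i P d v)]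
          simp [itemBits]
        obtain ⟨u, hu, hfu⟩ := ih (by omega) t5 hf5
          ((a4.mem_ne 6 (by omega) (by omega)).trans h63)
          (fun y hy' h6 h7 h8 => (a4.mem_ne y hy' h8).trans (hy3 y hy' h6 h7 h8))
          (hio.inbox.trans hti) (by rw [hout5]; exact hou) (hio.coins.trans hco)
        refine ⟨u, .loopStep (by omega) (.seq ht1 (.seq ht2 (.iteTrue ?_
          (.seq ht3 (.seq ht4 (.instr a4.fits.space_le hf5.space_le)))))) hu, hfu⟩
        rw [a2.mem_eq, ind_true hP]
        exact one_ne_zero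
      · have hsent : sentItems 1 (fun _ => P i) (fun _ => d i) (fun _ => v i) = [] := by
          simp [sentItems, hP]
        rw [hsent, List.append_nil] at hou
        have hio := a1.io.trans a2.io
        obtain ⟨u, hu, hfu⟩ := ih (by omega) t2 a2.fits h62 hy2
          (hio.inbox.trans hti) (by rw [hio.outbox]; exact hou) (hio.coins.trans hco)
        refine ⟨u, .loopStep (by omega) (.seq ht1 (.seq ht2 (.iteFalse ?_
          (.skip a2.fits.space_le)))) hu, hfu⟩
        rw [a2.mem_eq, ind_false hP]
  obtain ⟨u, hu, hfu⟩ := key N le_rfl t at1.fits at1.mem_eq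
    (fun y hy h6 _ _ => at1.mem_ne y hy h6) (at1.io.inbox.trans hin)
    (by rw [at1.io.outbox, hout, List.nil_append]) at1.io.coins
  exact ⟨u, .seq ht hu, hfu⟩

theorem exec_flipP {cnt : RamExpr} {s : MachineState} {N : ℕ}
    (hR : (flipP cnt).regBound ≤ L.R) (hs : Fits L s) (hN : N + 1 < 2 ^ L.b)
    (hcnt : ∀ σ : ℕ → ℕ, (∀ y < 6, σ y = s.mem y) → (∀ y, σ y < 2 ^ L.b) →
      Evals L cnt 16 σ N) :
    ∃ t, RamExec L.total (flipP cnt) s t ∧ Fits L t ∧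
      (∀ y < 16, y ≠ 6 → y ≠ 12 → y ≠ 13 → t.mem y = s.mem y) ∧
      t.mem 12 = trailingOnes s.coins N ∧ t.inbox = s.inbox ∧ t.outbox = s.outbox := by
  simp only [flipP, RamProg.regBound, RamInstr.regBound] at hR
  obtain ⟨t0, ht0, a0⟩ := exec_assign (x := 12) (v := 0) (e := litE 0) (by omega) (by omega) hs
    (Evals.lit (by positivity))
  obtain ⟨t1, ht1, a1⟩ := exec_assign (x := 6) (v := N) (e := cnt) (by omega) (by omega) a0.fits
    (hcnt _ (fun y hy => a0.mem_ne y (by omega) (by omega)) a0.fits.lt)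
  -- `a` coins have been used, `i` remain
  have key : ∀ i a, a + i = N → ∀ t, Fits L t → t.mem 6 = i →
      (∀ y < 16, y ≠ 6 → y ≠ 12 → y ≠ 13 → t.mem y = s.mem y) →
      t.mem 12 = trailingOnes s.coins a → t.inbox = s.inbox → t.outbox = s.outbox →
      t.coins = (fun i => s.coins (i + a)) → ∃ u, RamExec L.total (.loop 6
        (.seq (assignP 6 (opE .sub (varE 6) (litE 1)))
          (.seq (.instr (.flip 13))
            (assignP 12 (opE .mul (opE .add (varE 12) (litE 1)) (varE 13)))))) t u ∧ Fits L u ∧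
      (∀ y < 16, y ≠ 6 → y ≠ 12 → y ≠ 13 → u.mem y = s.mem y) ∧
      u.mem 12 = trailingOnes s.coins N ∧ u.inbox = s.inbox ∧ u.outbox = s.outbox := by
    intro i
    induction i with
    | zero =>
      rintro a rfl t hft h6 hy h12 hin hout _
      exact ⟨t, .loopStop hft.space_le h6, hft, hy, h12, hin, hout⟩
    | succ i ih =>
      intro a ha t hft h6 hy h12 hin hout hco
      obtain ⟨t2, ht2, a2⟩ := exec_decrement (by omega) (by omega) hft (by omega) h6
      set t3 := (RamInstr.flip 13).step t2 with ht3
      have hb : (t2.coins 0).toNat < 2 ^ L.b := by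
        have := Bool.toNat_le (t2.coins 0); omega
      have hf3 : Fits L t3 := by
        have := a2.fits.set (x := 13) (by omega) hb
        exact ⟨this.lt, this.zero, this.items⟩
      have hm3 : ∀ y, t3.mem y = if y = 13 then (t2.coins 0).toNat else t2.mem y :=
        MachineState.set_mem t2 13 _
      have hle := trailingOnes_le s.coins a
      have h12' : t3.mem 12 = trailingOnes s.coins a := by
        rw [hm3, if_neg (by omega), a2.mem_ne 12 (by omega) (by omega), h12]
      have h13' : t3.mem 13 = (s.coins a).toNat := by
        rw [hm3, if_pos rfl, a2.io.coins, hco]; simp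
      have hbool := Bool.toNat_le (s.coins a)
      have hE : Evals L (opE .mul (opE .add (varE 12) (litE 1)) (varE 13)) 16 t3.mem
          (trailingOnes s.coins (a + 1)) := by
        have e1 := Evals.var (L := L) (m := 16) (x := 12) (by omega) (hf3.lt 12)
        have e2 := Evals.var (L := L) (m := 16) (x := 13) (by omega) (hf3.lt 13)
        rw [h12'] at e1
        rw [h13'] at e2
        exact (e1.add (Evals.lit (by omega)) (by omega)).mul e2 (by nlinarith)
      obtain ⟨t4, ht4, a4⟩ := exec_assign (x := 12) (by omega) (by omega) hf3 hE
      obtain ⟨u, hu, hfu⟩ := ih (a + 1) (by omega) t4 a4.fits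
        (by rw [a4.mem_ne 6 (by omega) (by omega), hm3, if_neg (by omega), a2.mem_eq])
        (fun y hy' h6 h12 h13 => by
          rw [a4.mem_ne y hy' h12, hm3, if_neg h13, a2.mem_ne y hy' h6, hy y hy' h6 h12 h13])
        a4.mem_eq (a4.io.inbox.trans (a2.io.inbox.trans hin))
        (a4.io.outbox.trans (a2.io.outbox.trans hout))
        (by
          rw [a4.io.coins, ht3]
          funext i
          simp [RamInstr.step, a2.io.coins, hco, Nat.add_comm 1 a, Nat.add_assoc])
      exact ⟨u, .loopStep (by omega) (.seq ht2 (.seq (.instr a2.fits.space_le hf3.space_le) ht4))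
        hu, hfu⟩
  obtain ⟨u, hu, hfu⟩ := key N 0 (by omega) t1 a1.fits a1.mem_eq
    (fun y hy h6 h12 _ => by rw [a1.mem_ne y hy h6, a0.mem_ne y hy h12])
    (by rw [a1.mem_ne 12 (by omega) (by omega), a0.mem_eq, trailingOnes])
    (a1.io.inbox.trans a0.io.inbox) (a1.io.outbox.trans a0.io.outbox)
    (by rw [a1.io.coins, a0.io.coins]; rfl)
  exact ⟨u, .seq ht0 (.seq ht1 hu), hfu⟩

end

/-! ### The numbers that govern the algorithm, and the programs that compute them -/

/-- The number of binary digits of `n`, for `n ≥ 1`. -/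
def bitLength (n : ℕ) : ℕ := Nat.log 2 n + 1

/-- The size to which closed neighbourhoods are truncated: a vertex remains dominated by at most
this many vertices. The sampling loses little because this is `O(n / k)`, and the truncation loses
little because it is at least `512 n / k`. -/
def degreeCap (n k : ℕ) : ℕ := 512 * n / k + 1

/-- A bound for the expected size of the sample, where a vertex counts with the size of its
truncated closed neighbourhood. -/
def sampleSize (n : ℕ) : ℕ := 2 ^ 20 * (n * bitLength n)

/-- The most items that a machine ever receives: if the sample exceeds this number, nothing is sent
in the third round. It is four times the bound for the expected size of the sample, so this is
unlikely. -/
def itemCap (n : ℕ) : ℕ := 2 ^ 22 * (n * bitLength n)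

/-- All message contents are below this number; a degree and a level, both at most `n`, fit into one
message. -/
def contentBound (n : ℕ) : ℕ := (n + 1) * (n + 1)

theorem lt_two_pow_bitLength (n : ℕ) : n < 2 ^ bitLength n :=
  Nat.lt_pow_succ_log_self (by norm_num) n

theorem bitLength_pos (n : ℕ) : 1 ≤ bitLength n := Nat.le_add_left _ _

theorem bitLength_le {n : ℕ} (hn : 1 ≤ n) : bitLength n ≤ n := by
  have : Nat.log 2 n < n := Nat.log_lt_of_lt_pow (by omega) Nat.lt_two_pow_self
  unfold bitLength; omega

theorem itemBits_le {n : ℕ} {l : List (ℕ × ℕ)} (hl : ItemsLt n (contentBound n) l) :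
    itemBits l ≤ l.length * (4 * bitLength n) := by
  unfold itemBits
  rw [← smul_eq_mul]
  have h := List.sum_le_card_nsmul (l.map fun m => 1 + Nat.size m.1 + Nat.size m.2)
    (4 * bitLength n) ?_
  · simpa using h
  · intro x hx
    obtain ⟨p, hp, rfl⟩ := List.mem_map.1 hx
    have hp := hl p hp
    have h1 := lt_two_pow_bitLength n
    have h2 : Nat.size p.1 ≤ bitLength n := Nat.size_le.2 (hp.1.trans h1)
    have h3 : Nat.size p.2 ≤ 2 * bitLength n := by
      refine Nat.size_le.2 (hp.2.trans_le ?_)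
      rw [two_mul, pow_add]
      exact Nat.mul_le_mul h1 h1
    have := bitLength_pos n
    omega

/-- The budget is large enough for `n` machines. -/
structure Suffices (L : Budget) (n : ℕ) : Prop where
  pos : 1 ≤ n
  bits : 2 ^ 24 * (n * bitLength n ^ 2) ≤ L.b
  items : 2 ^ 24 * (n * bitLength n ^ 2) ≤ L.J

section
variable {L : Budget} {n : ℕ}

theorem Suffices.large (h : Suffices L n) : 2 ^ 30 * (n + 1) ^ 4 * 2 ^ n < 2 ^ L.b := by
  have h1 : (n + 1) ^ 4 ≤ (2 ^ n) ^ 4 := Nat.pow_le_pow_left Nat.lt_two_pow_self 4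
  have h2 : 30 + n * 4 + n < L.b := by
    have h3 := h.bits
    have h4 : n * 1 ≤ n * bitLength n ^ 2 :=
      Nat.mul_le_mul_left n (Nat.one_le_pow _ _ (bitLength_pos n))
    have := h.pos
    omega
  calc 2 ^ 30 * (n + 1) ^ 4 * 2 ^ n ≤ 2 ^ 30 * (2 ^ n) ^ 4 * 2 ^ n := by gcongr
    _ = 2 ^ (30 + n * 4 + n) := by rw [← pow_mul, pow_add, pow_add]
    _ < 2 ^ L.b := Nat.pow_lt_pow_right (by norm_num) h2

theorem Suffices.poly (h : Suffices L n) : 2 ^ 30 * (n + 1) ^ 4 < 2 ^ L.b :=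
  lt_of_le_of_lt (Nat.le_mul_of_pos_right _ (by positivity)) h.large

theorem Suffices.exp (h : Suffices L n) : 2 ^ n < 2 ^ L.b :=
  lt_of_le_of_lt (Nat.le_mul_of_pos_left _ (by positivity)) h.large

theorem Suffices.lit (h : Suffices L n) {c : ℕ} (hc : c ≤ 2 ^ 30) : c < 2 ^ L.b :=
  lt_of_le_of_lt (hc.trans (Nat.le_mul_of_pos_right _ (by positivity))) h.poly

theorem Suffices.list (h : Suffices L n) :
    (n * contentBound n + 1) ^ (itemCap n + 1) < 2 ^ L.b := by
  have h1 : n * contentBound n + 1 ≤ 2 ^ (3 * bitLength n) := by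
    have h2 : n + 1 ≤ 2 ^ bitLength n := lt_two_pow_bitLength n
    calc n * contentBound n + 1 ≤ (n + 1) ^ 3 := by unfold contentBound; nlinarith [sq_nonneg n]
      _ ≤ (2 ^ bitLength n) ^ 3 := Nat.pow_le_pow_left h2 3
      _ = _ := by rw [← pow_mul, mul_comm]
  calc (n * contentBound n + 1) ^ (itemCap n + 1) ≤ (2 ^ (3 * bitLength n)) ^ (itemCap n + 1) :=
        Nat.pow_le_pow_left h1 _
    _ = 2 ^ (3 * bitLength n * (itemCap n + 1)) := by rw [← pow_mul]
    _ < 2 ^ L.b := by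
      refine Nat.pow_lt_pow_right (by norm_num) (lt_of_lt_of_le ?_ h.bits)
      have h3 := bitLength_pos n
      have h4 := h.pos
      have h5 : bitLength n ≤ n * bitLength n ^ 2 := by nlinarith
      unfold itemCap
      nlinarith

theorem Suffices.le_poly (h : Suffices L n) {x : ℕ} (hx : x ≤ 2 ^ 30 * (n + 1) ^ 4) :
    x < 2 ^ L.b := hx.trans_lt h.poly

theorem Suffices.itemsFit (h : Suffices L n) {l : List (ℕ × ℕ)}
    (hl : ItemsLt n (contentBound n) l) (hlen : l.length ≤ itemCap n) : itemBits l ≤ L.J := by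
  refine (itemBits_le hl).trans (le_trans ?_ h.items)
  calc l.length * (4 * bitLength n) ≤ itemCap n * (4 * bitLength n) :=
        Nat.mul_le_mul_right _ hlen
    _ = _ := by unfold itemCap; ring

/-- The variables `0`, `1`, `2` hold `n`, `k` and the number of the machine. -/
structure Knows (L : Budget) (n k a m : ℕ) (σ : ℕ → ℕ) : Prop where
  n : Evals L (varE 0) m σ n
  k : Evals L (varE 1) m σ k
  self : Evals L (varE 2) m σ a

theorem Knows.mono {k a m m' : ℕ} {σ σ' : ℕ → ℕ} (h : Knows L n k a m σ) (hm : m ≤ m')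
    (hσ : ∀ x < m, σ' x = σ x) : Knows L n k a m' σ' :=
  ⟨h.n.mono hm hσ, h.k.mono hm hσ, h.self.mono hm hσ⟩

/-- The value of `bitLength n`. -/
def bitLengthE : RamExpr := sumE (varE 0) fun i => leE (powE (litE 2) i) (varE 0)

/-- The value of `itemCap n`. -/
def itemCapE : RamExpr := opE .mul (litE (2 ^ 22)) (opE .mul (varE 0) bitLengthE)

/-- The value of `sampleSize n`. -/
def sampleSizeE : RamExpr := opE .mul (litE (2 ^ 20)) (opE .mul (varE 0) bitLengthE)

/-- The value of `degreeCap n k`. -/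
def degreeCapE : RamExpr :=
  opE .add (opE .div (opE .mul (litE 512) (varE 0)) (varE 1)) (litE 1)

/-- The value of `n + 1`. -/
def succE : RamExpr := opE .add (varE 0) (litE 1)

/-- The value of `contentBound n`. -/
def contentBoundE : RamExpr := opE .mul succE succE

/-- The base in which lists are stored. -/
def baseE : RamExpr := opE .add (opE .mul (varE 0) contentBoundE) (litE 1)

/-- The digit that stands for an item. -/
def itemE (y z : RamExpr) : RamExpr :=
  opE .add (opE .add (opE .mul y contentBoundE) z) (litE 1)

/-- Whether the item `(y, z)` belongs to the list stored in `x`. -/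
def memE (x y z : RamExpr) : RamExpr :=
  anyE itemCapE fun i => eqE (modE (opE .div x (powE baseE i)) baseE) (itemE y z)

variable {k a m : ℕ} {σ : ℕ → ℕ}

theorem Suffices.itemCap_le (h : Suffices L n) : itemCap n ≤ 2 ^ 30 * (n + 1) ^ 4 := by
  have h1 := bitLength_le h.pos
  have h2 : n * bitLength n ≤ (n + 1) ^ 2 := by nlinarith
  have h3 : (n + 1) ^ 2 ≤ (n + 1) ^ 4 := Nat.pow_le_pow_right (by omega) (by norm_num)
  unfold itemCap
  omega

theorem sum_two_pow_le {n : ℕ} (hn : 1 ≤ n) :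
    ∑ i ∈ Finset.range n, ind (2 ^ i ≤ n) = bitLength n := by
  classical
  have : ∀ i, 2 ^ i ≤ n ↔ i < bitLength n := fun i => by
    rw [bitLength, Nat.lt_succ_iff, Nat.le_log_iff_pow_le (by norm_num) (by omega)]
  simp only [this, ind, Finset.sum_ite, Finset.sum_const_zero, add_zero, Finset.sum_const,
    smul_eq_mul, mul_one]
  rw [show (Finset.range n).filter (fun i => i < bitLength n) = Finset.range (bitLength n) from ?_,
    Finset.card_range]
  ext i
  have := bitLength_le hn
  simp; omega

theorem Suffices.pow_lt (h : Suffices L n) {i : ℕ} (hi : i ≤ n) : 2 ^ i < 2 ^ L.b :=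
  lt_of_le_of_lt (Nat.pow_le_pow_right (by norm_num) hi) h.exp

theorem Knows.evals_bitLength (hk : Knows L n k a m σ) (h : Suffices L n) :
    Evals L bitLengthE m σ (bitLength n) := by
  have h2 : 2 < 2 ^ L.b := h.lit (by norm_num)
  have hs := sum_two_pow_le h.pos
  refine (Evals.sum (F := fun i => ind (2 ^ i ≤ n)) hk.n ?_ ?_).of_eq hs
  · intro i hi m' σ' ei hm hσ he
    exact ((Evals.lit h2).pow he (by norm_num) (h.pow_lt hi.le)).leTest (by omega) (hk.n.mono hm hσ)
  · rw [hs]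
    exact (bitLength_le h.pos).trans_lt hk.n.lt

theorem Knows.evals_itemCap (hk : Knows L n k a m σ) (h : Suffices L n) :
    Evals L itemCapE m σ (itemCap n) := by
  have h1 := h.itemCap_le
  unfold itemCap at *
  exact (Evals.lit (h.lit (by norm_num))).mul
    (hk.n.mul (hk.evals_bitLength h) (h.le_poly (by omega)))
    (h.le_poly h1)

theorem Knows.evals_sampleSize (hk : Knows L n k a m σ) (h : Suffices L n) :
    Evals L sampleSizeE m σ (sampleSize n) := by
  have h1 := h.itemCap_le
  unfold itemCap at h1
  exact (Evals.lit (h.lit (by norm_num))).mul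
    (hk.n.mul (hk.evals_bitLength h) (h.le_poly (by omega)))
    (h.le_poly (by omega))

theorem Suffices.linear (h : Suffices L n) {c : ℕ} (hc : c ≤ 2 ^ 30) : c * (n + 1) < 2 ^ L.b := by
  refine h.le_poly (Nat.mul_le_mul hc ?_)
  exact Nat.le_self_pow (by norm_num) _

theorem Knows.evals_degreeCap (hk : Knows L n k a m σ) (h : Suffices L n) :
    Evals L degreeCapE m σ (degreeCap n k) := by
  have h1 := h.linear (c := 1024) (by norm_num)
  have h2 := Nat.div_le_self (512 * n) k
  exact (((Evals.lit (h.lit (by norm_num))).mul hk.n (by omega)).div hk.k).add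
    (Evals.lit (h.lit (by norm_num))) (by omega)

theorem Knows.evals_succ (hk : Knows L n k a m σ) (h : Suffices L n) :
    Evals L succE m σ (n + 1) := by
  have h1 := h.linear (c := 1) (by norm_num)
  exact hk.n.add (Evals.lit (h.lit (by norm_num))) (by omega)

theorem Suffices.base_le (h : Suffices L n) : n * contentBound n + 1 < 2 ^ L.b :=
  lt_of_le_of_lt (Nat.le_self_pow (by omega) _) h.list

theorem Knows.evals_contentBound (hk : Knows L n k a m σ) (h : Suffices L n) :
    Evals L contentBoundE m σ (contentBound n) := by
  have h1 := h.base_le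
  have h2 := Nat.mul_le_mul_right (contentBound n) h.pos
  have h3 : (n + 1) * (n + 1) = contentBound n := rfl
  exact (hk.evals_succ h).mul (hk.evals_succ h) (by omega)

theorem Knows.evals_base (hk : Knows L n k a m σ) (h : Suffices L n) :
    Evals L baseE m σ (n * contentBound n + 1) := by
  have h1 := h.base_le
  exact (hk.n.mul (hk.evals_contentBound h) (by omega)).add (Evals.lit (h.lit (by norm_num))) h1

theorem Knows.evals_item (hk : Knows L n k a m σ) (h : Suffices L n) {ey ez : RamExpr} {y z : ℕ}
    (hy : Evals L ey m σ y) (hz : Evals L ez m σ z) (hy' : y < n)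
    (hz' : z < contentBound n) :
    Evals L (itemE ey ez) m σ (y * contentBound n + z + 1) := by
  have h1 := h.base_le
  have h2 := itemCode_lt hy' hz'
  exact ((hy.mul (hk.evals_contentBound h) (by omega)).add hz (by omega)).add
    (Evals.lit (h.lit (by norm_num))) (by omega)

theorem Knows.evals_mem (hk : Knows L n k a m σ) (h : Suffices L n) {ex ey ez : RamExpr}
    {l : List (ℕ × ℕ)} {y z : ℕ} (hx : Evals L ex m σ (listCode n (contentBound n) l))
    (hy : Evals L ey m σ y) (hz : Evals L ez m σ z) (hl : ItemsLt n (contentBound n) l)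
    (hlen : l.length ≤ itemCap n) (hy' : y < n) (hz' : z < contentBound n) :
    Evals L (memE ex ey ez) m σ (ind ((y, z) ∈ l)) := by
  have h1 : 1 < 2 ^ L.b := h.lit (by norm_num)
  refine (Evals.any h1 (hk.evals_itemCap h) ?_).of_eq (congrArg ind (propext
    (exists_digit_iff (y := y) hl hlen hz')))
  intro i hi m' σ' ei hm hσ he
  have hk' := hk.mono hm hσ
  refine (((hx.mono hm hσ).div ((hk'.evals_base h).pow he (by omega) ?_)).mod
    (hk'.evals_base h)).eqTest h1 (hk'.evals_item h (hy.mono hm hσ) (hz.mono hm hσ) hy' hz')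
  exact lt_of_le_of_lt (Nat.pow_le_pow_right (by omega) (by omega)) h.list

/-- Adding the current item to the list in register `x`. -/
def pushE (x : ℕ) : RamExpr := opE .add (opE .mul (varE x) baseE) (itemE (varE 4) (varE 5))

/-- The machine state knows its input. -/
structure Holds (s : MachineState) (n k a : ℕ) : Prop where
  n : s.mem 0 = n
  k : s.mem 1 = k
  self : s.mem 2 = a

theorem knows_of_eq (hn : σ 0 = n) (hk : σ 1 = k) (ha : σ 2 = a)
    (hσ : ∀ y, σ y < 2 ^ L.b) : Knows L n k a 16 σ :=
  ⟨(Evals.var (by norm_num) (hσ 0)).of_eq hn, (Evals.var (by norm_num) (hσ 1)).of_eq hk,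
    (Evals.var (by norm_num) (hσ 2)).of_eq ha⟩

theorem exec_recvList {x : ℕ} {s : MachineState} (h : Suffices L n) (hx : 8 < x) (hx' : x < 16)
    (hR : (recvP x (pushE x)).regBound ≤ L.R) (hs : Fits L s) (hh : Holds s n k a)
    (hl : ItemsLt n (contentBound n) s.inbox) (hlen : s.inbox.length ≤ itemCap n) :
    ∃ t, RamExec L.total (recvP x (pushE x)) s t ∧ Fits L t ∧ Holds t n k a ∧
      t.mem x = listCode n (contentBound n) s.inbox ∧
      (∀ y < 16, 8 < y → y ≠ x → t.mem y = s.mem y) ∧ t.inbox = [] ∧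
      t.outbox = s.outbox ∧ t.coins = s.coins := by
  have hcb : n ≤ n * contentBound n :=
    Nat.le_mul_of_pos_right _ (by unfold contentBound; positivity)
  have hcb' : contentBound n ≤ n * contentBound n := Nat.le_mul_of_pos_left _ h.pos
  have hb := h.base_le
  obtain ⟨t, ht, hft, hx'', hy, hrest⟩ := exec_recvP (L := L) (push := pushE x)
    (g := listCode n (contentBound n)) (by omega) hx'
    hR hs (h.lit (by norm_num)) (fun p hp => by have := hl p hp; omega) rfl (by
      intro l p r hs' σ hσ hσlt h9 h4 h5
      have hkn : Knows L n k a 16 σ := knows_of_eq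
        ((hσ 0 (by omega) (by omega) (by omega) (by omega) (by omega)).trans hh.n)
        ((hσ 1 (by omega) (by omega) (by omega) (by omega) (by omega)).trans hh.k)
        ((hσ 2 (by omega) (by omega) (by omega) (by omega) (by omega)).trans hh.self) hσlt
      have hp := hl p (by rw [hs']; simp)
      have hl' : ItemsLt n (contentBound n) (l ++ [p]) := fun q hq => hl q (by
        rw [hs']; simp only [List.mem_append, List.mem_cons] at hq ⊢; tauto)
      have hlt : listCode n (contentBound n) (l ++ [p]) < 2 ^ L.b := by
        refine (listCode_lt hl').trans (lt_of_le_of_lt (Nat.pow_le_pow_right (by omega) ?_) h.list)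
        rw [hs'] at hlen
        simp only [List.length_append, List.length_nil, List.length_cons] at hlen ⊢
        omega
      rw [listCode_append] at hlt ⊢
      exact (((Evals.var hx' (hσlt x)).of_eq h9).mul (hkn.evals_base h) (by omega)).add
        (hkn.evals_item h ((Evals.var (by norm_num) (hσlt 4)).of_eq h4)
          ((Evals.var (by norm_num) (hσlt 5)).of_eq h5) hp.1 hp.2) hlt)
  refine ⟨t, ht, hft, ⟨?_, ?_, ?_⟩, hx'', fun y hy16 hy8 hyx => hy y hy16 (by omega) (by omega)
    (by omega) hyx, hrest⟩
  · rw [hy 0 (by omega) (by omega) (by omega) (by omega) (by omega), hh.n]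
  · rw [hy 1 (by omega) (by omega) (by omega) (by omega) (by omega), hh.k]
  · rw [hy 2 (by omega) (by omega) (by omega) (by omega) (by omega), hh.self]

/-! ### First round: every edge is sent to both of its end points -/

/-- The program of the first round. -/
def roundOne : RamProg :=
  .seq (recvP 9 (pushE 9)) (sendP (opE .mul (varE 0) (varE 0))
    (orE (memE (varE 9) (opE .div (varE 6) (varE 0)) (modE (varE 6) (varE 0)))
      (memE (varE 9) (modE (varE 6) (varE 0)) (opE .div (varE 6) (varE 0))))
    (opE .div (varE 6) (varE 0)) (modE (varE 6) (varE 0)))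

/-- The messages sent in the first round by a machine that holds the edges `l`. -/
noncomputable def sentOne (n : ℕ) (l : List (ℕ × ℕ)) : List (ℕ × ℕ) :=
  sentItems (n * n) (fun i => (i / n, i % n) ∈ l ∨ (i % n, i / n) ∈ l) (fun i => i / n)
    (fun i => i % n)

theorem le_contentBound (n : ℕ) : n ≤ contentBound n := by unfold contentBound; nlinarith

theorem exec_roundOne {s : MachineState} (h : Suffices L n)
    (hR : roundOne.regBound ≤ L.R) (hs : Fits L s) (hh : Holds s n k a)
    (hl : ItemsLt n (contentBound n) s.inbox) (hlen : s.inbox.length ≤ itemCap n)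
    (hout : s.outbox = []) (hJ : itemBits (sentOne n s.inbox) ≤ L.J) :
    ∃ t, RamExec L.total roundOne s t ∧ Fits L t ∧ Holds t n k a ∧
      t.outbox = sentOne n s.inbox ∧ t.coins = s.coins := by
  have h1 : 1 < 2 ^ L.b := h.lit (by norm_num)
  simp only [roundOne, RamProg.regBound, sup_le_iff] at hR
  obtain ⟨t, ht, hft, hht, h9, -, hin, hou, hco⟩ := exec_recvList h (by norm_num) (by norm_num)
    hR.1 hs hh hl hlen
  have hnn : n * n < 2 ^ L.b := h.le_poly (by nlinarith [Nat.one_le_pow 2 (n + 1) (by omega)])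
  have hkn : Knows L n k a 16 t.mem := knows_of_eq hht.n hht.k hht.self hft.lt
  obtain ⟨u, hu, hfu, hy, huo, huc⟩ := exec_sendP (L := L) hR.2 hft h1 hin (hou.trans hout) hJ
    (hkn.n.mul hkn.n hnn) (by
      intro i hi σ hσ hσlt h6
      have hkn : Knows L n k a 16 σ := knows_of_eq
        ((hσ 0 (by omega) (by omega) (by omega) (by omega)).trans hht.n)
        ((hσ 1 (by omega) (by omega) (by omega) (by omega)).trans hht.k)
        ((hσ 2 (by omega) (by omega) (by omega) (by omega)).trans hht.self) hσlt
      have e9 := (Evals.var (L := L) (m := 16) (by norm_num) (hσlt 9)).of_eq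
        ((hσ 9 (by omega) (by omega) (by omega) (by omega)).trans h9)
      have e6 := (Evals.var (L := L) (m := 16) (by norm_num) (hσlt 6)).of_eq h6
      have hd : i / n < n := Nat.div_lt_of_lt_mul hi
      have hm : i % n < n := Nat.mod_lt _ h.pos
      have hcb := le_contentBound n
      have ed := e6.div hkn.n
      have em := e6.mod hkn.n
      exact ⟨(hkn.evals_mem h e9 ed em hl hlen hd (by omega)).or h1
        (hkn.evals_mem h e9 em ed hl hlen hm (by omega)), fun _ => ⟨ed, em⟩⟩)
  refine ⟨u, .seq ht hu, hfu, ⟨?_, ?_, ?_⟩, huo, huc.trans hco⟩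
  · rw [hy 0 (by omega) (by omega) (by omega) (by omega), hht.n]
  · rw [hy 1 (by omega) (by omega) (by omega) (by omega), hht.k]
  · rw [hy 2 (by omega) (by omega) (by omega) (by omega), hht.self]

/-! ### Second round: degrees and levels are broadcast -/

/-- Membership in the closed neighbourhood of machine `a`, given the messages of the first round. -/
def Closed (n a : ℕ) (l : List (ℕ × ℕ)) (w : ℕ) : Prop := w = a ∨ ∃ i < n, (i, w) ∈ l

/-- The restriction of `P` to the `D` smallest numbers that satisfy it. -/
def Lowest (P : ℕ → Prop) (D u : ℕ) : Prop := P u ∧ ∑ w ∈ Finset.range u, ind (P w) < D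

/-- Whether `w` is in the closed neighbourhood. -/
def closedE (w : RamExpr) : RamExpr :=
  orE (eqE w (varE 2)) (anyE (varE 0) fun i => memE (varE 9) i w)

/-- Whether `u` is in the truncated neighbourhood. -/
def lowestE (u : RamExpr) : RamExpr :=
  andE (closedE u) (ltE (sumE u fun w => closedE w) degreeCapE)

theorem Knows.evals_lowest (hk : Knows L n k a m σ) (h : Suffices L n) {eu : RamExpr}
    {l : List (ℕ × ℕ)} {u : ℕ} (h9 : Evals L (varE 9) m σ (listCode n (contentBound n) l))
    (hu : Evals L eu m σ u) (hl : ItemsLt n (contentBound n) l)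
    (hlen : l.length ≤ itemCap n) (hu' : u < n) :
    Evals L (lowestE eu) m σ (ind (Lowest (Closed n a l) (degreeCap n k) u)) := by
  have h1 : 1 < 2 ^ L.b := h.lit (by norm_num)
  have closed : ∀ (m' : ℕ) (σ' : ℕ → ℕ) (ew : RamExpr) (w : ℕ), m ≤ m' → (∀ x < m, σ' x = σ x) →
      Evals L ew m' σ' w → w < n → Evals L (closedE ew) m' σ' (ind (Closed n a l w)) := by
    intro m' σ' ew w hm hσ hw hw'
    have hk' := hk.mono hm hσ
    refine (hw.eqTest h1 hk'.self).or h1 (Evals.any h1 hk'.n ?_)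
    intro i hi m'' σ'' ei hm' hσ' he
    exact (hk'.mono hm' hσ').evals_mem h ((h9.mono hm hσ).mono hm' hσ') he (hw.mono hm' hσ') hl
      hlen hi (hw'.trans_le (le_contentBound n))
  refine (closed m σ eu u le_rfl (fun _ _ => rfl) hu hu').and ((Evals.sum hu ?_ ?_).ltTest h1
    (hk.evals_degreeCap h))
  · intro i hi m' σ' ei hm hσ he
    exact closed m' σ' ei i hm hσ he (hi.trans hu')
  · exact (sum_ind_le _ _).trans_lt hu.lt

/-- The size of the truncated neighbourhood. -/
noncomputable def lowestCount (n k a : ℕ) (l : List (ℕ × ℕ)) : ℕ :=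
  ∑ u ∈ Finset.range n, ind (Lowest (Closed n a l) (degreeCap n k) u)

theorem lowestCount_le (n k a : ℕ) (l : List (ℕ × ℕ)) : lowestCount n k a l ≤ n := sum_ind_le _ _

/-- The program of the second round. -/
def roundTwo : RamProg :=
  .seq (recvP 9 (pushE 9)) (.seq (flipP (varE 0)) (sendP (varE 0) (litE 1) (varE 6)
    (opE .add (opE .mul (sumE (varE 0) lowestE) succE) (varE 12))))

/-- The content of the messages of the second round. -/
noncomputable def report (n k a : ℕ) (l : List (ℕ × ℕ)) (c : ℕ → Bool) : ℕ :=
  lowestCount n k a l * (n + 1) + trailingOnes c n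

theorem report_lt (n k a : ℕ) (l : List (ℕ × ℕ)) (c : ℕ → Bool) :
    report n k a l c < contentBound n := by
  have h1 := Nat.mul_le_mul_right (n + 1) (lowestCount_le n k a l)
  have h2 := trailingOnes_le c n
  have h3 : contentBound n = n * (n + 1) + (n + 1) := by unfold contentBound; ring
  unfold report
  omega

/-- The messages sent in the second round. -/
noncomputable def sentTwo (n k a : ℕ) (l : List (ℕ × ℕ)) (c : ℕ → Bool) : List (ℕ × ℕ) :=
  sentItems n (fun _ => True) (fun i => i) (fun _ => report n k a l c)

theorem exec_roundTwo {s : MachineState} (h : Suffices L n)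
    (hR : roundTwo.regBound ≤ L.R) (hs : Fits L s) (hh : Holds s n k a)
    (hl : ItemsLt n (contentBound n) s.inbox) (hlen : s.inbox.length ≤ itemCap n)
    (hout : s.outbox = []) (hJ : itemBits (sentTwo n k a s.inbox s.coins) ≤ L.J) :
    ∃ t, RamExec L.total roundTwo s t ∧ Fits L t ∧ Holds t n k a ∧
      t.mem 9 = listCode n (contentBound n) s.inbox ∧ t.mem 12 = trailingOnes s.coins n ∧
      t.outbox = sentTwo n k a s.inbox s.coins := by
  have h1 : 1 < 2 ^ L.b := h.lit (by norm_num)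
  simp only [roundTwo, RamProg.regBound, max_le_iff] at hR
  obtain ⟨t, ht, hft, hht, h9, -, hin, hou, hco⟩ := exec_recvList h (by norm_num) (by norm_num)
    hR.1 hs hh hl hlen
  have hn1 := h.linear (c := 1) (by norm_num)
  obtain ⟨r, hr, hfr, hry, h12, hrin, hrou⟩ := exec_flipP (N := n) hR.2.1 hft (by omega) (by
    intro σ hσ hσlt
    exact (Evals.var (by norm_num) (hσlt 0)).of_eq ((hσ 0 (by norm_num)).trans hht.n))
  rw [hco] at h12
  have r0 := (hry 0 (by omega) (by omega) (by omega) (by omega)).trans hht.n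
  have r1 := (hry 1 (by omega) (by omega) (by omega) (by omega)).trans hht.k
  have r2 := (hry 2 (by omega) (by omega) (by omega) (by omega)).trans hht.self
  have r9 := (hry 9 (by omega) (by omega) (by omega) (by omega)).trans h9
  have hkn : Knows L n k a 16 r.mem := knows_of_eq r0 r1 r2 hfr.lt
  obtain ⟨u, hu, hfu, hy, huo, huc⟩ := exec_sendP (L := L) hR.2.2 hfr h1 (hrin.trans hin)
    (hrou.trans (hou.trans hout)) hJ hkn.n (by
      intro i hi σ hσ hσlt h6
      have hkn : Knows L n k a 16 σ := knows_of_eq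
        ((hσ 0 (by omega) (by omega) (by omega) (by omega)).trans r0)
        ((hσ 1 (by omega) (by omega) (by omega) (by omega)).trans r1)
        ((hσ 2 (by omega) (by omega) (by omega) (by omega)).trans r2) hσlt
      have e9 := (Evals.var (L := L) (m := 16) (by norm_num) (hσlt 9)).of_eq
        ((hσ 9 (by omega) (by omega) (by omega) (by omega)).trans r9)
      have e12 := (Evals.var (L := L) (m := 16) (by norm_num) (hσlt 12)).of_eq
        ((hσ 12 (by omega) (by omega) (by omega) (by omega)).trans h12)
      have e6 := (Evals.var (L := L) (m := 16) (by norm_num) (hσlt 6)).of_eq h6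
      have hlt := (report_lt n k a s.inbox s.coins).trans (hkn.evals_contentBound h).lt
      have hlt' : lowestCount n k a s.inbox * (n + 1) < 2 ^ L.b := by
        unfold report at hlt; omega
      refine ⟨(Evals.lit h1).of_eq (ind_true trivial).symm, fun _ => ⟨e6, ?_⟩⟩
      refine ((Evals.sum hkn.n ?_ ?_).mul (hkn.evals_succ h) hlt').add e12 hlt
      · intro j hj m' σ' ej hm hσ' hej
        exact (hkn.mono hm hσ').evals_lowest h (e9.mono hm hσ') hej hl hlen hj
      · exact (lowestCount_le n k a s.inbox).trans_lt hkn.n.lt)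
  refine ⟨u, .seq ht (.seq hr hu), hfu, ⟨?_, ?_, ?_⟩, ?_, ?_, huo⟩
  · rw [hy 0 (by omega) (by omega) (by omega) (by omega), r0]
  · rw [hy 1 (by omega) (by omega) (by omega) (by omega), r1]
  · rw [hy 2 (by omega) (by omega) (by omega) (by omega), r2]
  · rw [hy 9 (by omega) (by omega) (by omega) (by omega), r9]
  · rw [hy 12 (by omega) (by omega) (by omega) (by omega), h12]

/-! ### Third round: the sample is sent to machine `0` -/

/-- The sum of all truncated degrees, read off from the reports. -/
noncomputable def totalDegree (n : ℕ) (l : List (ℕ × ℕ)) : ℕ :=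
  ∑ i ∈ Finset.range n, ∑ x ∈ Finset.range (contentBound n), x / (n + 1) * ind ((i, x) ∈ l)

/-- The least `j` for which the expected size `T / 2 ^ j` of the sample is small enough: the smaller
levels are counted. -/
noncomputable def sampleLevel (n T : ℕ) : ℕ :=
  ∑ i ∈ Finset.range n, ind (sampleSize n * 2 ^ i < T)

/-- The number of items in the sample of level `j`, read off from the reports. -/
noncomputable def sampleLoad (n j : ℕ) (l : List (ℕ × ℕ)) : ℕ :=
  ∑ i ∈ Finset.range n, ∑ x ∈ Finset.range (contentBound n),
    x / (n + 1) * ind (j ≤ x % (n + 1)) * ind ((i, x) ∈ l)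

/-- The value of `totalDegree`. -/
def totalDegreeE : RamExpr := sumE (varE 0) fun i => sumE contentBoundE fun x =>
  opE .mul (opE .div x succE) (memE (varE 10) i x)

/-- The value of `sampleLevel`. -/
def sampleLevelE : RamExpr := sumE (varE 0) fun i =>
  ltE (opE .mul sampleSizeE (powE (litE 2) i)) totalDegreeE

/-- The value of `sampleLoad`. -/
def sampleLoadE : RamExpr := sumE (varE 0) fun i => sumE contentBoundE fun x =>
  opE .mul (opE .mul (opE .div x succE) (leE sampleLevelE (modE x succE))) (memE (varE 10) i x)

theorem Suffices.double_sum (h : Suffices L n) {F : ℕ → ℕ → ℕ}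
    (hF : ∀ i, ∀ x < contentBound n, F i x ≤ n + 1) :
    (∀ i, ∑ x ∈ Finset.range (contentBound n), F i x < 2 ^ L.b) ∧
    ∑ i ∈ Finset.range n, ∑ x ∈ Finset.range (contentBound n), F i x < 2 ^ L.b := by
  have h1 : ∀ i, ∑ x ∈ Finset.range (contentBound n), F i x ≤ (n + 1) ^ 3 := by
    intro i
    refine (Finset.sum_le_card_nsmul _ _ (n + 1)
      fun x hx => hF i x (Finset.mem_range.1 hx)).trans ?_
    rw [Finset.card_range, smul_eq_mul, contentBound]
    exact le_of_eq (by ring)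
  refine ⟨fun i => h.le_poly ((h1 i).trans ?_), h.le_poly ?_⟩
  · calc (n + 1) ^ 3 ≤ (n + 1) ^ 4 := Nat.pow_le_pow_right (by omega) (by norm_num)
      _ ≤ _ := Nat.le_mul_of_pos_left _ (by norm_num)
  · refine (Finset.sum_le_card_nsmul _ _ _ fun i _ => h1 i).trans ?_
    rw [Finset.card_range, smul_eq_mul]
    calc n * (n + 1) ^ 3 ≤ (n + 1) * (n + 1) ^ 3 := by gcongr; omega
      _ = (n + 1) ^ 4 := by ring
      _ ≤ _ := Nat.le_mul_of_pos_left _ (by norm_num)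

theorem div_le_of_lt_contentBound {n x : ℕ} (hx : x < contentBound n) : x / (n + 1) ≤ n + 1 :=
  (Nat.div_lt_of_lt_mul hx).le

theorem mul_ind_le (x : ℕ) (P : Prop) : x * ind P ≤ x := by
  simpa using Nat.mul_le_mul_left x (ind_le_one P)

theorem Knows.evals_totalDegree (hk : Knows L n k a m σ) (h : Suffices L n) {l : List (ℕ × ℕ)}
    (h10 : Evals L (varE 10) m σ (listCode n (contentBound n) l))
    (hl : ItemsLt n (contentBound n) l) (hlen : l.length ≤ itemCap n) :
    Evals L totalDegreeE m σ (totalDegree n l) := by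
  have hF : ∀ i, ∀ x < contentBound n, x / (n + 1) * ind ((i, x) ∈ l) ≤ n + 1 :=
    fun i x hx => (mul_ind_le _ _).trans (div_le_of_lt_contentBound hx)
  have hb := h.linear (c := 1) (by norm_num)
  refine Evals.sum hk.n ?_ (h.double_sum hF).2
  intro i hi m' σ' ei hm hσ he
  have hk' := hk.mono hm hσ
  refine Evals.sum (hk'.evals_contentBound h) ?_ ((h.double_sum hF).1 i)
  intro x hx m'' σ'' ex hm' hσ' hex
  have hk'' := hk'.mono hm' hσ'
  exact (hex.div (hk''.evals_succ h)).mul (hk''.evals_mem h ((h10.mono hm hσ).mono hm' hσ')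
    (he.mono hm' hσ') hex hl hlen hi hx) ((hF i x hx).trans_lt (by omega))

theorem Suffices.sampleSize_mul_lt (h : Suffices L n) {i : ℕ} (hi : i < n) :
    sampleSize n * 2 ^ i < 2 ^ L.b := by
  have h1 := h.itemCap_le
  have h2 : sampleSize n ≤ itemCap n := by
    unfold sampleSize itemCap; omega
  refine lt_of_le_of_lt ?_ h.large
  exact Nat.mul_le_mul (h2.trans h1) (Nat.pow_le_pow_right (by norm_num) hi.le)

theorem Knows.evals_sampleLevel (hk : Knows L n k a m σ) (h : Suffices L n) {l : List (ℕ × ℕ)}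
    (h10 : Evals L (varE 10) m σ (listCode n (contentBound n) l))
    (hl : ItemsLt n (contentBound n) l) (hlen : l.length ≤ itemCap n) :
    Evals L sampleLevelE m σ (sampleLevel n (totalDegree n l)) := by
  have h1 : 1 < 2 ^ L.b := h.lit (by norm_num)
  refine Evals.sum hk.n ?_ ((sum_ind_le _ _).trans_lt hk.n.lt)
  intro i hi m' σ' ei hm hσ he
  have hk' := hk.mono hm hσ
  exact ((hk'.evals_sampleSize h).mul ((Evals.lit (h.lit (by norm_num))).pow he (by norm_num)
    (h.pow_lt hi.le)) (h.sampleSize_mul_lt hi)).ltTest h1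
    (hk'.evals_totalDegree h (h10.mono hm hσ) hl hlen)

theorem Knows.evals_sampleLoad (hk : Knows L n k a m σ) (h : Suffices L n) {l : List (ℕ × ℕ)}
    (h10 : Evals L (varE 10) m σ (listCode n (contentBound n) l))
    (hl : ItemsLt n (contentBound n) l) (hlen : l.length ≤ itemCap n) :
    Evals L sampleLoadE m σ (sampleLoad n (sampleLevel n (totalDegree n l)) l) := by
  have h1 : 1 < 2 ^ L.b := h.lit (by norm_num)
  have hG : ∀ x < contentBound n,
      x / (n + 1) * ind (sampleLevel n (totalDegree n l) ≤ x % (n + 1)) ≤ n + 1 :=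
    fun x hx => (mul_ind_le _ _).trans (div_le_of_lt_contentBound hx)
  have hF : ∀ i, ∀ x < contentBound n,
      x / (n + 1) * ind (sampleLevel n (totalDegree n l) ≤ x % (n + 1)) *
        ind ((i, x) ∈ l) ≤ n + 1 :=
    fun i x hx => (mul_ind_le _ _).trans (hG x hx)
  have hb := h.linear (c := 1) (by norm_num)
  refine Evals.sum hk.n ?_ (h.double_sum hF).2
  intro i hi m' σ' ei hm hσ he
  have hk' := hk.mono hm hσ
  refine Evals.sum (hk'.evals_contentBound h) ?_ ((h.double_sum hF).1 i)
  intro x hx m'' σ'' ex hm' hσ' hex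
  have hk'' := hk'.mono hm' hσ'
  have h10' := (h10.mono hm hσ).mono hm' hσ'
  exact ((hex.div (hk''.evals_succ h)).mul ((hk''.evals_sampleLevel h h10' hl hlen).leTest h1
    (hex.mod (hk''.evals_succ h))) ((hG x hx).trans_lt (by omega))).mul (hk''.evals_mem h h10'
      (he.mono hm' hσ') hex hl hlen hi hx) ((hF i x hx).trans_lt (by omega))

/-- The program of the third round. -/
def roundThree : RamProg :=
  .seq (recvP 10 (pushE 10)) (sendP (varE 0)
    (andE (andE (leE sampleLoadE itemCapE) (leE sampleLevelE (varE 12))) (lowestE (varE 6)))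
    (litE 0) (varE 6))

/-- The messages sent in the third round by machine `a`, which received the lists `l` in the
second and `r` in the third round, and whose level is `v`. -/
noncomputable def sentThree (n k a v : ℕ) (l r : List (ℕ × ℕ)) : List (ℕ × ℕ) :=
  sentItems n (fun u => (sampleLoad n (sampleLevel n (totalDegree n r)) r ≤ itemCap n ∧
    sampleLevel n (totalDegree n r) ≤ v) ∧ Lowest (Closed n a l) (degreeCap n k) u)
    (fun _ => 0) (fun u => u)

theorem exec_roundThree {s : MachineState} {v : ℕ} {l : List (ℕ × ℕ)} (h : Suffices L n)
    (hR : roundThree.regBound ≤ L.R) (hs : Fits L s) (hh : Holds s n k a)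
    (h9 : s.mem 9 = listCode n (contentBound n) l) (h12 : s.mem 12 = v)
    (hl : ItemsLt n (contentBound n) l) (hlen : l.length ≤ itemCap n)
    (hl' : ItemsLt n (contentBound n) s.inbox) (hlen' : s.inbox.length ≤ itemCap n)
    (hout : s.outbox = []) (hJ : itemBits (sentThree n k a v l s.inbox) ≤ L.J) :
    ∃ t, RamExec L.total roundThree s t ∧ Fits L t ∧ Holds t n k a ∧
      t.outbox = sentThree n k a v l s.inbox := by
  have h1 : 1 < 2 ^ L.b := h.lit (by norm_num)
  simp only [roundThree, RamProg.regBound, max_le_iff] at hR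
  obtain ⟨t, ht, hft, hht, h10, hty, hin, hou, hco⟩ := exec_recvList h (by norm_num)
    (by norm_num) hR.1 hs hh hl' hlen'
  have hkn : Knows L n k a 16 t.mem := knows_of_eq hht.n hht.k hht.self hft.lt
  obtain ⟨u, hu, hfu, hy, huo, huc⟩ := exec_sendP (L := L) hR.2 hft h1 hin (hou.trans hout) hJ
    hkn.n (by
      intro i hi σ hσ hσlt h6
      have hkn : Knows L n k a 16 σ := knows_of_eq
        ((hσ 0 (by omega) (by omega) (by omega) (by omega)).trans hht.n)
        ((hσ 1 (by omega) (by omega) (by omega) (by omega)).trans hht.k)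
        ((hσ 2 (by omega) (by omega) (by omega) (by omega)).trans hht.self) hσlt
      have e9 := (Evals.var (L := L) (m := 16) (by norm_num) (hσlt 9)).of_eq
        ((hσ 9 (by omega) (by omega) (by omega) (by omega)).trans
          ((hty 9 (by omega) (by omega) (by omega)).trans h9))
      have e10 := (Evals.var (L := L) (m := 16) (by norm_num) (hσlt 10)).of_eq
        ((hσ 10 (by omega) (by omega) (by omega) (by omega)).trans h10)
      have e12 := (Evals.var (L := L) (m := 16) (by norm_num) (hσlt 12)).of_eq
        ((hσ 12 (by omega) (by omega) (by omega) (by omega)).trans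
          ((hty 12 (by omega) (by omega) (by omega)).trans h12))
      have e6 := (Evals.var (L := L) (m := 16) (by norm_num) (hσlt 6)).of_eq h6
      exact ⟨(((hkn.evals_sampleLoad h e10 hl' hlen').leTest h1 (hkn.evals_itemCap h)).and
        ((hkn.evals_sampleLevel h e10 hl' hlen').leTest h1 e12)).and
        (hkn.evals_lowest h e9 e6 hl hlen hi), fun _ => ⟨Evals.lit (by positivity), e6⟩⟩)
  refine ⟨u, .seq ht hu, hfu, ⟨?_, ?_, ?_⟩, huo⟩
  · rw [hy 0 (by omega) (by omega) (by omega) (by omega), hht.n]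
  · rw [hy 1 (by omega) (by omega) (by omega) (by omega), hht.k]
  · rw [hy 2 (by omega) (by omega) (by omega) (by omega), hht.self]

/-! ### Fourth round: exhaustive search -/

/-- The objective function of the search: it is `0` unless the bit mask `S` has `k` elements, and
otherwise one more than the number of sampled vertices that `S` covers. -/
noncomputable def searchKey (n k : ℕ) (l : List (ℕ × ℕ)) (S : ℕ) : ℕ :=
  ind (∑ u ∈ Finset.range n, ind (S.testBit u = true) = k) *
    (1 + ∑ v ∈ Finset.range n, ind (∃ u < n, S.testBit u = true ∧ (v, u) ∈ l))

/-- A maximizer of `f` among `N - 1, …, N - j` (or `0`). -/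
def argmaxFrom (f : ℕ → ℕ) (N : ℕ) : ℕ → ℕ
  | 0 => 0
  | j + 1 => if f (argmaxFrom f N j) < f (N - (j + 1)) then N - (j + 1) else argmaxFrom f N j

theorem le_argmaxFrom (f : ℕ → ℕ) {N j x : ℕ} (hj : N - j ≤ x) (hx : x < N) :
    f x ≤ f (argmaxFrom f N j) := by
  induction j with
  | zero => omega
  | succ j ih =>
    unfold argmaxFrom
    by_cases h : N - j ≤ x
    · have := ih h
      split_ifs <;> omega
    · have : x = N - (j + 1) := by omega
      subst this
      split_ifs <;> omega

/-- The value of `searchKey`. -/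
def searchKeyE (S : RamExpr) : RamExpr :=
  opE .mul (eqE (sumE (varE 0) fun u => bitE S u) (varE 1))
    (opE .add (litE 1) (sumE (varE 0) fun v => anyE (varE 0) fun u =>
      andE (bitE S u) (memE (varE 11) v u)))

/-- The best bit mask. -/
def searchE : RamExpr := foldE (powE (litE 2) (varE 0)) (litE 0) fun e S =>
  opE .add (opE .mul (ltE (searchKeyE e) (searchKeyE S)) S)
    (opE .mul (notE (ltE (searchKeyE e) (searchKeyE S))) e)

theorem Knows.evals_searchKey (hk : Knows L n k a m σ) (h : Suffices L n) {l : List (ℕ × ℕ)}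
    (h11 : Evals L (varE 11) m σ (listCode n (contentBound n) l))
    (hl : ItemsLt n (contentBound n) l) (hlen : l.length ≤ itemCap n)
    {eS : RamExpr} {S : ℕ} (hS : Evals L eS m σ S) :
    Evals L (searchKeyE eS) m σ (searchKey n k l S) := by
  have h1 : 1 < 2 ^ L.b := h.lit (by norm_num)
  have h2 : 2 < 2 ^ L.b := h.lit (by norm_num)
  have hb := h.linear (c := 1) (by norm_num)
  have hsum := sum_ind_le n fun v => ∃ u < n, S.testBit u = true ∧ (v, u) ∈ l
  have hle : searchKey n k l S ≤ n + 1 := by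
    unfold searchKey
    rw [mul_comm]
    exact (mul_ind_le _ _).trans (by omega)
  refine ((Evals.sum hk.n ?_ ((sum_ind_le _ _).trans_lt hk.n.lt)).eqTest h1 hk.k).mul
    ((Evals.lit h1).add (Evals.sum hk.n ?_ (hsum.trans_lt hk.n.lt)) (by omega))
    (lt_of_le_of_lt hle (by omega))
  · intro u hu m' σ' eu hm hσ heu
    exact (hS.mono hm hσ).bit h2 heu (h.pow_lt hu.le)
  · intro v hv m' σ' ev hm hσ hev
    refine Evals.any h1 (hk.n.mono hm hσ) ?_
    intro u hu m'' σ'' eu hm' hσ' heu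
    exact (((hS.mono hm hσ).mono hm' hσ').bit h2 heu (h.pow_lt hu.le)).and
      (((hk.mono hm hσ).mono hm' hσ').evals_mem h ((h11.mono hm hσ).mono hm' hσ')
        (hev.mono hm' hσ') heu hl hlen hv (hu.trans_le (le_contentBound n)))

theorem Knows.evals_search (hk : Knows L n k a m σ) (h : Suffices L n) {l : List (ℕ × ℕ)}
    (h11 : Evals L (varE 11) m σ (listCode n (contentBound n) l))
    (hl : ItemsLt n (contentBound n) l) (hlen : l.length ≤ itemCap n) :
    Evals L searchE m σ (argmaxFrom (searchKey n k l) (2 ^ n) (2 ^ n)) := by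
  have h1 : 1 < 2 ^ L.b := h.lit (by norm_num)
  have h2 : 2 < 2 ^ L.b := h.lit (by norm_num)
  refine (Evals.fold (g := fun i => argmaxFrom (searchKey n k l) (2 ^ n) (2 ^ n - i))
    ((Evals.lit h2).pow hk.n (by norm_num) h.exp) ?_ ?_).of_eq (by rw [Nat.sub_zero])
  · rw [Nat.sub_self]
    exact Evals.lit (by positivity)
  · intro i hi m' σ' ea ei hm hσ ha he
    have hk' := hk.mono hm hσ
    have h11' := h11.mono hm hσ
    have hc := (hk'.evals_searchKey h h11' hl hlen ha).ltTest h1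
      (hk'.evals_searchKey h h11' hl hlen he)
    have hai := ha.lt
    have hei := he.lt
    have hind (P : Prop) : ind P * i < 2 ^ L.b ∧ ind (¬P) * argmaxFrom (searchKey n k l)
        (2 ^ n) (2 ^ n - (i + 1)) < 2 ^ L.b ∧ ind P * i + ind (¬P) * argmaxFrom
        (searchKey n k l) (2 ^ n) (2 ^ n - (i + 1)) < 2 ^ L.b := by
      by_cases hP : P
      · simp [ind_true hP, ind_false (not_not_intro hP), hei]
      · simp [ind_false hP, ind_true hP, hai]
    refine ((hc.mul he (hind _).1).add ((hc.not h1).mul ha (hind _).2.1) (hind _).2.2).of_eq ?_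
    have hj : 2 ^ n - i = (2 ^ n - (i + 1)) + 1 := by omega
    have hi' : 2 ^ n - (2 ^ n - (i + 1) + 1) = i := by omega
    rw [hj, argmaxFrom, hi']
    split_ifs with hP
    · rw [ind_true hP, ind_false (not_not_intro hP), one_mul, zero_mul, add_zero]
    · rw [ind_false hP, ind_true hP, one_mul, zero_mul, zero_add]

/-- The program of the fourth round. -/
def roundFour : RamProg :=
  .seq (recvP 11 (pushE 11)) (.seq (assignP 14 searchE)
    (sendP (varE 0) (bitE (varE 14) (varE 6)) (litE 0) (varE 6)))

/-- The messages sent in the fourth round. -/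
noncomputable def sentFour (n k : ℕ) (l : List (ℕ × ℕ)) : List (ℕ × ℕ) :=
  sentItems n (fun u => (argmaxFrom (searchKey n k l) (2 ^ n) (2 ^ n)).testBit u = true)
    (fun _ => 0) (fun u => u)

theorem exec_roundFour {s : MachineState} (h : Suffices L n)
    (hR : roundFour.regBound ≤ L.R) (hs : Fits L s) (hh : Holds s n k a)
    (hl : ItemsLt n (contentBound n) s.inbox) (hlen : s.inbox.length ≤ itemCap n)
    (hout : s.outbox = []) (hJ : itemBits (sentFour n k s.inbox) ≤ L.J) :
    ∃ t, RamExec L.total roundFour s t ∧ t.outbox = sentFour n k s.inbox := by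
  have h1 : 1 < 2 ^ L.b := h.lit (by norm_num)
  simp only [roundFour, RamProg.regBound, max_le_iff] at hR
  obtain ⟨t, ht, hft, hht, h11, -, hin, hou, hco⟩ := exec_recvList h (by norm_num) (by norm_num)
    hR.1 hs hh hl hlen
  have hkn : Knows L n k a 16 t.mem := knows_of_eq hht.n hht.k hht.self hft.lt
  obtain ⟨r, hr, ar⟩ := exec_assign (x := 14) (by norm_num) hR.2.1 hft
    (hkn.evals_search h ((Evals.var (by norm_num) (hft.lt 11)).of_eq h11) hl hlen)
  have r0 := (ar.mem_ne 0 (by omega) (by omega)).trans hht.n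
  obtain ⟨u, hu, hfu, hy, huo, huc⟩ := exec_sendP (L := L) hR.2.2 ar.fits h1
    (ar.io.inbox.trans hin) (ar.io.outbox.trans (hou.trans hout)) hJ
    ((Evals.var (by norm_num) (ar.fits.lt 0)).of_eq r0) (by
      intro i hi σ hσ hσlt h6
      have e14 := (Evals.var (L := L) (m := 16) (by norm_num) (hσlt 14)).of_eq
        ((hσ 14 (by omega) (by omega) (by omega) (by omega)).trans ar.mem_eq)
      have e6 := (Evals.var (L := L) (m := 16) (by norm_num) (hσlt 6)).of_eq h6
      exact ⟨e14.bit (h.lit (by norm_num)) e6 (h.pow_lt hi.le),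
        fun _ => ⟨Evals.lit (by positivity), e6⟩⟩)
  exact ⟨u, .seq ht (.seq hr hu), huo⟩

end

/-! ### Coverage: random sets and truncated neighbourhoods -/

theorem card_div_card_le_one {V : Type*} [Fintype V] (A : Finset V) :
    (A.card : ℝ) / Fintype.card V ≤ 1 :=
  div_le_one_of_le₀ (by exact_mod_cast Finset.card_le_univ A) (by positivity)

section
variable {V : Type*} [Fintype V] [DecidableEq V]

/-- The elements covered by `S`; here `N v` is the collection of the sets that contain `v`. -/
def coveredBy (N : V → Finset V) (S : Finset V) : Finset V :=
  Finset.univ.filter fun v => ∃ u ∈ S, u ∈ N v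

theorem mem_coveredBy {N : V → Finset V} {S : Finset V} {v : V} :
    v ∈ coveredBy N S ↔ ∃ u ∈ S, u ∈ N v := by simp [coveredBy]

theorem coveredBy_mono {N N' : V → Finset V} {S S' : Finset V} (hN : ∀ v, N v ⊆ N' v)
    (hS : S ⊆ S') : coveredBy N S ⊆ coveredBy N' S' := by
  intro v hv
  obtain ⟨u, hu, huv⟩ := mem_coveredBy.1 hv
  exact mem_coveredBy.2 ⟨u, hS hu, hN v huv⟩

/-- The weight left uncovered by `q` random sets has the expectation on the right hand side, hence
some choice of the `q` sets does as well. -/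
theorem exists_uncovered_le [Nonempty V] (N : V → Finset V) (q : ℕ) (w : V → ℝ)
    (hw : ∀ v, 0 ≤ w v) :
    ∃ Q : Finset V, Q.card ≤ q ∧ ∑ v ∈ (coveredBy N Q)ᶜ, w v ≤
      ∑ v, w v * (1 - (N v).card / Fintype.card V) ^ q := by
  induction q generalizing w with
  | zero => exact ⟨∅, by simp, by simp [coveredBy]⟩
  | succ q ih =>
    have hV : (0 : ℝ) < Fintype.card V := by exact_mod_cast Fintype.card_pos
    set F : V → ℝ := fun u => ∑ v, (if u ∈ N v then 0 else w v) *
      (1 - ((N v).card : ℝ) / Fintype.card V) ^ q with hF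
    have hsum : ∑ u, F u = ∑ _u : V, ∑ v, w v *
        (1 - ((N v).card : ℝ) / Fintype.card V) ^ (q + 1) := by
      rw [Finset.sum_const, Finset.card_univ, nsmul_eq_mul, Finset.mul_sum, hF,
        Finset.sum_comm]
      refine Finset.sum_congr rfl fun v _ => ?_
      rw [← Finset.sum_mul]
      have : ∑ u, (if u ∈ N v then (0 : ℝ) else w v) =
          (Fintype.card V - (N v).card : ℝ) * w v := by
        have h1 : ∀ u, (if u ∈ N v then (0 : ℝ) else w v) = w v - if u ∈ N v then w v else 0 := by
          intro u; split_ifs <;> simp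
        simp only [h1, Finset.sum_sub_distrib, Finset.sum_const, Finset.card_univ, nsmul_eq_mul,
          Finset.sum_ite_mem, Finset.univ_inter]
        ring
      rw [this, pow_succ]
      field_simp
    obtain ⟨u, -, hu⟩ := Finset.exists_le_of_sum_le Finset.univ_nonempty hsum.le
    obtain ⟨Q, hQ, hQw⟩ := ih (fun v => if u ∈ N v then 0 else w v)
      fun v => by split_ifs; exacts [le_rfl, hw v]
    refine ⟨insert u Q, (Finset.card_insert_le _ _).trans (by omega), le_trans ?_ (hQw.trans hu)⟩
    have hsub : (coveredBy N (insert u Q))ᶜ ⊆ (coveredBy N Q)ᶜ :=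
      Finset.compl_subset_compl.2 (coveredBy_mono (fun _ => subset_rfl) (Finset.subset_insert _ _))
    calc ∑ v ∈ (coveredBy N (insert u Q))ᶜ, w v
        = ∑ v ∈ (coveredBy N (insert u Q))ᶜ, (if u ∈ N v then 0 else w v) := by
          refine Finset.sum_congr rfl fun v hv => ?_
          rw [Finset.mem_compl, mem_coveredBy] at hv
          rw [if_neg fun h => hv ⟨u, Finset.mem_insert_self _ _, h⟩]
      _ ≤ _ := Finset.sum_le_sum_of_subset_of_nonneg hsub fun v _ _ => by
          split_ifs; exacts [le_rfl, hw v]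

theorem one_sub_pow_le {x : ℝ} (h0 : 0 ≤ x) (h1 : x ≤ 1) (q : ℕ) :
    (1 - x) ^ q ≤ 1 / (1 + q * x) := by
  have h2 : 1 + (q : ℝ) * x ≤ (1 + x) ^ q := one_add_mul_le_pow (by linarith) q
  rw [le_div_iff₀ (by positivity)]
  calc (1 - x) ^ q * (1 + q * x) ≤ (1 - x) ^ q * (1 + x) ^ q :=
        mul_le_mul_of_nonneg_left h2 (pow_nonneg (by linarith) _)
    _ = (1 - x ^ 2) ^ q := by rw [← mul_pow]; ring_nf
    _ ≤ 1 := pow_le_one₀ (by nlinarith) (by nlinarith)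

/-- If no element lies in many sets, then some `k` sets cover a proportional part of the total
size of all sets. -/
theorem exists_covered_ge [Nonempty V] (N : V → Finset V) {k : ℕ} (hk : k ≤ Fintype.card V)
    (hN : ∀ v, (N v).card * k ≤ 513 * Fintype.card V) :
    ∃ S : Finset V, S.card = k ∧
      k * ∑ v, (N v).card ≤ 514 * Fintype.card V * (coveredBy N S).card := by
  have hV : (0 : ℝ) < Fintype.card V := by exact_mod_cast Fintype.card_pos
  obtain ⟨Q, hQ, hQw⟩ := exists_uncovered_le N k (fun _ => 1) fun _ => zero_le_one
  obtain ⟨S, hQS, hS⟩ := Finset.exists_superset_card_eq hQ hk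
  refine ⟨S, hS, ?_⟩
  have hmono := Finset.card_le_card (coveredBy_mono (N := N) (fun _ => subset_rfl) hQS)
  have h1 : ∀ v, 1 * (1 - ((N v).card : ℝ) / Fintype.card V) ^ k ≤
      1 - k * (N v).card / (514 * Fintype.card V) := by
    intro v
    refine (one_mul _).le.trans
      ((one_sub_pow_le (by positivity) (card_div_card_le_one _) k).trans ?_)
    have h2 : ((N v).card : ℝ) * k ≤ 513 * Fintype.card V := by exact_mod_cast hN v
    set y : ℝ := k * ((N v).card / Fintype.card V) with hy
    have hy0 : 0 ≤ y := by positivity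
    have hy1 : y ≤ 513 := by
      rw [hy, mul_div_assoc', div_le_iff₀ hV]; linarith
    have h3 : (k : ℝ) * (N v).card / (514 * Fintype.card V) = y / 514 := by
      rw [hy]; field_simp
    rw [h3, div_le_iff₀ (by positivity)]
    nlinarith
  have h2 := hQw.trans (Finset.sum_le_sum fun v _ => h1 v)
  rw [Finset.sum_sub_distrib, Finset.sum_const, Finset.sum_const, Finset.card_univ,
    Finset.card_compl, nsmul_eq_mul, nsmul_eq_mul, Nat.cast_sub (Finset.card_le_univ _),
    ← Finset.sum_div, ← Finset.mul_sum, mul_one, mul_one] at h2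
  have h3 : (k : ℝ) * ∑ v, ((N v).card : ℝ) / (514 * Fintype.card V) ≤ (coveredBy N Q).card := by
    rw [← Finset.sum_div, mul_div_assoc']; linarith
  rw [← Finset.sum_div, mul_div_assoc', div_le_iff₀ (by positivity)] at h3
  have h4 : ((k * ∑ v, (N v).card : ℕ) : ℝ) ≤
      ((514 * Fintype.card V * (coveredBy N Q).card : ℕ) : ℝ) := by
    push_cast; linarith
  exact (Nat.cast_le.1 h4).trans (Nat.mul_le_mul_left _ hmono)

/-- Some element of `T` covers privately at most the average. -/
theorem exists_covered_erase (N : V → Finset V) {T : Finset V} {t : ℕ} (hT : T.card = t + 1) :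
    ∃ u ∈ T, t * (coveredBy N T).card ≤ (t + 1) * (coveredBy N (T.erase u)).card := by
  have hne : T.Nonempty := Finset.card_pos.1 (by omega)
  -- the sets of the elements covered by `u` only are disjoint
  have hdisj : ∑ u ∈ T, (coveredBy N T \ coveredBy N (T.erase u)).card ≤ (coveredBy N T).card := by
    rw [← Finset.card_biUnion]
    · exact Finset.card_le_card (Finset.biUnion_subset.2 fun u _ => Finset.sdiff_subset)
    · intro u hu u' hu' huu
      rw [Function.onFun, Finset.disjoint_left]
      intro v hv hv'
      rw [Finset.mem_sdiff] at hv hv'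
      obtain ⟨x, hx, hxv⟩ := mem_coveredBy.1 hv.1
      by_cases h : x = u
      · exact hv'.2 (mem_coveredBy.2 ⟨x, Finset.mem_erase.2 ⟨by rw [h]; exact huu, hx⟩, hxv⟩)
      · exact hv.2 (mem_coveredBy.2 ⟨x, Finset.mem_erase.2 ⟨h, hx⟩, hxv⟩)
  by_contra! h
  have h1 : ∀ u ∈ T, (t + 1) * (coveredBy N T \ coveredBy N (T.erase u)).card >
      (coveredBy N T).card := by
    intro u hu
    have h2 := h u hu
    have hsub := coveredBy_mono (N := N) (fun _ => subset_rfl) (Finset.erase_subset u T)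
    have h3 := Finset.card_sdiff_add_card_eq_card hsub
    nlinarith
  have h4 := Finset.sum_lt_sum_of_nonempty hne h1
  rw [← Finset.mul_sum, Finset.sum_const, hT, smul_eq_mul] at h4
  exact absurd hdisj (not_le.2 (lt_of_mul_lt_mul_left h4 (Nat.zero_le _)))

theorem exists_subset_covered (N : V → Finset V) (T : Finset V) {q : ℕ} (hq : q ≤ T.card) :
    ∃ T₁ ⊆ T, T₁.card = T.card - q ∧
      (T.card - q) * (coveredBy N T).card ≤ T.card * (coveredBy N T₁).card := by
  induction q with
  | zero => exact ⟨T, subset_rfl, by simp, by simp⟩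
  | succ q ih =>
    obtain ⟨T₁, hT₁, hc, hle⟩ := ih (by omega)
    obtain ⟨u, hu, hle'⟩ := exists_covered_erase N (T := T₁) (t := T.card - (q + 1)) (by omega)
    refine ⟨T₁.erase u, (Finset.erase_subset _ _).trans hT₁, ?_, ?_⟩
    · rw [Finset.card_erase_of_mem hu]; omega
    · obtain ⟨t, ht⟩ : ∃ t, T.card = t + (q + 1) := ⟨T.card - (q + 1), by omega⟩
      have e1 : T.card - q = t + 1 := by omega
      have e2 : T.card - (q + 1) = t := by omega
      rw [e1] at hle
      rw [e2] at hle' ⊢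
      have h5 : (t + 1) * (t * (coveredBy N T).card) ≤
          (t + 1) * (T.card * (coveredBy N (T₁.erase u)).card) := by
        calc (t + 1) * (t * (coveredBy N T).card) = t * ((t + 1) * (coveredBy N T).card) := by ring
          _ ≤ t * (T.card * (coveredBy N T₁).card) := Nat.mul_le_mul_left _ hle
          _ = T.card * (t * (coveredBy N T₁).card) := by ring
          _ ≤ T.card * ((t + 1) * (coveredBy N (T₁.erase u)).card) := Nat.mul_le_mul_left _ hle'
          _ = _ := by ring
      exact Nat.le_of_mul_le_mul_left h5 (by omega)

/-- Truncation at `D ≥ 512 n / k` loses at most a sixteenth of the optimum: keep `k - k / 16` sets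
of an optimal solution, which still cover most of the elements that are not truncated, and add
`k / 16` sets, which can be chosen so as to cover most of the truncated elements. -/
theorem exists_covered_truncated [Nonempty V] {N N' : V → Finset V} {k D : ℕ}
    (hN : ∀ v, N' v ⊆ N v) (hcard : ∀ v, (N' v).card = min (N v).card D)
    (hD : 512 * Fintype.card V ≤ D * k) (hk : k ≤ Fintype.card V) {T : Finset V}
    (hT : T.card = k) :
    ∃ S : Finset V, S.card = k ∧ 15 * (coveredBy N T).card ≤ 16 * (coveredBy N' S).card := by
  have hV : (0 : ℝ) < Fintype.card V := by exact_mod_cast Fintype.card_pos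
  have hVn : 0 < Fintype.card V := Fintype.card_pos
  have hlight : ∀ v, (N v).card ≤ D → N' v = N v := fun v hv =>
    Finset.eq_of_subset_of_card_le (hN v) (by rw [hcard, min_eq_left hv])
  rcases le_or_gt k 512 with hk512 | hk512
  · refine ⟨T, hT, ?_⟩
    have hDV : Fintype.card V ≤ D := by
      have : 512 * Fintype.card V ≤ 512 * D := hD.trans (by nlinarith)
      omega
    have : N' = N := funext fun v => hlight v ((Finset.card_le_univ _).trans hDV)
    rw [this]; omega
  set q := k / 16 with hq
  obtain ⟨T₁, hT₁, hcT, hle⟩ := exists_subset_covered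
    (fun v => if (N v).card ≤ D then N v else ∅) T (q := q) (by omega)
  obtain ⟨Q, hQ, hQw⟩ := exists_uncovered_le N' q (fun v => if (N v).card ≤ D then 0 else 1)
    fun v => by split_ifs <;> norm_num
  obtain ⟨S, hTS, hS⟩ := Finset.exists_superset_card_eq (s := T₁ ∪ Q) (n := k)
    ((Finset.card_union_le _ _).trans (by omega)) hk
  refine ⟨S, hS, ?_⟩
  set H := Finset.univ.filter fun v => ¬(N v).card ≤ D with hH
  set l := coveredBy (fun v => if (N v).card ≤ D then N v else ∅) T with hl
  set l₁ := coveredBy (fun v => if (N v).card ≤ D then N v else ∅) T₁ with hl₁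
  -- the sums over the truncated elements, counted
  have hQH : ((H \ coveredBy N' Q).card : ℝ) ≤ H.card / 16 := by
    have e1 : ∑ v ∈ (coveredBy N' Q)ᶜ, (if (N v).card ≤ D then (0 : ℝ) else 1) =
        (H \ coveredBy N' Q).card := by
      rw [Finset.sum_ite, Finset.sum_const_zero, zero_add, Finset.sum_const, nsmul_one]
      congr 2
      ext v; simp [hH, and_comm]
    rw [e1] at hQw
    refine hQw.trans ?_
    have e2 : (H.card : ℝ) / 16 = ∑ v, if (N v).card ≤ D then (0 : ℝ) else 1 / 16 := by
      rw [Finset.sum_ite, Finset.sum_const_zero, zero_add, Finset.sum_const, nsmul_eq_mul]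
      rw [hH]; ring
    rw [e2]
    refine Finset.sum_le_sum fun v _ => ?_
    split_ifs with hv
    · simp
    · rw [one_mul]
      refine (one_sub_pow_le (by positivity) (card_div_card_le_one _) q).trans ?_
      refine one_div_le_one_div_of_le (by norm_num) ?_
      have e3 : (N' v).card = D := by rw [hcard, min_eq_right (by omega)]
      rw [e3]
      have e4 : 15 * Fintype.card V ≤ q * D := by
        have h16 : k ≤ 32 * q := by omega
        have : 512 * Fintype.card V ≤ 32 * (q * D) := hD.trans (by nlinarith)
        omega
      have e5 : (15 : ℝ) * Fintype.card V ≤ q * D := by exact_mod_cast e4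
      have e6 : (15 : ℝ) ≤ q * (D / Fintype.card V) := by
        rw [mul_div_assoc', le_div_iff₀ hV]; exact e5
      linarith
  have hHn : 15 * H.card ≤ 16 * (H ∩ coveredBy N' Q).card := by
    have h1 := Finset.card_sdiff_add_card_inter H (coveredBy N' Q)
    have h2 : 16 * (H \ coveredBy N' Q).card ≤ H.card := by
      have : (16 : ℝ) * (H \ coveredBy N' Q).card ≤ H.card := by linarith
      exact_mod_cast this
    omega
  have hLn : 15 * l.card ≤ 16 * l₁.card := by
    rw [hT] at hle
    have h16 : 15 * k ≤ 16 * (k - q) := by omega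
    have : k * (15 * l.card) ≤ k * (16 * l₁.card) := by nlinarith
    exact Nat.le_of_mul_le_mul_left this (by omega)
  have h1 : coveredBy N T ⊆ l ∪ H := by
    intro v hv
    obtain ⟨u, hu, huv⟩ := mem_coveredBy.1 hv
    rw [Finset.mem_union]
    by_cases h : (N v).card ≤ D
    · exact .inl (mem_coveredBy.2 ⟨u, hu, by simpa [h] using huv⟩)
    · exact .inr (by simpa [hH] using h)
  have h2 : l₁ ∪ (H ∩ coveredBy N' Q) ⊆ coveredBy N' S := by
    refine Finset.union_subset ?_ (Finset.inter_subset_right.trans (coveredBy_mono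
      (fun _ => subset_rfl) (Finset.subset_union_right.trans hTS)))
    refine coveredBy_mono (fun v => ?_) (Finset.subset_union_left.trans hTS)
    split_ifs with h
    · rw [hlight v h]
    · exact Finset.empty_subset _
  have h3 : Disjoint l₁ (H ∩ coveredBy N' Q) := by
    rw [Finset.disjoint_left]
    intro v hv hv'
    obtain ⟨u, hu, huv⟩ := mem_coveredBy.1 hv
    have : ¬(N v).card ≤ D := by simpa [hH] using (Finset.mem_inter.1 hv').1
    simp [this] at huv
  have h4 := Finset.card_le_card h1
  have h5 := Finset.card_le_card h2
  rw [Finset.card_union_of_disjoint h3] at h5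
  have h6 := Finset.card_union_le l H
  omega

end

theorem sum_ind_lowest (P : ℕ → Prop) (D n : ℕ) :
    ∑ u ∈ Finset.range n, ind (Lowest P D u) = min (∑ u ∈ Finset.range n, ind (P u)) D := by
  induction n with
  | zero => simp
  | succ n ih =>
    rw [Finset.sum_range_succ, Finset.sum_range_succ, ih]
    by_cases h1 : P n
    · rw [ind_true h1]
      by_cases h2 : ∑ w ∈ Finset.range n, ind (P w) < D
      · rw [ind_true ⟨h1, h2⟩]; omega
      · rw [ind_false fun h => h2 h.2]; omega
    · rw [ind_false h1, ind_false fun h => h1 h.1]; omega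

/-! ### Concentration of the sample -/

theorem sum_indicator_mul {Ω V : Type*} [Fintype V] [DecidableEq V] (E : V → Set Ω) (ω : Ω)
    (A X : Finset V) (hX : ∀ v, v ∈ X ↔ ω ∈ E v) :
    ∑ v, (if v ∈ A then (1 : ℝ) else 0) * (E v).indicator 1 ω = (A ∩ X).card := by
  have : ∀ v, (if v ∈ A then (1 : ℝ) else 0) * (E v).indicator 1 ω =
      if v ∈ A ∩ X then 1 else 0 := by
    intro v
    by_cases h1 : v ∈ A <;> by_cases h2 : ω ∈ E v <;> simp [h1, h2, hX]
  rw [Finset.sum_congr rfl fun v _ => this v, Finset.sum_boole, Finset.filter_mem_eq_inter,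
    Finset.univ_inter]

section
open MeasureTheory ProbabilityTheory

variable {Ω V : Type*} [MeasurableSpace Ω] {P : Measure Ω} [IsProbabilityMeasure P] [Fintype V]

theorem exp_mul_le_of_mem_unit {a : ℝ} (ha0 : 0 ≤ a) (ha1 : a ≤ 1) (t : ℝ) :
    Real.exp (t * a) ≤ 1 + a * (Real.exp t - 1) := by
  have := convexOn_exp.2 (Set.mem_univ 0) (Set.mem_univ t) (by linarith : 0 ≤ 1 - a) ha0
    (by ring)
  simp only [smul_eq_mul, mul_zero, zero_add, Real.exp_zero, mul_one] at this
  rw [mul_comm t a]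
  linarith

/-- The estimate behind both Chernoff bounds: by convexity, an independent event of probability `p`
with weight `a v ≤ 1` contributes at most `exp (p * (exp t - 1) * a v)`. -/
theorem mgf_weighted_sum_le {E : V → Set Ω} (hE : ∀ v, MeasurableSet (E v))
    (hind : iIndepFun (fun v => (E v).indicator (1 : Ω → ℝ)) P) {p : ℝ}
    (hp : ∀ v, P.real (E v) = p) {a : V → ℝ} (ha0 : ∀ v, 0 ≤ a v) (ha1 : ∀ v, a v ≤ 1) (t : ℝ) :
    mgf (∑ v, fun ω => a v * (E v).indicator 1 ω) P t ≤
      Real.exp (p * (Real.exp t - 1) * ∑ v, a v) := by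
  have hmeas : ∀ v, Measurable ((E v).indicator (1 : Ω → ℝ)) := fun v =>
    measurable_one.indicator (hE v)
  have hind' : iIndepFun (fun v ω => a v * (E v).indicator (1 : Ω → ℝ) ω) P :=
    hind.comp (fun v x => a v * x) fun v => measurable_const_mul (a v)
  rw [hind'.mgf_sum (fun v => (hmeas v).const_mul _), Finset.mul_sum, Real.exp_sum]
  refine Finset.prod_le_prod (fun v _ => mgf_nonneg) fun v _ => ?_
  have h1 : (fun ω => Real.exp (t * (a v * (E v).indicator 1 ω))) =
      fun ω => 1 + (Real.exp (t * a v) - 1) * (E v).indicator 1 ω := by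
    funext ω
    by_cases h : ω ∈ E v <;> simp [h]
  have hint : Integrable ((E v).indicator (1 : Ω → ℝ)) P :=
    (integrable_const (1 : ℝ)).indicator (hE v)
  rw [mgf, h1, integral_add (integrable_const _) (hint.const_mul _), integral_const_mul,
    integral_indicator_one (hE v), hp]
  have hp0 : 0 ≤ p := by rw [← hp v]; exact measureReal_nonneg
  have h2 := mul_le_mul_of_nonneg_right
    (sub_le_sub_right (exp_mul_le_of_mem_unit (ha0 v) (ha1 v) t) 1) hp0
  have h3 := Real.add_one_le_exp (p * (Real.exp t - 1) * a v)
  simp only [integral_const, probReal_univ, smul_eq_mul, mul_one]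
  linarith

theorem integrable_exp_weighted_sum {E : V → Set Ω} (hE : ∀ v, MeasurableSet (E v)) (a : V → ℝ)
    (t : ℝ) :
    Integrable (fun ω => Real.exp (t * (∑ v, fun ω => a v * (E v).indicator 1 ω) ω)) P := by
  have hmeas : ∀ v, Measurable ((E v).indicator (1 : Ω → ℝ)) := fun v =>
    measurable_one.indicator (hE v)
  refine Integrable.of_bound (C := Real.exp (∑ v, |t * a v|)) ?_ (ae_of_all _ fun ω => ?_)
  · refine Measurable.aestronglyMeasurable (Real.measurable_exp.comp (Measurable.const_mul ?_ t))
    rw [Finset.sum_fn]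
    exact Finset.measurable_sum _ fun v _ => (hmeas v).const_mul _
  · rw [Real.norm_eq_abs, Real.abs_exp, Finset.sum_apply, Finset.mul_sum]
    refine Real.exp_le_exp.2 (Finset.sum_le_sum fun v _ => ?_)
    by_cases h : ω ∈ E v
    · simpa [h] using le_abs_self (t * a v)
    · simp only [h, not_false_eq_true, Set.indicator_of_notMem, mul_zero]
      positivity

theorem upper_tail_le {E : V → Set Ω} (hE : ∀ v, MeasurableSet (E v))
    (hind : iIndepFun (fun v => (E v).indicator (1 : Ω → ℝ)) P) {p : ℝ}
    (hp : ∀ v, P.real (E v) = p) {a : V → ℝ} (ha0 : ∀ v, 0 ≤ a v) (ha1 : ∀ v, a v ≤ 1) {t : ℝ}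
    (ht : 0 ≤ t) (x : ℝ) :
    P.real {ω | x ≤ ∑ v, a v * (E v).indicator 1 ω} ≤
      Real.exp (p * (Real.exp t - 1) * ∑ v, a v - t * x) := by
  have h := measure_ge_le_exp_mul_mgf x ht (integrable_exp_weighted_sum (P := P) hE a t)
  simp only [Finset.sum_apply] at h
  refine h.trans ?_
  rw [sub_eq_neg_add, Real.exp_add, neg_mul]
  exact mul_le_mul_of_nonneg_left (mgf_weighted_sum_le hE hind hp ha0 ha1 t) (Real.exp_pos _).le

theorem lower_tail_le {E : V → Set Ω} (hE : ∀ v, MeasurableSet (E v))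
    (hind : iIndepFun (fun v => (E v).indicator (1 : Ω → ℝ)) P) {p : ℝ}
    (hp : ∀ v, P.real (E v) = p) {a : V → ℝ} (ha0 : ∀ v, 0 ≤ a v) (ha1 : ∀ v, a v ≤ 1) {t : ℝ}
    (ht : t ≤ 0) (x : ℝ) :
    P.real {ω | ∑ v, a v * (E v).indicator 1 ω ≤ x} ≤
      Real.exp (p * (Real.exp t - 1) * ∑ v, a v - t * x) := by
  have h := measure_le_le_exp_mul_mgf x ht (integrable_exp_weighted_sum (P := P) hE a t)
  simp only [Finset.sum_apply] at h
  refine h.trans ?_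
  rw [sub_eq_neg_add, Real.exp_add, neg_mul]
  exact mul_le_mul_of_nonneg_left (mgf_weighted_sum_le hE hind hp ha0 ha1 t) (Real.exp_pos _).le

/-- The sample `X` is representative: it is small, and every family of `k` sets that covers much
less than the `M` elements covered by `S₀` also covers less than `S₀` within the sample. -/
structure Representative [DecidableEq V] (N : V → Finset V) (k M cap : ℕ) (S₀ X : Finset V) :
    Prop where
  small : ∑ v ∈ X, (N v).card ≤ cap
  separates : ∀ S : Finset V, S.card = k → 16 * (coveredBy N S).card < 11 * M →
    (coveredBy N S ∩ X).card < (coveredBy N S₀ ∩ X).card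

theorem exp_neg_bitLength_le {n : ℕ} (hn : 1 ≤ n) : Real.exp (-(bitLength n : ℝ)) ≤ 1 / n := by
  have h1 : (n : ℝ) ≤ Real.exp (bitLength n) := by
    have h2 : (n : ℝ) ≤ 2 ^ bitLength n := by exact_mod_cast (lt_two_pow_bitLength n).le
    refine h2.trans ?_
    rw [← Real.exp_one_pow]
    exact pow_le_pow_left₀ (by norm_num) (by linarith [Real.add_one_le_exp 1]) _
  rw [Real.exp_neg, ← one_div]
  exact one_div_le_one_div_of_le (by exact_mod_cast hn) h1

theorem exp_one_sub_one_le : Real.exp 1 - 1 ≤ 2 := by linarith [Real.exp_one_lt_d9]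

/-- Together with `exp_eighth_le`: with `t = ∓ 1 / 8`, the threshold `27 / 32` lies far enough from
the means `1` and `11 / 16` for the Chernoff bounds, with a margin of `1 / 200` in the exponents. -/
theorem exp_neg_eighth_le : Real.exp (-(1 / 8)) ≤ 1 - 27 / 256 - 1 / 200 := by
  have h1 := Real.quadratic_le_exp_of_nonneg (show (0 : ℝ) ≤ 1 / 8 by norm_num)
  rw [Real.exp_neg]
  exact (inv_anti₀ (by norm_num) h1).trans (by norm_num)

theorem exp_eighth_le : 11 / 16 * (Real.exp (1 / 8) - 1) ≤ 27 / 256 - 1 / 200 := by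
  have h1 := Real.add_one_le_exp (-(1 / 8) : ℝ)
  rw [Real.exp_neg] at h1
  have h2 : Real.exp (1 / 8) ≤ 8 / 7 := by
    rw [← inv_inv (Real.exp (1 / 8))]
    exact (inv_anti₀ (by norm_num) h1).trans (by norm_num)
  linarith

set_option maxHeartbeats 400000 in
/-- A sample that contains each element independently with probability `p` is representative with
high probability, if its expected size, weighted with degrees, is of order `n log n`. The thresholds
are `27/32` of the expectation `p M` for `S₀`, and the families to be separated have expectation
at most `11/16` of it; there are at most `n ^ k` of them. -/
theorem representative_whp [DecidableEq V] [Nonempty V] {E : V → Set Ω}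
    (hE : ∀ v, MeasurableSet (E v))
    (hind : iIndepFun (fun v => (E v).indicator (1 : Ω → ℝ)) P) {p : ℝ}
    (hp : ∀ v, P.real (E v) = p) {N : V → Finset V} {n k M : ℕ} (hn : Fintype.card V = n)
    (hk : 1 ≤ k) (hkn : k ≤ n) (hN : ∀ v, (N v).card ≤ degreeCap n k) {S₀ : Finset V}
    (hS₀ : (coveredBy N S₀).card = M)
    (hM : k * ∑ v, (N v).card ≤ 514 * n * M)
    (hp1 : p * ∑ v, ((N v).card : ℝ) ≤ sampleSize n)
    (hp2 : (sampleSize n : ℝ) ≤ 2 * (p * ∑ v, ((N v).card : ℝ)))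
    (X : Ω → Finset V) (hX : ∀ ω v, v ∈ X ω ↔ ω ∈ E v) :
    P.real {ω | ¬Representative N k M (itemCap n) S₀ (X ω)} ≤ 2 / n := by
  have hnpos : 0 < n := hn ▸ Fintype.card_pos
  have hn0 : (0 : ℝ) < n := by exact_mod_cast hnpos
  have hp0 : 0 ≤ p := by
    obtain ⟨v⟩ := ‹Nonempty V›
    rw [← hp v]; exact measureReal_nonneg
  set ℓ : ℝ := ((bitLength n : ℕ) : ℝ) with hℓ
  have hℓ1 : 1 ≤ ℓ := by rw [hℓ]; exact_mod_cast bitLength_pos n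
  have hk1 : (1 : ℝ) ≤ k := by exact_mod_cast hk
  have hkℓ : ℓ ≤ k * ℓ := le_mul_of_one_le_left (by linarith) hk1
  have hsz : (sampleSize n : ℝ) = 2 ^ 20 * (n * ℓ) := by
    rw [hℓ, sampleSize]; push_cast; norm_num
  have hcap : (itemCap n : ℝ) = 2 ^ 22 * (n * ℓ) := by
    rw [hℓ, itemCap]; push_cast; norm_num
  set T : ℝ := ∑ v, ((N v).card : ℝ) with hT
  have hT0 : 0 ≤ T := Finset.sum_nonneg fun v _ => Nat.cast_nonneg _
  have hM' : (k : ℝ) * T ≤ 514 * n * M := by rw [hT]; exact_mod_cast hM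
  -- the expectation `p M` is of order `k log n`
  have hpM : 1000 * (k * ℓ) ≤ p * M := by
    have h1 : n * (2 ^ 19 * (k * ℓ)) ≤ n * (514 * (p * M)) := by
      calc n * (2 ^ 19 * (k * ℓ)) = k * (2 ^ 20 * (n * ℓ)) / 2 := by ring
        _ ≤ k * (2 * (p * T)) / 2 := by
          rw [← hsz]; gcongr
        _ = p * (k * T) := by ring
        _ ≤ p * (514 * n * M) := mul_le_mul_of_nonneg_left hM' hp0
        _ = _ := by ring
    have h2 := le_of_mul_le_mul_left h1 hn0
    linarith
  set w : Finset V → V → ℝ := fun A v => if v ∈ A then 1 else 0 with hw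
  have hw0 : ∀ A v, 0 ≤ w A v := fun A v => by simp only [hw]; split_ifs <;> norm_num
  have hw1 : ∀ A v, w A v ≤ 1 := fun A v => by simp only [hw]; split_ifs <;> norm_num
  have hwsum : ∀ A, ∑ v, w A v = A.card := fun A => by simp [hw]
  set D : ℝ := ((degreeCap n k : ℕ) : ℝ) with hD
  have hD0 : 0 < D := by simp only [hD, degreeCap]; positivity
  have hDk : D * k ≤ 513 * n := by
    have h1 := Nat.div_mul_le_self (512 * n) k
    have : degreeCap n k * k ≤ 513 * n := by unfold degreeCap; nlinarith
    rw [hD]; exact_mod_cast this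
  set bigS : Finset (Finset V) := (Finset.powersetCard k Finset.univ).filter
    fun S => 16 * (coveredBy N S).card < 11 * M with hbigS
  set x : ℝ := 27 / 32 * (p * M) with hx
  set EA : Set Ω := {ω | ∑ v, w (coveredBy N S₀) v * (E v).indicator 1 ω ≤ x} with hEA
  set EB : Finset V → Set Ω := fun S =>
    {ω | x ≤ ∑ v, w (coveredBy N S) v * (E v).indicator 1 ω} with hEB
  set EC : Set Ω := {ω | itemCap n / D ≤ ∑ v, (N v).card / D * (E v).indicator 1 ω} with hEC
  have hsub : {ω | ¬Representative N k M (itemCap n) S₀ (X ω)} ⊆ EA ∪ (⋃ S ∈ bigS, EB S) ∪ EC := by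
    intro ω hω
    by_contra hcon
    simp only [Set.mem_union, not_or, Set.mem_iUnion, not_exists] at hcon
    obtain ⟨⟨hA, hB⟩, hC⟩ := hcon
    refine hω ⟨?_, fun S hS hlt => ?_⟩
    · simp only [hEC, Set.mem_ofPred_eq, not_le] at hC
      have h1 : ∑ v, ((N v).card : ℝ) / D * (E v).indicator 1 ω =
          (∑ v ∈ X ω, (N v).card : ℕ) / D := by
        rw [Nat.cast_sum, Finset.sum_div, ← Finset.sum_filter_add_sum_filter_not Finset.univ
          (fun v => v ∈ X ω) (fun v => ((N v).card : ℝ) / D * (E v).indicator 1 ω),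
          Finset.sum_eq_zero (s := Finset.univ.filter fun v => ¬v ∈ X ω), add_zero]
        · rw [Finset.filter_mem_eq_inter, Finset.univ_inter]
          refine Finset.sum_congr rfl fun v hv => ?_
          rw [Set.indicator_of_mem ((hX ω v).1 hv), Pi.one_apply, mul_one]
        · intro v hv
          rw [Set.indicator_of_notMem (fun h => (Finset.mem_filter.1 hv).2 ((hX ω v).2 h)),
            mul_zero]
      rw [h1] at hC
      exact_mod_cast ((div_lt_div_iff_of_pos_right hD0).1 hC).le
    · have hSm : S ∈ bigS := by simp [hbigS, hS, hlt]
      have hB := hB S hSm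
      simp only [hEA, hEB, hw, Set.mem_ofPred_eq, not_le,
        sum_indicator_mul E ω _ (X ω) (hX ω)] at hA hB
      exact_mod_cast hB.trans hA
  have he1 := exp_neg_eighth_le
  have he2 := exp_eighth_le
  have hpM0 : 0 ≤ p * M := by positivity
  have hA : P.real EA ≤ Real.exp (-(4 * ℓ)) := by
    refine (lower_tail_le hE hind hp (hw0 _) (hw1 _) (t := -(1 / 8)) (by norm_num) x).trans
      (Real.exp_le_exp.2 ?_)
    rw [hwsum, hS₀]
    nlinarith
  have hcardS : (bigS.card : ℝ) ≤ Real.exp (k * ℓ) := by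
    have h1 : bigS.card ≤ n ^ k := by
      refine (Finset.card_filter_le _ _).trans ?_
      rw [Finset.card_powersetCard, Finset.card_univ, hn]
      exact Nat.choose_le_pow n k
    have h2 : (n : ℝ) ≤ Real.exp ℓ := by
      have := exp_neg_bitLength_le (n := n) hnpos
      rw [Real.exp_neg, ← one_div] at this
      exact (one_div_le_one_div (Real.exp_pos _) hn0).1 this
    calc (bigS.card : ℝ) ≤ (n : ℝ) ^ k := by exact_mod_cast h1
      _ ≤ (Real.exp ℓ) ^ k := pow_le_pow_left₀ hn0.le h2 k
      _ = Real.exp (k * ℓ) := by rw [← Real.exp_nat_mul]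
  have hB : P.real (⋃ S ∈ bigS, EB S) ≤ Real.exp (-(4 * ℓ)) := by
    refine (measureReal_biUnion_finset_le _ _).trans ?_
    refine (Finset.sum_le_card_nsmul _ _ (Real.exp (-(5 * (k * ℓ)))) fun S hS => ?_).trans ?_
    · refine (upper_tail_le hE hind hp (hw0 _) (hw1 _) (t := 1 / 8) (by norm_num) x).trans
        (Real.exp_le_exp.2 ?_)
      rw [hwsum]
      have h1 : (16 : ℝ) * (coveredBy N S).card ≤ 11 * M := by
        exact_mod_cast (Finset.mem_filter.1 hS).2.le
      have h2 : p * (Real.exp (1 / 8) - 1) * (coveredBy N S).card ≤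
          p * (Real.exp (1 / 8) - 1) * (11 / 16 * M) :=
        mul_le_mul_of_nonneg_left (by linarith)
          (mul_nonneg hp0 (by linarith [Real.add_one_le_exp (1 / 8 : ℝ)]))
      nlinarith
    · rw [nsmul_eq_mul]
      refine (mul_le_mul_of_nonneg_right hcardS (Real.exp_pos _).le).trans ?_
      rw [← Real.exp_add]
      exact Real.exp_le_exp.2 (by linarith)
  have hC : P.real EC ≤ Real.exp (-(4 * ℓ)) := by
    have hN1 : ∀ v, ((N v).card : ℝ) / D ≤ 1 := fun v => by
      rw [div_le_one hD0, hD]; exact_mod_cast hN v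
    refine (upper_tail_le hE hind hp (fun v => by positivity) hN1 (t := 1) (by norm_num) _).trans
      (Real.exp_le_exp.2 ?_)
    have h1 : p * (Real.exp 1 - 1) * ∑ v, ((N v).card : ℝ) / D ≤ 2 * sampleSize n / D := by
      rw [← Finset.sum_div, mul_div_assoc']
      refine div_le_div_of_nonneg_right ?_ hD0.le
      calc p * (Real.exp 1 - 1) * T = (Real.exp 1 - 1) * (p * T) := by ring
        _ ≤ 2 * (p * T) := mul_le_mul_of_nonneg_right exp_one_sub_one_le (mul_nonneg hp0 hT0)
        _ ≤ 2 * sampleSize n := mul_le_mul_of_nonneg_left hp1 zero_le_two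
    have h2 : 4 * ℓ ≤ 2 * sampleSize n / D := by
      rw [le_div_iff₀ hD0, hsz]
      have h3 : D ≤ 513 * n := (le_mul_of_one_le_right hD0.le hk1).trans hDk
      calc 4 * ℓ * D ≤ 4 * ℓ * (513 * n) := mul_le_mul_of_nonneg_left h3 (by positivity)
        _ = 2052 * (n * ℓ) := by ring
        _ ≤ 2 ^ 21 * (n * ℓ) := mul_le_mul_of_nonneg_right (by norm_num) (by positivity)
        _ = 2 * (2 ^ 20 * (n * ℓ)) := by ring
    have h4 : (1 : ℝ) * (itemCap n / D) = 2 * (2 * sampleSize n / D) := by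
      rw [hcap, hsz]; ring
    rw [h4]
    linarith
  have h3 : 3 * Real.exp (-(4 * ℓ)) ≤ 2 * Real.exp (-ℓ) := by
    have h4 : Real.exp (-(4 * ℓ)) = Real.exp (-ℓ) * Real.exp (-(3 * ℓ)) := by
      rw [← Real.exp_add]; ring_nf
    have h5 : Real.exp (-(3 * ℓ)) ≤ 1 / 4 := by
      rw [Real.exp_neg, ← one_div]
      exact one_div_le_one_div_of_le (by norm_num) (by linarith [Real.add_one_le_exp (3 * ℓ)])
    rw [h4]
    nlinarith [Real.exp_pos (-ℓ)]
  calc P.real {ω | ¬Representative N k M (itemCap n) S₀ (X ω)}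
      ≤ P.real (EA ∪ (⋃ S ∈ bigS, EB S) ∪ EC) := measureReal_mono hsub
    _ ≤ P.real EA + P.real (⋃ S ∈ bigS, EB S) + P.real EC :=
        (measureReal_union_le _ _).trans (add_le_add_left (measureReal_union_le _ _) _)
    _ ≤ 2 * Real.exp (-ℓ) := by linarith
    _ ≤ 2 * (1 / n) := mul_le_mul_of_nonneg_left (exp_neg_bitLength_le hnpos) (by norm_num)
    _ = 2 / n := by ring

/-! ### Sampling by coin flips -/

/-- The event that a machine has level at least `j`: the last `j` of its first `n` coins are
ones. -/
def levelEvent (n j : ℕ) : Set (ℕ → Bool) := {c | j ≤ trailingOnes c n}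

theorem levelEvent_eq {n j : ℕ} (hj : j ≤ n) :
    levelEvent n j = Set.pi (Finset.Ico (n - j) n) fun _ => {true} := by
  ext c
  simp [levelEvent, le_trailingOnes_iff c hj, Set.mem_pi]

/-- The coins of one machine. -/
noncomputable abbrev bitMeasure : Measure Bool := (PMF.uniformOfFintype Bool).toMeasure

theorem bitMeasure_true : bitMeasure.real {true} = 1 / 2 := by
  simp [bitMeasure, Measure.real]

theorem measurableSet_levelEvent {n j : ℕ} (hj : j ≤ n) : MeasurableSet (levelEvent n j) := by
  rw [levelEvent_eq hj]
  exact MeasurableSet.pi (Finset.countable_toSet _) fun _ _ => measurableSet_singleton _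

theorem prob_levelEvent {n j : ℕ} (hj : j ≤ n) :
    (Measure.infinitePi fun _ : ℕ => bitMeasure).real (levelEvent n j) = (1 / 2) ^ j := by
  rw [levelEvent_eq hj, Measure.real, Measure.infinitePi_pi _ fun _ _ => measurableSet_singleton _,
    ENNReal.toReal_prod]
  have : ∀ i : ℕ, (bitMeasure {true}).toReal = 1 / 2 := fun _ => bitMeasure_true
  rw [Finset.prod_congr rfl fun i _ => this i, Finset.prod_const, Nat.card_Ico]
  congr 1
  omega

theorem sampleLevel_spec {n T : ℕ} (hT : T ≤ n * n) :
    sampleLevel n T ≤ n ∧ T ≤ sampleSize n * 2 ^ sampleLevel n T ∧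
      ∀ i < sampleLevel n T, sampleSize n * 2 ^ i < T := by
  have key : ∀ m, (∀ i < ∑ i ∈ Finset.range m, ind (sampleSize n * 2 ^ i < T),
      sampleSize n * 2 ^ i < T) ∧ ((∑ i ∈ Finset.range m, ind (sampleSize n * 2 ^ i < T) = m) ∨
      T ≤ sampleSize n * 2 ^ (∑ i ∈ Finset.range m, ind (sampleSize n * 2 ^ i < T))) := by
    intro m
    induction m with
    | zero => simp
    | succ m ih =>
      rw [Finset.sum_range_succ]
      by_cases h : sampleSize n * 2 ^ m < T
      · have hlt : ∀ i ≤ m, sampleSize n * 2 ^ i < T := fun i hi =>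
          lt_of_le_of_lt (Nat.mul_le_mul_left _ (Nat.pow_le_pow_right (by norm_num) hi)) h
        have hle := sum_ind_le m fun i => sampleSize n * 2 ^ i < T
        rw [ind_true h]
        refine ⟨fun i hi => hlt i (by omega), .inl ?_⟩
        rcases ih.2 with h1 | h1
        · omega
        · exact absurd (hlt _ hle) (not_lt.2 h1)
      · rw [ind_false h, add_zero]
        refine ⟨ih.1, .inr ?_⟩
        rcases ih.2 with h1 | h1
        · rw [h1]; exact not_lt.1 h
        · exact h1
  refine ⟨sum_ind_le _ _, ?_, (key n).1⟩
  rcases (key n).2 with h | h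
  · unfold sampleLevel
    rw [h]
    have h1 : n ≤ sampleSize n := by
      unfold sampleSize
      have := Nat.le_mul_of_pos_right n (bitLength_pos n)
      omega
    exact hT.trans (Nat.mul_le_mul h1 Nat.lt_two_pow_self.le)
  · exact h

/-- For the level computed by the algorithm, the machines of at least this level form a
representative sample with high probability. -/
theorem representative_level_whp {n k M : ℕ} [NeZero n] {N : Fin n → Finset (Fin n)}
    (hk : 1 ≤ k) (hkn : k ≤ n) (hN : ∀ v, (N v).card ≤ degreeCap n k) {S₀ : Finset (Fin n)}
    (hS₀ : (coveredBy N S₀).card = M) (hM : k * ∑ v, (N v).card ≤ 514 * n * M)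
    (X : (Fin n × ℕ → Bool) → Finset (Fin n))
    (hX : ∀ ω v, v ∈ X ω ↔
      sampleLevel n (∑ v, (N v).card) ≤ trailingOnes (fun i => ω (v, i)) n) :
    1 - 2 / (n : ℝ) ≤
      (coinMeasure n).real {ω | Representative N k M (itemCap n) S₀ (X ω)} := by
  have : IsProbabilityMeasure (coinMeasure n) := by unfold coinMeasure; infer_instance
  set T := ∑ v, (N v).card with hT
  have hTn : T ≤ n * n := by
    refine (Finset.sum_le_card_nsmul _ _ n fun v _ => ?_).trans (by simp)
    simpa using Finset.card_le_univ (N v)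
  set j := sampleLevel n T with hj
  obtain ⟨hjn, hj1, hj2⟩ := sampleLevel_spec hTn
  rcases Nat.eq_zero_or_pos j with hj0 | hj0
  · have huniv : {ω | Representative N k M (itemCap n) S₀ (X ω)} = Set.univ := by
      refine Set.eq_univ_of_forall fun ω => ?_
      have hXu : X ω = Finset.univ := Finset.eq_univ_of_forall fun v => by
        rw [hX, hj0]; exact Nat.zero_le _
      refine ⟨?_, fun S _ hlt => ?_⟩
      · rw [hXu]
        rw [← hj, hj0, pow_zero, mul_one] at hj1
        refine hj1.trans ?_
        unfold sampleSize itemCap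
        omega
      · rw [hXu, Finset.inter_univ, Finset.inter_univ, hS₀]
        omega
    rw [huniv, probReal_univ]
    have : (0 : ℝ) ≤ 2 / n := by positivity
    linarith
  -- the coins of the machines, as independent random sequences
  set P : Measure (Fin n → ℕ → Bool) :=
    Measure.infinitePi fun _ => Measure.infinitePi fun _ => bitMeasure with hP
  have hmap : (coinMeasure n).map (MeasurableEquiv.curry (Fin n) ℕ Bool) = P :=
    Measure.infinitePi_map_curry fun _ _ => bitMeasure
  set E : Fin n → Set (Fin n → ℕ → Bool) := fun v => {c | c v ∈ levelEvent n j} with hE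
  have hEm : ∀ v, MeasurableSet (E v) := fun v =>
    (measurableSet_levelEvent hjn).preimage (measurable_pi_apply v)
  have hind : iIndepFun (fun v => (E v).indicator (1 : (Fin n → ℕ → Bool) → ℝ)) P :=
    iIndepFun_infinitePi (X := fun _ => (levelEvent n j).indicator (1 : (ℕ → Bool) → ℝ))
      fun _ => measurable_one.indicator (measurableSet_levelEvent hjn)
  have hprob : ∀ v, P.real (E v) = (1 / 2) ^ j := by
    intro v
    rw [← prob_levelEvent hjn, ← Measure.infinitePi_map_eval
      (fun _ : Fin n => Measure.infinitePi fun _ : ℕ => bitMeasure) v,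
      map_measureReal_apply (measurable_pi_apply v) (measurableSet_levelEvent hjn)]
    rfl
  have hTr : ∑ v, ((N v).card : ℝ) = T := by rw [hT]; push_cast; rfl
  have hwhp := representative_whp (P := P) hEm hind hprob (n := n) (by simp) hk hkn hN hS₀ hM
    (by
      rw [hTr, one_div_pow, one_div_mul_eq_div, div_le_iff₀ (by positivity)]
      exact_mod_cast hj1)
    (by
      rw [hTr, one_div_pow, one_div_mul_eq_div, mul_div_assoc', le_div_iff₀ (by positivity)]
      have h1 := hj2 (j - 1) (Nat.sub_lt hj0 one_pos)
      have h2 : 2 ^ j = 2 * 2 ^ (j - 1) := by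
        rw [← pow_succ', Nat.sub_add_cancel hj0]
      have h3 : sampleSize n * 2 ^ j ≤ 2 * T := by rw [h2]; nlinarith
      exact_mod_cast h3)
    (fun c => X ((MeasurableEquiv.curry (Fin n) ℕ Bool).symm c))
    (fun c v => by rw [hX]; rfl)
  set A : Set (Fin n → ℕ → Bool) := {c | ¬Representative N k M (itemCap n) S₀
    (X ((MeasurableEquiv.curry (Fin n) ℕ Bool).symm c))} with hA
  have hAeq : P.real A =
      (coinMeasure n).real {ω | ¬Representative N k M (itemCap n) S₀ (X ω)} := by
    rw [← hmap, Measure.real, MeasurableEquiv.map_apply, Measure.real]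
    rfl
  rw [hAeq] at hwhp
  have hcov : (1 : ℝ) ≤
      (coinMeasure n).real {ω | Representative N k M (itemCap n) S₀ (X ω)} +
      (coinMeasure n).real {ω | ¬Representative N k M (itemCap n) S₀ (X ω)} := by
    rw [← probReal_univ (μ := coinMeasure n)]
    refine (measureReal_mono ?_).trans (measureReal_union_le _ _)
    intro ω _
    exact em _
  linarith

end

/-! ### Delivery of messages -/

theorem sum_ind_eq_card (N : ℕ) (P : ℕ → Prop) [DecidablePred P] :
    ∑ i ∈ Finset.range N, ind (P i) = ((Finset.range N).filter P).card := by
  rw [Finset.card_filter]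
  refine Finset.sum_congr rfl fun i _ => ?_
  unfold ind
  congr

theorem card_filter_fin {n : ℕ} (P : ℕ → Prop) [DecidablePred fun u : Fin n => P u] :
    (Finset.univ.filter fun u : Fin n => P u).card = ∑ u ∈ Finset.range n, ind (P u) := by
  rw [← Fin.sum_univ_eq_sum_range (fun u => ind (P u)), Finset.card_filter]
  refine Finset.sum_congr rfl fun i _ => ?_
  unfold ind
  congr

theorem length_sentItems (N : ℕ) (P : ℕ → Prop) (d v : ℕ → ℕ) :
    (sentItems N P d v).length = ∑ i ∈ Finset.range N, ind (P i) := by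
  induction N with
  | zero => simp [sentItems]
  | succ N ih =>
    rw [sentItems_succ, List.length_append, ih, Finset.sum_range_succ, add_comm]
    by_cases h : P N <;> simp [sentItems, h, ind_true, ind_false]

theorem length_filter_sentItems (N : ℕ) (P : ℕ → Prop) (d v : ℕ → ℕ) (j : ℕ) :
    ((sentItems N P d v).filter fun m => m.1 = j).length =
      ∑ i ∈ Finset.range N, ind (P i ∧ d i = j) := by
  induction N with
  | zero => simp [sentItems]
  | succ N ih =>
    rw [sentItems_succ, List.filter_append, List.length_append, ih, Finset.sum_range_succ, add_comm]
    congr 1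
    by_cases h : P N <;> by_cases h' : d N = j <;>
      simp [sentItems, h, h', ind_true, ind_false]

theorem mem_deliver {n : ℕ} {s : Fin n → MachineState} {j : Fin n} {y z : ℕ} :
    (y, z) ∈ (deliverMessages s j).inbox ↔ ∃ i : Fin n, i.val = y ∧ (j.val, z) ∈ (s i).outbox := by
  simp only [deliverMessages, List.mem_flatMap, List.mem_finRange, true_and, List.mem_map,
    List.mem_filter, decide_eq_true_eq, Prod.mk.injEq, Prod.exists]
  constructor
  · rintro ⟨i, a, b, ⟨h1, rfl⟩, h2, rfl⟩
    exact ⟨i, h2, h1⟩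
  · rintro ⟨i, h1, h2⟩
    exact ⟨i, _, _, ⟨h2, rfl⟩, h1, rfl⟩

theorem length_deliver {n : ℕ} (s : Fin n → MachineState) (j : Fin n) :
    (deliverMessages s j).inbox.length =
      ∑ i, ((s i).outbox.filter fun m => m.1 = j.val).length := by
  simp only [deliverMessages, List.length_flatMap, List.length_map]
  rw [Fin.sum_univ_def]

theorem Fits.deliver {L : Budget} {n : ℕ} (hL : Suffices L n) {t : Fin n → MachineState}
    {j : Fin n} (h : Fits L (t j)) (hl : ItemsLt n (contentBound n) (deliverMessages t j).inbox)
    (hlen : (deliverMessages t j).inbox.length ≤ itemCap n) : Fits L (deliverMessages t j) :=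
  ⟨h.lt, h.zero, by
    have := hL.itemsFit hl hlen
    simpa [deliverMessages, itemBits] using this⟩

theorem Holds.deliver {n k a : ℕ} {t : Fin n → MachineState} {j : Fin n} (h : Holds (t j) n k a) :
    Holds (deliverMessages t j) n k a := ⟨h.n, h.k, h.self⟩

theorem le_itemCap (n : ℕ) : 2 * n ≤ itemCap n := by
  have := Nat.le_mul_of_pos_right n (bitLength_pos n)
  unfold itemCap
  omega

/-! ### The edges arrive at their end points -/

section
variable {n : ℕ}

/-- The items in the initial inbox. -/
def edgeItems (l : List (Fin n × Fin n)) : List (ℕ × ℕ) := l.map fun p => (p.1.val, p.2.val)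

theorem mem_edgeItems {l : List (Fin n × Fin n)} {a b : Fin n} :
    (a.val, b.val) ∈ edgeItems l ↔ (a, b) ∈ l := by
  simp [edgeItems, Fin.val_inj]

theorem edgeItems_lt (l : List (Fin n × Fin n)) : ItemsLt n (contentBound n) (edgeItems l) := by
  intro p hp
  obtain ⟨q, -, rfl⟩ := List.mem_map.1 hp
  exact ⟨q.1.2, q.2.2.trans_le (le_contentBound n)⟩

theorem mem_map_edge_iff {l : List (Fin n × Fin n)} {a b : Fin n} :
    s(a, b) ∈ l.map (fun p => s(p.1, p.2)) ↔ (a, b) ∈ l ∨ (b, a) ∈ l := by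
  rw [List.mem_map]
  constructor
  · rintro ⟨⟨x, y⟩, hp, h⟩
    rcases Sym2.eq_iff.1 h with ⟨rfl, rfl⟩ | ⟨rfl, rfl⟩
    · exact .inl hp
    · exact .inr hp
  · rintro (h | h)
    · exact ⟨_, h, rfl⟩
    · exact ⟨_, h, Sym2.eq_swap⟩

variable {G : SimpleGraph (Fin n)} {inp : Fin n → List (Fin n × Fin n)}

theorem IsEdgeSplit.adj_iff (h : IsEdgeSplit G inp) {a b : Fin n} :
    G.Adj a b ↔ ∃ i, (a, b) ∈ inp i ∨ (b, a) ∈ inp i := by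
  simp only [← mem_map_edge_iff]
  rw [← SimpleGraph.mem_edgeSet]
  constructor
  · intro hab
    by_contra! hne
    have := h.2.1 _ hab
    rw [Finset.sum_eq_zero fun i _ => List.count_eq_zero.2 (hne i)] at this
    exact zero_ne_one this
  · rintro ⟨i, hi⟩
    by_contra hab
    exact List.count_eq_zero.1 ((Finset.sum_eq_zero_iff.1 (h.2.2 _ hab)) i (Finset.mem_univ i)) hi

theorem IsEdgeSplit.sum_ind_le_one (h : IsEdgeSplit G inp) (a b : Fin n) :
    ∑ i, ind ((a, b) ∈ inp i ∨ (b, a) ∈ inp i) ≤ 1 := by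
  have h1 : ∑ i, ind ((a, b) ∈ inp i ∨ (b, a) ∈ inp i) ≤
      ∑ i, ((inp i).map fun p => s(p.1, p.2)).count s(a, b) := by
    refine Finset.sum_le_sum fun i _ => ?_
    by_cases hi : (a, b) ∈ inp i ∨ (b, a) ∈ inp i
    · rw [ind_true hi]
      exact List.one_le_count_iff.2 (mem_map_edge_iff.2 hi)
    · rw [ind_false hi]
      exact Nat.zero_le _
  by_cases hab : s(a, b) ∈ G.edgeSet
  · exact h1.trans (h.2.1 _ hab).le
  · exact h1.trans ((h.2.2 _ hab).le.trans zero_le_one)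

theorem mem_sentOne {l : List (Fin n × Fin n)} {a : Fin n} {z : ℕ} :
    (a.val, z) ∈ sentOne n (edgeItems l) ↔
      ∃ b : Fin n, b.val = z ∧ ((a, b) ∈ l ∨ (b, a) ∈ l) := by
  simp only [sentOne, mem_sentItems, Prod.mk.injEq]
  have hn : 0 < n := a.pos
  constructor
  · rintro ⟨i, hi, hP, h1, rfl⟩
    refine ⟨⟨i % n, Nat.mod_lt _ hn⟩, rfl, ?_⟩
    rw [h1] at hP
    rwa [← mem_edgeItems, ← mem_edgeItems]
  · rintro ⟨b, rfl, hP⟩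
    have h1 : (a.val * n + b.val) / n = a.val := by
      rw [add_comm, Nat.add_mul_div_right _ _ hn, Nat.div_eq_of_lt b.2, zero_add]
    have h2 : (a.val * n + b.val) % n = b.val := by
      rw [add_comm, Nat.add_mul_mod_self_right, Nat.mod_eq_of_lt b.2]
    refine ⟨a.val * n + b.val, ?_, ?_, h1, h2⟩
    · have := Nat.mul_le_mul_right n (Nat.succ_le_of_lt a.2)
      rw [Nat.succ_mul] at this
      omega
    · rwa [h1, h2, mem_edgeItems, mem_edgeItems]

theorem sentOne_lt (l : List (ℕ × ℕ)) :
    ItemsLt n (contentBound n) (sentOne n l) := by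
  intro p hp
  obtain ⟨i, hi, -, rfl⟩ := mem_sentItems.1 hp
  have hn : 0 < n := Nat.pos_of_ne_zero fun h => by simp [h] at hi
  exact ⟨Nat.div_lt_of_lt_mul hi, (Nat.mod_lt _ hn).trans_le (le_contentBound n)⟩

theorem length_sentOne_le (l : List (ℕ × ℕ)) :
    (sentOne n l).length ≤ 2 * l.length := by
  classical
  rw [sentOne, length_sentItems, sum_ind_eq_card]
  have h1 : ((Finset.range (n * n)).filter fun i => (i / n, i % n) ∈ l ∨ (i % n, i / n) ∈ l).card ≤
      (l.toFinset ∪ (l.map Prod.swap).toFinset).card := by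
    refine Finset.card_le_card_of_injOn (fun i => (i / n, i % n)) ?_ ?_
    · intro i hi
      rcases (Finset.mem_filter.1 hi).2 with h | h
      · exact Finset.mem_union_left _ (List.mem_toFinset.2 h)
      · exact Finset.mem_union_right _ (List.mem_toFinset.2 (List.mem_map.2 ⟨_, h, rfl⟩))
    · intro i _ j _ hij
      simp only [Prod.mk.injEq] at hij
      rw [← Nat.div_add_mod i n, ← Nat.div_add_mod j n, hij.1, hij.2]
  have h2 := Finset.card_union_le l.toFinset (l.map Prod.swap).toFinset
  have h3 := l.toFinset_card_le
  have h4 := (l.map Prod.swap).toFinset_card_le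
  rw [List.length_map] at h4
  omega

theorem length_filter_sentOne_le (l : List (Fin n × Fin n)) (a : Fin n) :
    ((sentOne n (edgeItems l)).filter fun m => m.1 = a.val).length ≤
      ∑ b, ind ((a, b) ∈ l ∨ (b, a) ∈ l) := by
  classical
  have hn : 0 < n := a.pos
  rw [sentOne, length_filter_sentItems, sum_ind_eq_card]
  have h1 : ∑ b, ind ((a, b) ∈ l ∨ (b, a) ∈ l) =
      (Finset.univ.filter fun b : Fin n => (a, b) ∈ l ∨ (b, a) ∈ l).card := by
    rw [Finset.card_filter]
    refine Finset.sum_congr rfl fun i _ => ?_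
    unfold ind
    congr
  rw [h1]
  refine Finset.card_le_card_of_injOn (fun i => ⟨i % n, Nat.mod_lt _ hn⟩) ?_ ?_
  · intro i hi
    obtain ⟨-, hP, h2⟩ := Finset.mem_filter.1 hi
    rw [h2] at hP
    refine Finset.mem_coe.2 (Finset.mem_filter.2 ⟨Finset.mem_univ _, ?_⟩)
    rwa [← mem_edgeItems, ← mem_edgeItems]
  · intro i hi j hj hij
    have hi' := (Finset.mem_filter.1 hi).2.2
    have hj' := (Finset.mem_filter.1 hj).2.2
    have hij : i % n = j % n := congrArg Fin.val hij
    rw [← Nat.div_add_mod i n, ← Nat.div_add_mod j n, hi', hj', hij]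

/-- Membership in the closed neighbourhood of `v`, for natural numbers. -/
def IsClosedNbr (G : SimpleGraph (Fin n)) (v : Fin n) (w : ℕ) : Prop :=
  ∃ h : w < n, ⟨w, h⟩ = v ∨ G.Adj v ⟨w, h⟩

open Classical in
/-- The closed neighbourhood of `v`: the vertices that dominate `v`. -/
noncomputable def closedNbhd (G : SimpleGraph (Fin n)) (v : Fin n) : Finset (Fin n) :=
  Finset.univ.filter fun u => IsClosedNbr G v u

open Classical in
/-- The truncated closed neighbourhood of `v`. -/
noncomputable def truncNbhd (G : SimpleGraph (Fin n)) (k : ℕ) (v : Fin n) : Finset (Fin n) :=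
  Finset.univ.filter fun u => Lowest (IsClosedNbr G v) (degreeCap n k) u

theorem mem_closedNbhd {v u : Fin n} : u ∈ closedNbhd G v ↔ u = v ∨ G.Adj v u := by
  simp only [closedNbhd, Finset.mem_filter, Finset.mem_univ, true_and]
  simp [IsClosedNbr]

theorem mem_truncNbhd {k : ℕ} {v u : Fin n} :
    u ∈ truncNbhd G k v ↔ Lowest (IsClosedNbr G v) (degreeCap n k) u := by
  simp [truncNbhd]

theorem truncNbhd_subset (k : ℕ) (v : Fin n) : truncNbhd G k v ⊆ closedNbhd G v := by
  intro u hu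
  simpa [closedNbhd] using (mem_truncNbhd.1 hu).1

theorem card_truncNbhd (k : ℕ) (v : Fin n) :
    (truncNbhd G k v).card = min (closedNbhd G v).card (degreeCap n k) := by
  classical
  unfold truncNbhd closedNbhd
  rw [card_filter_fin (Lowest (IsClosedNbr G v) (degreeCap n k)), card_filter_fin (IsClosedNbr G v),
    sum_ind_lowest]

/-! ### The run of the algorithm -/

/-- The four programs. -/
def algorithm : List RamProg := [roundOne, roundTwo, roundThree, roundFour]

/-- The level of machine `v`. -/
def coinLevel (ω : Fin n × ℕ → Bool) (v : Fin n) : ℕ := trailingOnes (fun i => ω (v, i)) n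

/-- The sample: the machines of sufficiently high level. -/
noncomputable def sampleSet (G : SimpleGraph (Fin n)) (k : ℕ) (ω : Fin n × ℕ → Bool) :
    Finset (Fin n) :=
  Finset.univ.filter fun v => sampleLevel n (∑ v, (truncNbhd G k v).card) ≤ coinLevel ω v

theorem mem_sampleSet {G : SimpleGraph (Fin n)} {k : ℕ} {ω : Fin n × ℕ → Bool} {v : Fin n} :
    v ∈ sampleSet G k ω ↔ sampleLevel n (∑ v, (truncNbhd G k v).card) ≤ coinLevel ω v := by
  simp [sampleSet]

theorem initial_fits {L : Budget} (hL : Suffices L n) (hR : 3 ≤ L.R) {k : ℕ} (hk : k ≤ n)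
    (hlen : ∀ i, (inp i).length ≤ n) (ω : Fin n × ℕ → Bool) (i : Fin n) :
    Fits L (initialStates k inp ω i) ∧ Holds (initialStates k inp ω i) n k i := by
  have hn : n < 2 ^ L.b := by have := hL.linear (c := 1) (by norm_num); omega
  have hi := i.2
  have hm : ∀ x, (initialStates k inp ω i).mem x =
      (if 0 = x then n else 0) + (if 1 = x then k else 0) + if 2 = x then i.val else 0 := by
    intro x
    simp [initialStates, Finsupp.single_apply]
  refine ⟨⟨fun x => ?_, fun x hx => ?_, ?_⟩, ⟨?_, ?_, ?_⟩⟩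
  · rw [hm]; split_ifs <;> omega
  · rw [hm]; split_ifs <;> omega
  · have h1 := hL.itemsFit (edgeItems_lt (inp i)) (by
      have := le_itemCap n
      have := hlen i
      simp only [edgeItems, List.length_map]
      omega)
    simpa [initialStates, itemBits, edgeItems] using h1
  · simp [hm]
  · simp [hm]
  · simp [hm]

theorem forall_deliver_one {k : ℕ} (hs : IsEdgeSplit G inp) {t : Fin n → MachineState}
    (ht : ∀ i, (t i).outbox = sentOne n (edgeItems (inp i))) (a : Fin n) :
    ItemsLt n (contentBound n) (deliverMessages t a).inbox ∧
    (deliverMessages t a).inbox.length ≤ n ∧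
    Closed n a (deliverMessages t a).inbox = IsClosedNbr G a ∧
    lowestCount n k a (deliverMessages t a).inbox = (truncNbhd G k a).card := by
  have hcl : Closed n a (deliverMessages t a).inbox = IsClosedNbr G a := by
    funext w
    refine propext ⟨?_, ?_⟩
    · rintro (rfl | ⟨i, -, hi⟩)
      · exact ⟨a.2, .inl rfl⟩
      · obtain ⟨i, rfl, hi'⟩ := mem_deliver.1 hi
        rw [ht, mem_sentOne] at hi'
        obtain ⟨b, rfl, hb⟩ := hi'
        exact ⟨b.2, .inr (hs.adj_iff.2 ⟨i, hb⟩)⟩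
    · rintro ⟨hw, h | h⟩
      · exact .inl (congrArg Fin.val h)
      · obtain ⟨i, hi⟩ := hs.adj_iff.1 h
        refine .inr ⟨i, i.2, mem_deliver.2 ⟨i, rfl, ?_⟩⟩
        rw [ht]
        exact mem_sentOne.2 ⟨_, rfl, hi⟩
  refine ⟨?_, ?_, hcl, ?_⟩
  · rintro ⟨y, z⟩ hp
    obtain ⟨i, rfl, hi⟩ := mem_deliver.1 hp
    rw [ht] at hi
    exact ⟨i.2, (sentOne_lt _ _ hi).2⟩
  · rw [length_deliver]
    calc ∑ i, ((t i).outbox.filter fun m => m.1 = a.val).length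
        ≤ ∑ i, ∑ b, ind ((a, b) ∈ inp i ∨ (b, a) ∈ inp i) := Finset.sum_le_sum fun i _ => by
          rw [ht]; exact length_filter_sentOne_le _ _
      _ = ∑ b, ∑ i, ind ((a, b) ∈ inp i ∨ (b, a) ∈ inp i) := Finset.sum_comm
      _ ≤ ∑ _b : Fin n, 1 := Finset.sum_le_sum fun b _ => hs.sum_ind_le_one a b
      _ = n := by simp
  · classical
    rw [lowestCount, hcl, truncNbhd, card_filter_fin (Lowest (IsClosedNbr G a) (degreeCap n k))]

theorem sum_mul_ind_eq {N x : ℕ} (hx : x < N) (F : ℕ → ℕ) :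
    ∑ y ∈ Finset.range N, F y * ind (y = x) = F x := by
  rw [Finset.sum_eq_single x]
  · rw [ind_true rfl, mul_one]
  · intro y _ hy
    rw [ind_false hy, mul_zero]
  · intro h
    exact absurd (Finset.mem_range.2 hx) h

theorem forall_deliver_two {t : Fin n → MachineState} {r : Fin n → ℕ}
    (hr : ∀ i, r i < contentBound n)
    (ht : ∀ i, (t i).outbox = sentItems n (fun _ => True) (fun i => i) (fun _ => r i))
    (a : Fin n) :
    ItemsLt n (contentBound n) (deliverMessages t a).inbox ∧
    (deliverMessages t a).inbox.length ≤ n ∧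
    totalDegree n (deliverMessages t a).inbox = ∑ i, r i / (n + 1) ∧
    ∀ j, sampleLoad n j (deliverMessages t a).inbox =
      ∑ i, r i / (n + 1) * ind (j ≤ r i % (n + 1)) := by
  have hmem : ∀ (i : Fin n) z, (i.val, z) ∈ (deliverMessages t a).inbox ↔ z = r i := by
    intro i z
    simp only [mem_deliver, ht, mem_sentItems, Prod.mk.injEq, true_and]
    constructor
    · rintro ⟨i', hi', x, -, -, rfl⟩
      rw [Fin.ext hi']
    · rintro rfl
      exact ⟨i, rfl, a, a.2, rfl, rfl⟩
  refine ⟨?_, ?_, ?_, ?_⟩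
  · rintro ⟨y, z⟩ hp
    obtain ⟨i, rfl, hi⟩ := mem_deliver.1 hp
    exact ⟨i.2, by rw [(hmem i z).1 hp]; exact hr i⟩
  · rw [length_deliver]
    calc ∑ i, ((t i).outbox.filter fun m => m.1 = a.val).length = ∑ _i : Fin n, 1 := by
          refine Finset.sum_congr rfl fun i _ => ?_
          rw [ht, length_filter_sentItems]
          have := sum_mul_ind_eq a.2 fun _ => 1
          simpa using this
      _ ≤ n := by simp
  · rw [totalDegree, ← Fin.sum_univ_eq_sum_range (fun i => ∑ x ∈ Finset.range (contentBound n),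
      x / (n + 1) * ind ((i, x) ∈ (deliverMessages t a).inbox))]
    refine Finset.sum_congr rfl fun i _ => ?_
    simp only [hmem]
    exact sum_mul_ind_eq (hr i) fun x => x / (n + 1)
  · intro j
    rw [sampleLoad, ← Fin.sum_univ_eq_sum_range (fun i => ∑ x ∈ Finset.range (contentBound n),
      x / (n + 1) * ind (j ≤ x % (n + 1)) * ind ((i, x) ∈ (deliverMessages t a).inbox))]
    refine Finset.sum_congr rfl fun i _ => ?_
    simp only [hmem]
    exact sum_mul_ind_eq (hr i) fun x => x / (n + 1) * ind (j ≤ x % (n + 1))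

theorem report_div (n k a : ℕ) (l : List (ℕ × ℕ)) (c : ℕ → Bool) :
    report n k a l c / (n + 1) = lowestCount n k a l ∧
      report n k a l c % (n + 1) = trailingOnes c n := by
  have h := Nat.lt_succ_of_le (trailingOnes_le c n)
  unfold report
  constructor
  · rw [add_comm, Nat.add_mul_div_right _ _ n.succ_pos, Nat.div_eq_of_lt h, zero_add]
  · rw [add_comm, Nat.add_mul_mod_self_right, Nat.mod_eq_of_lt h]

/-- The run of the algorithm. Machine `0` finally outputs the best solution with respect to a list
of items, and these items are the truncated neighbourhoods of the sample, if the sample is not too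
large. -/
theorem exists_run [NeZero n] {L : Budget} (hL : Suffices L n)
    (hR : ∀ p ∈ algorithm, p.regBound ≤ L.R) {k : ℕ} (hk : k ≤ n) (hs : IsEdgeSplit G inp)
    (ω : Fin n × ℕ → Bool) :
    ∃ (final : Fin n → MachineState) (l : List (ℕ × ℕ)),
      DistributedRun L.total algorithm (initialStates k inp ω) final ∧
      (final 0).outbox = sentFour n k l ∧
      (∑ v ∈ sampleSet G k ω, (truncNbhd G k v).card ≤ itemCap n →
        ∀ v u : Fin n, (v.val, u.val) ∈ l ↔ v ∈ sampleSet G k ω ∧ u ∈ truncNbhd G k v) := by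
  have hn : 1 ≤ n := hL.pos
  have hcap := le_itemCap n
  simp only [algorithm, List.forall_mem_cons] at hR
  obtain ⟨hR1, hR2, hR3, hR4, -⟩ := hR
  have hR3' : 3 ≤ L.R := le_trans (by
    simp only [roundOne, recvP, RamProg.regBound, RamInstr.regBound]; omega) hR1
  -- first round
  have round1 : ∀ i, ∃ t, RamExec L.total roundOne (initialStates k inp ω i) t ∧ Fits L t ∧
      Holds t n k i ∧ t.outbox = sentOne n (edgeItems (inp i)) ∧ t.coins = fun m => ω (i, m) := by
    intro i
    obtain ⟨hf, hh⟩ := initial_fits hL hR3' hk hs.1 ω i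
    have hlen : (edgeItems (inp i)).length ≤ n := by
      simp only [edgeItems, List.length_map]; exact hs.1 i
    have h1 := length_sentOne_le (n := n) (edgeItems (inp i))
    exact exec_roundOne hL hR1 hf hh (edgeItems_lt _) (hlen.trans (by omega)) rfl
      (hL.itemsFit (sentOne_lt _) (h1.trans (by omega)))
  choose t1 ht1 hf1 hh1 ho1 hc1 using round1
  -- second round
  have d1 := forall_deliver_one (k := k) hs ho1
  set l1 : Fin n → List (ℕ × ℕ) := fun a => (deliverMessages t1 a).inbox with hl1
  have hrlt : ∀ i : Fin n, report n k i (l1 i) (fun m => ω (i, m)) < contentBound n :=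
    fun i => report_lt _ _ _ _ _
  have round2 : ∀ i, ∃ t, RamExec L.total roundTwo (deliverMessages t1 i) t ∧ Fits L t ∧
      Holds t n k i ∧ t.mem 9 = listCode n (contentBound n) (l1 i) ∧ t.mem 12 = coinLevel ω i ∧
      t.outbox = sentTwo n k i (l1 i) (fun m => ω (i, m)) := by
    intro i
    obtain ⟨hlt, hlen, -, -⟩ := d1 i
    have hco : (deliverMessages t1 i).coins = fun m => ω (i, m) := hc1 i
    have h2 := exec_roundTwo hL hR2 (Fits.deliver hL (hf1 i) hlt (by omega)) (hh1 i).deliver hlt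
      (by omega) rfl
    rw [hco] at h2
    refine h2 (hL.itemsFit ?_ ?_)
    · intro p hp
      obtain ⟨x, hx, -, rfl⟩ := mem_sentItems.1 hp
      exact ⟨hx, hrlt i⟩
    · rw [sentTwo, length_sentItems]
      exact (sum_ind_le _ _).trans (by omega)
  choose t2 ht2 hf2 hh2 h92 h122 ho2 using round2
  -- third round
  have d2 := forall_deliver_two hrlt ho2
  set l2 : Fin n → List (ℕ × ℕ) := fun a => (deliverMessages t2 a).inbox with hl2
  set T := ∑ v, (truncNbhd G k v).card with hT
  have htot : ∀ a, totalDegree n (l2 a) = T := by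
    intro a
    rw [(d2 a).2.2.1]
    exact Finset.sum_congr rfl fun i _ => (report_div _ _ _ _ _).1.trans (d1 i).2.2.2
  have hload : ∀ a, sampleLoad n (sampleLevel n T) (l2 a) =
      ∑ v ∈ sampleSet G k ω, (truncNbhd G k v).card := by
    intro a
    rw [(d2 a).2.2.2, sampleSet, Finset.sum_filter]
    refine Finset.sum_congr rfl fun i _ => ?_
    rw [(report_div _ _ _ _ _).1, (report_div _ _ _ _ _).2, (d1 i).2.2.2]
    change _ * ind (sampleLevel n T ≤ coinLevel ω i) = _
    split_ifs with h
    · rw [ind_true h, mul_one]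
    · rw [ind_false h, mul_zero]
  -- all machines agree on whether the sample is small enough to be sent
  obtain ⟨small, hsmall⟩ :
      ∃ q : Prop, q = (∑ v ∈ sampleSet G k ω, (truncNbhd G k v).card ≤ itemCap n) := ⟨_, rfl⟩
  have round3 : ∀ i, ∃ t, RamExec L.total roundThree (deliverMessages t2 i) t ∧ Fits L t ∧
      Holds t n k i ∧ t.outbox = sentItems n (fun u => (small ∧ i ∈ sampleSet G k ω) ∧
        Lowest (IsClosedNbr G i) (degreeCap n k) u) (fun _ => 0) (fun u => u) := by
    intro i
    obtain ⟨hlt, hlen, hcl, -⟩ := d1 i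
    obtain ⟨hlt', hlen', -, -⟩ := d2 i
    have h3 := exec_roundThree hL hR3 (Fits.deliver hL (hf2 i) hlt' (by omega)) (hh2 i).deliver
      (h92 i) (h122 i) hlt (hlen.trans (by omega)) hlt' (hlen'.trans (by omega)) rfl
    have hsent : sentThree n k i (coinLevel ω i) (l1 i) (deliverMessages t2 i).inbox =
        sentItems n (fun u => (small ∧ i ∈ sampleSet G k ω) ∧
        Lowest (IsClosedNbr G i) (degreeCap n k) u) (fun _ => 0) (fun u => u) := by
      change sentThree n k i (coinLevel ω i) (l1 i) (l2 i) = _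
      rw [sentThree, htot, hload, hcl]
      simp only [hsmall, sampleSet, Finset.mem_filter, Finset.mem_univ, true_and]
      rfl
    rw [hsent] at h3
    refine h3 (hL.itemsFit ?_ ?_)
    · intro p hp
      obtain ⟨x, hx, -, rfl⟩ := mem_sentItems.1 hp
      exact ⟨hn, hx.trans_le (le_contentBound n)⟩
    · rw [length_sentItems]
      exact (sum_ind_le _ _).trans (by omega)
  choose t3 ht3 hf3 hh3 ho3 using round3
  -- fourth round
  have round4 : ∀ i, ∃ t, RamExec L.total roundFour (deliverMessages t3 i) t ∧
      t.outbox = sentFour n k (deliverMessages t3 i).inbox := by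
    intro i
    have hlt : ItemsLt n (contentBound n) (deliverMessages t3 i).inbox := by
      rintro ⟨y, z⟩ hp
      obtain ⟨j, rfl, hj⟩ := mem_deliver.1 hp
      rw [ho3] at hj
      obtain ⟨x, hx, -, he⟩ := mem_sentItems.1 hj
      simp only [Prod.mk.injEq] at he
      exact ⟨j.2, by rw [← he.2]; exact hx.trans_le (le_contentBound n)⟩
    have hlen : (deliverMessages t3 i).inbox.length ≤ itemCap n := by
      rw [length_deliver]
      have h1 : ∀ j, ((t3 j).outbox.filter fun m => m.1 = i.val).length ≤
          ind small * if j ∈ sampleSet G k ω then (truncNbhd G k j).card else 0 := by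
        classical
        intro j
        rw [ho3, length_filter_sentItems]
        by_cases h : small ∧ j ∈ sampleSet G k ω
        · rw [ind_true h.1, if_pos h.2, one_mul, truncNbhd,
            card_filter_fin (Lowest (IsClosedNbr G j) (degreeCap n k))]
          refine Finset.sum_le_sum fun u _ => ?_
          by_cases h' : Lowest (IsClosedNbr G j) (degreeCap n k) u
          · rw [ind_true h']; exact ind_le_one _
          · rw [ind_false fun h'' => h' h''.1.2]; exact Nat.zero_le _
        · rw [Finset.sum_eq_zero fun u _ => ind_false fun h'' => h h''.1.1]
          exact Nat.zero_le _
      refine (Finset.sum_le_sum fun j _ => h1 j).trans ?_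
      rw [← Finset.mul_sum, Finset.sum_ite_mem, Finset.univ_inter]
      by_cases h : small
      · rw [ind_true h, one_mul]; exact hsmall.mp h
      · rw [ind_false h, zero_mul]; exact Nat.zero_le _
    refine exec_roundFour hL hR4 (Fits.deliver hL (hf3 i) hlt hlen) (hh3 i).deliver hlt hlen rfl
      (hL.itemsFit ?_ ?_)
    · intro p hp
      obtain ⟨x, hx, -, rfl⟩ := mem_sentItems.1 hp
      exact ⟨hn, hx.trans_le (le_contentBound n)⟩
    · rw [sentFour, length_sentItems]
      exact (sum_ind_le _ _).trans (by omega)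
  choose t4 ht4 ho4 using round4
  refine ⟨t4, (deliverMessages t3 0).inbox, .next ht1 (.next ht2 (.next ht3 (.last ht4))), ho4 0,
    fun hsm v u => ?_⟩
  simp only [mem_deliver, ho3, mem_sentItems, Prod.mk.injEq, mem_truncNbhd]
  constructor
  · rintro ⟨i, hi, x, -, ⟨⟨-, h1⟩, h2⟩, -, rfl⟩
    rw [← Fin.ext hi]
    exact ⟨h1, h2⟩
  · rintro ⟨h1, h2⟩
    exact ⟨v, rfl, u, u.2, ⟨⟨hsmall.mpr hsm, h1⟩, h2⟩, rfl, rfl⟩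

end

/-! ### The output -/

section
variable {n : ℕ}

/-- The set with a given bit mask. -/
def bitSet (n m : ℕ) : Finset (Fin n) := Finset.univ.filter fun u => m.testBit u = true

theorem exists_bitSet_eq (S : Finset (Fin n)) : ∃ m < 2 ^ n, bitSet n m = S := by
  refine ⟨Nat.ofBits fun u => decide (u ∈ S), Nat.ofBits_lt_two_pow _, ?_⟩
  ext u
  simp [bitSet]

open Classical in
/-- The number of vertices that `S` covers according to the list `l`. -/
noncomputable def listScore (l : List (ℕ × ℕ)) (S : Finset (Fin n)) : ℕ :=
  (Finset.univ.filter fun v : Fin n => ∃ u ∈ S, (v.val, u.val) ∈ l).card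

theorem searchKey_eq (k : ℕ) (l : List (ℕ × ℕ)) (m : ℕ) :
    searchKey n k l m = ind ((bitSet n m).card = k) * (1 + listScore l (bitSet n m)) := by
  classical
  have h : ∀ v, (∃ u < n, m.testBit u = true ∧ (v, u) ∈ l) ↔
      ∃ u ∈ bitSet n m, (v, u.val) ∈ l := by
    intro v
    constructor
    · rintro ⟨u, hu, h1, h2⟩
      exact ⟨⟨u, hu⟩, by simpa [bitSet] using h1, h2⟩
    · rintro ⟨u, hu, h2⟩
      exact ⟨u, u.2, by simpa [bitSet] using hu, h2⟩
  have h' : (bitSet n m).card = ∑ u ∈ Finset.range n, ind (m.testBit u = true) :=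
    card_filter_fin fun u => m.testBit u = true
  rw [searchKey, h', listScore, card_filter_fin (fun v => ∃ u ∈ bitSet n m, (v, u.val) ∈ l)]
  simp only [h]

/-- The output is optimal with respect to the list that machine `0` holds. -/
theorem exists_reported [NeZero n] {k : ℕ} (hk : k ≤ n) {t : Fin n → MachineState}
    {l : List (ℕ × ℕ)} (ht : (t 0).outbox = sentFour n k l) :
    ∃ S : Finset (Fin n), ReportsSet t S ∧ S.card = k ∧
      ∀ T : Finset (Fin n), T.card = k → listScore l T ≤ listScore l S := by
  set m := argmaxFrom (searchKey n k l) (2 ^ n) (2 ^ n) with hm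
  have hmax : ∀ T : Finset (Fin n), T.card = k → 1 + listScore l T ≤ searchKey n k l m := by
    intro T hT
    obtain ⟨x, hx, hxT⟩ := exists_bitSet_eq T
    have h1 := le_argmaxFrom (searchKey n k l) (N := 2 ^ n) (j := 2 ^ n) (by omega) hx
    rwa [searchKey_eq, hxT, ind_true hT, one_mul] at h1
  obtain ⟨T₀, -, hT₀⟩ := Finset.exists_superset_card_eq (s := (∅ : Finset (Fin n))) (n := k)
    (by simp) (by simpa using hk)
  have hcard : (bitSet n m).card = k := by
    by_contra hne
    have h1 := hmax T₀ hT₀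
    rw [searchKey_eq, ind_false hne] at h1
    omega
  refine ⟨bitSet n m, ?_, hcard, fun T hT => ?_⟩
  · rw [ReportsSet, ht]
    ext x
    simp only [List.mem_toFinset, List.mem_map, Finset.mem_map, Prod.exists, sentFour,
      mem_sentItems, Prod.mk.injEq, bitSet, Finset.mem_filter, Finset.mem_univ, true_and,
      Fin.valEmbedding_apply]
    constructor
    · rintro ⟨a, b, ⟨i, hi, hb, -, rfl⟩, rfl⟩
      exact ⟨⟨i, hi⟩, hb, rfl⟩
    · rintro ⟨u, hu, rfl⟩
      exact ⟨0, u, ⟨u, u.2, hu, rfl, rfl⟩, rfl⟩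
  · have h1 := hmax T hT
    rw [searchKey_eq, ind_true hcard, one_mul] at h1
    omega

theorem ncard_dominatedSet (G : SimpleGraph (Fin n)) (S : Finset (Fin n)) :
    (dominatedSet G S).ncard = (coveredBy (closedNbhd G) S).card := by
  rw [← Set.ncard_coe_finset]
  congr 1
  ext v
  simp only [dominatedSet, Set.mem_ofPred_eq, Finset.mem_coe, mem_coveredBy, mem_closedNbhd]
  constructor
  · rintro (h | ⟨u, hu, h⟩)
    · exact ⟨v, h, .inl rfl⟩
    · exact ⟨u, hu, .inr h.symm⟩
  · rintro ⟨u, hu, rfl | h⟩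
    · exact .inl hu
    · exact .inr ⟨u, hu, h.symm⟩

theorem listScore_eq {G : SimpleGraph (Fin n)} {k : ℕ} {X : Finset (Fin n)} {l : List (ℕ × ℕ)}
    (hl : ∀ v u : Fin n, (v.val, u.val) ∈ l ↔ v ∈ X ∧ u ∈ truncNbhd G k v)
    (S : Finset (Fin n)) : listScore l S = (coveredBy (truncNbhd G k) S ∩ X).card := by
  unfold listScore
  congr 1
  ext v
  simp only [hl, Finset.mem_filter, Finset.mem_univ, true_and, Finset.mem_inter, mem_coveredBy]
  constructor
  · rintro ⟨u, hu, hv, h⟩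
    exact ⟨⟨u, hu, h⟩, hv⟩
  · rintro ⟨⟨u, hu, h⟩, hv⟩
    exact ⟨u, hu, hv, h⟩

/-- The loss by truncation and the loss by sampling together leave more than `1 - 1 / e`. -/
theorem one_sub_inv_exp_le : 1 - 1 / Real.exp 1 ≤ 165 / 256 := by
  have h1 := Real.exp_one_lt_d9
  have h2 : 1 / 2.7182818286 ≤ 1 / Real.exp 1 :=
    one_div_le_one_div_of_le (Real.exp_pos 1) h1.le
  have h3 : (91 : ℝ) / 256 ≤ 1 / 2.7182818286 := by norm_num
  linarith

/-- The optimum for truncated neighbourhoods: it is close to the true optimum, and it is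
proportional to the total truncated degree. -/
theorem exists_optimum [NeZero n] (G : SimpleGraph (Fin n)) {k : ℕ} (hk1 : 1 ≤ k) (hk : k ≤ n) :
    ∃ S₀ : Finset (Fin n), S₀.card = k ∧
      (∀ T : Finset (Fin n), T.card = k →
        15 * (coveredBy (closedNbhd G) T).card ≤ 16 * (coveredBy (truncNbhd G k) S₀).card) ∧
      k * ∑ v, (truncNbhd G k v).card ≤ 514 * n * (coveredBy (truncNbhd G k) S₀).card := by
  have hk' : k ≤ Fintype.card (Fin n) := by simpa using hk
  have hdiv := Nat.div_mul_le_self (512 * n) k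
  obtain ⟨S₁, hS₁, hS₁'⟩ := exists_covered_ge (truncNbhd G k) hk' (by
    intro v
    rw [Fintype.card_fin]
    have h1 : (truncNbhd G k v).card ≤ degreeCap n k := by
      rw [card_truncNbhd]; exact min_le_right _ _
    have h2 : degreeCap n k * k ≤ 513 * n := by unfold degreeCap; nlinarith
    exact (Nat.mul_le_mul_right _ h1).trans h2)
  obtain ⟨S₀, hS₀, hmax⟩ := Finset.exists_max_image (Finset.powersetCard k Finset.univ)
    (fun S => (coveredBy (truncNbhd G k) S).card) ⟨S₁, by simp [hS₁]⟩
  simp only [Finset.mem_powersetCard, Finset.subset_univ, true_and] at hS₀ hmax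
  refine ⟨S₀, hS₀, fun T hT => ?_, ?_⟩
  · obtain ⟨S, hS, hle⟩ := exists_covered_truncated (truncNbhd_subset (G := G) k)
      (card_truncNbhd k) (by
        rw [Fintype.card_fin]
        have h1 := Nat.lt_mul_div_succ (512 * n) hk1
        unfold degreeCap
        exact h1.le.trans (le_of_eq (mul_comm _ _))) hk' hT
    exact hle.trans (Nat.mul_le_mul_left _ (hmax S hS))
  · rw [Fintype.card_fin] at hS₁'
    exact hS₁'.trans (Nat.mul_le_mul_left _ (hmax S₁ hS₁))

theorem approx_of_representative {G : SimpleGraph (Fin n)} {k : ℕ} {S₀ X S : Finset (Fin n)}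
    (hS₀ : S₀.card = k) (hopt : ∀ T : Finset (Fin n), T.card = k →
      15 * (coveredBy (closedNbhd G) T).card ≤ 16 * (coveredBy (truncNbhd G k) S₀).card)
    (hrep : Representative (truncNbhd G k) k (coveredBy (truncNbhd G k) S₀).card (itemCap n) S₀ X)
    {l : List (ℕ × ℕ)} (hl : ∀ v u : Fin n, (v.val, u.val) ∈ l ↔ v ∈ X ∧ u ∈ truncNbhd G k v)
    (hS : S.card = k)
    (hmax : ∀ T : Finset (Fin n), T.card = k → listScore l T ≤ listScore l S) {ε : ℝ}
    (hε : 0 < ε) : IsApproxKDominating G k (1 - 1 / Real.exp 1 - ε) S := by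
  refine ⟨hS, fun T hT => ?_⟩
  rw [ncard_dominatedSet, ncard_dominatedSet]
  have h1 : 11 * (coveredBy (truncNbhd G k) S₀).card ≤ 16 * (coveredBy (truncNbhd G k) S).card := by
    by_contra! h
    have h2 := hrep.separates S hS h
    have h3 := hmax S₀ hS₀
    rw [listScore_eq hl, listScore_eq hl] at h3
    omega
  have h2 := hopt T hT
  have h3 := Finset.card_le_card (coveredBy_mono (truncNbhd_subset (G := G) k) (subset_refl S))
  have h4 : 165 * (coveredBy (closedNbhd G) T).card ≤ 256 * (coveredBy (closedNbhd G) S).card := by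
    omega
  have h5 : (165 : ℝ) * (coveredBy (closedNbhd G) T).card ≤
      256 * (coveredBy (closedNbhd G) S).card := by exact_mod_cast h4
  have h6 := one_sub_inv_exp_le
  have h7 : (0 : ℝ) ≤ (coveredBy (closedNbhd G) T).card := Nat.cast_nonneg _
  nlinarith

end

/-- The budget for `n` machines whose programs use `R` registers. -/
def budgetFor (R n : ℕ) : Budget where
  R := R
  b := 2 ^ 24 * (n * bitLength n ^ 2)
  J := 2 ^ 24 * (n * bitLength n ^ 2)

theorem budgetFor_total_le (R : ℕ) {n : ℕ} (hn : 1 ≤ n) :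
    (budgetFor R n).total ≤ (R * R + R * 2 ^ 24 + 2 ^ 24) * n * (Nat.log 2 n + 1) ^ 2 := by
  have h1 : 1 ≤ n * bitLength n ^ 2 :=
    Nat.one_le_iff_ne_zero.2 (Nat.mul_ne_zero (by omega)
      (pow_ne_zero _ (Nat.one_le_iff_ne_zero.1 (bitLength_pos n))))
  change R * (R + 2 ^ 24 * (n * bitLength n ^ 2)) + 2 ^ 24 * (n * bitLength n ^ 2) ≤
    (R * R + R * 2 ^ 24 + 2 ^ 24) * n * bitLength n ^ 2
  have h2 := Nat.mul_le_mul_left (R * R) h1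
  calc R * (R + 2 ^ 24 * (n * bitLength n ^ 2)) + 2 ^ 24 * (n * bitLength n ^ 2)
      = R * R * 1 + (R * 2 ^ 24 + 2 ^ 24) * (n * bitLength n ^ 2) := by ring
    _ ≤ R * R * (n * bitLength n ^ 2) + (R * 2 ^ 24 + 2 ^ 24) * (n * bitLength n ^ 2) :=
        Nat.add_le_add_right h2 _
    _ = _ := by ring

theorem RamExec.mono {B B' : ℕ} (hB : B ≤ B') {p : RamProg} {s t : MachineState}
    (h : RamExec B p s t) : RamExec B' p s t := by
  induction h with
  | skip h => exact .skip (h.trans hB)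
  | instr h h' => exact .instr (h.trans hB) (h'.trans hB)
  | seq _ _ ih ih' => exact .seq ih ih'
  | iteTrue h _ ih => exact .iteTrue h ih
  | iteFalse h _ ih => exact .iteFalse h ih
  | loopStop h h' => exact .loopStop (h.trans hB) h'
  | loopStep h _ _ ih ih' => exact .loopStep h ih ih'

theorem DistributedRun.mono {n B B' : ℕ} (hB : B ≤ B') {P : List RamProg}
    {s t : Fin n → MachineState} (h : DistributedRun B P s t) : DistributedRun B' P s t := by
  induction h with
  | last h => exact .last fun i => (h i).mono hB
  | next h _ ih => exact .next (fun i => (h i).mono hB) ih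

theorem mainTheorem6 :
    ∃ c : ℕ, ∀ ε : ℝ, 0 < ε → ε ≤ 1 →
      ∃ (C : ℕ) (P : List RamProg), P.length = 4 ∧
        ∀ (n : ℕ) [NeZero n] (k : ℕ), k ≤ n →
          ∀ (G : SimpleGraph (Fin n)) (inp : Fin n → List (Fin n × Fin n)), IsEdgeSplit G inp →
            ∃ final : (Fin n × ℕ → Bool) → Fin n → MachineState,
              (∀ ω, DistributedRun (C * n * (Nat.log 2 n + 1) ^ c) P
                (initialStates k inp ω) (final ω)) ∧
              1 - 2 / (n : ℝ) ≤ (coinMeasure n).real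
                {ω | ∃ S : Finset (Fin n), ReportsSet (final ω) S ∧
                  IsApproxKDominating G k (1 - 1 / Real.exp 1 - ε) S} := by
  obtain ⟨R, hR⟩ : ∃ R, ∀ p ∈ algorithm, p.regBound ≤ R :=
    ⟨max roundOne.regBound (max roundTwo.regBound (max roundThree.regBound roundFour.regBound)), by
      simp [algorithm]⟩
  refine ⟨2, fun ε hε _ => ⟨R * R + R * 2 ^ 24 + 2 ^ 24, algorithm, rfl, ?_⟩⟩
  intro n _ k hk G inp hs
  have hn : 1 ≤ n := Nat.one_le_iff_ne_zero.2 (NeZero.ne n)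
  have hL : Suffices (budgetFor R n) n := ⟨hn, le_rfl, le_rfl⟩
  choose final l hrun hout hl using exists_run (G := G) hL hR hk hs
  refine ⟨final, fun ω => (hrun ω).mono (budgetFor_total_le R hn), ?_⟩
  have : MeasureTheory.IsProbabilityMeasure (coinMeasure n) := by
    unfold coinMeasure; infer_instance
  rcases Nat.eq_zero_or_pos k with rfl | hk1
  · -- the empty set is the only candidate
    have huniv : {ω | ∃ S : Finset (Fin n), ReportsSet (final ω) S ∧
        IsApproxKDominating G 0 (1 - 1 / Real.exp 1 - ε) S} = Set.univ := by
      refine Set.eq_univ_of_forall fun ω => ?_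
      obtain ⟨S, hS, hSk, -⟩ := exists_reported hk (hout ω)
      refine ⟨S, hS, hSk, fun T hT => ?_⟩
      rw [Finset.card_eq_zero.1 hT, Finset.card_eq_zero.1 hSk]
      simp [dominatedSet]
    rw [huniv, MeasureTheory.probReal_univ]
    have : (0 : ℝ) ≤ 2 / n := by positivity
    linarith
  obtain ⟨S₀, hS₀, hopt, hdeg⟩ := exists_optimum G hk1 hk
  refine (representative_level_whp hk1 hk (N := truncNbhd G k)
    (fun v => by rw [card_truncNbhd]; exact min_le_right _ _) rfl hdeg (sampleSet G k)
    (fun ω v => mem_sampleSet)).trans (MeasureTheory.measureReal_mono ?_)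
  intro ω hrep
  obtain ⟨S, hS, hSk, hmax⟩ := exists_reported hk (hout ω)
  exact ⟨S, hS, approx_of_representative hS₀ hopt hrep (hl ω hrep.small) hSk hmax hε⟩
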